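/- **Setting.** Let $K=(S,\hookrightarrow,S_0,AP,\mathcal L)$ be a Kripke structure with finitely many states; its traces are the words $\mathcal L(s_0)\mathcal L(s_1)\dots\in(2^{AP})^\omega$ with $s_0\in S_0$ and $s_i\hookrightarrow s_{i+1}$. Let $T$ be a repair machine with finite state set $Q$, initial states $Q_0$, final states $Q_f$, and transitions $(q,a,q',w,c)$ (read the letter $a\in 2^{AP}$, write $w\in\Gamma^*$, pay $c\in\mathbb N$). Let $B$ be a nondeterministic Büchi automaton over $\Gamma$ with finite state set $P$, initial states $P_0$, final states $P_f$ and language $L(B)\subseteq\Gamma^\omega$. A run of $T$ on $u$ starts in $Q_0$ and is accepting if it visits $Q_f$ infinitely often. Its cost is $\mathsf{Mean}(c_0c_1\dots)=\limsup_{n\to\infty}\frac1n\sum_{i<n}c_i$. The cost of rewriting $u$ to $v\in\Gamma^\omega$ is the infimum of the costs of the accepting runs of $T$ on $u$ with output $v$. The impair threshold $\tau^*\in[0,\infty]$ is the infimum of all real $\tau\ge0$ such that some trace of $K$ can be rewritten to some word of $L(B)$ at cost at most $\tau$ ($\tau^*=\infty$ if there is none). **Product.** The graph $G^\times$ has the vertices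 $S\times Q\times P\times\{1,2\}$. There is a step $(s,q,p,i)\to(s',q',p',i')$ with output $w$ and cost $c$ if $s\hookrightarrow s'$, $(q,\mathcal L(s),q',w,c)$ is a transition of $T$, $B$ has a run from $p$ to $p'$ on $w$, and: if $i=1$, then $i'=2$ exactly when $q'\in Q_f$; if $i=2$, then $i'=1$ exactly when this run of $B$ enters $P_f$ while reading $w$ (after at least one letter). Edges are the pairs of vertices joined by a step; the weight $W$ of an edge is the least cost of a step along it. Initial vertices are those in $S_0\times Q_0\times P_0\times\{1\}$. An edge from counter value $2$ to counter value $1$ is accepting; a cycle or closed walk is accepting if it uses an accepting edge. **Theorem.** (1) If no accepting cycle of $G^\times$ is reachable from an initial vertex, then $\tau^*=\infty$. Otherwise, among the cycles of $G^\times$ that are reachable from, and can reach, an accepting cycle that is reachable from an initial vertex, there is one of least mean weight, and $\tau^*$ equals the mean weight of every such least-mean cycle. (2) In the second case, consider strategies of the player who chooses everything: the initial vertex and then, depending on the history, the output word and the next vertex. Call such a strategy successful if its play is an infinite path of $G^\times$ from an initial vertex with infinitely many accepting edges, and the outputs together with the weights of the edges form an accepting run of $T$ on the corresponding trace of $K$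 whose output lies in $L(B)$. There are a least-mean cycle $C$, an accepting closed walk $D$ that starts at the same vertex as $C$, and a successful strategy that proceeds in infinitely many rounds after a finite prefix, going in round $i=0,1,2,\dots$ exactly $2^i$ times around $C$ and then once around $D$ (so that unbounded memory is used to count), with cost exactly $\tau^*$. For every $\varepsilon>0$ there is a successful strategy with finite memory and cost at most $\tau^*+\varepsilon$. (3) There is an algorithm that, given finite $K$, $T$ and $B$ (all components listed explicitly, costs in binary), computes $\tau^*$, as a fraction of two natural numbers or $\infty$, in time polynomial in the length of the input. -/

import Mathlib

open Filter
open scoped ENNReal NNReal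

/-! Kripke structures, Büchi automata and repair machines (weighted nondeterministic Büchi
transducers), the impair threshold for the mean cost, the synchronized product, strategies of
the only player on the product, and programs with a running time. -/

namespace ImpairVerif

/-! ### Infinite words -/

/-- `w 0 ++ w 1 ++ ⋯ ++ w (n - 1)`. -/
def concatUpTo {α : Type*} (w : ℕ → List α) (n : ℕ) : List α :=
  (List.range n).flatMap w

/-- The infinite concatenation `w 0 ++ w 1 ++ ⋯` is infinite and equals the ω-word `v`. -/
def IsConcat {α : Type*} (w : ℕ → List α) (v : ℕ → α) : Prop :=
  (∀ (n i : ℕ) (h : i < (concatUpTo w n).length), (concatUpTo w n)[i] = v i) ∧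
    ∀ N : ℕ, ∃ n : ℕ, N ≤ (concatUpTo w n).length

/-- Mean payoff of a cost sequence: the limit superior of the averages of its prefixes. -/
noncomputable def meanCost (c : ℕ → ℕ) : ℝ≥0∞ :=
  limsup (fun n : ℕ => ((∑ i ∈ Finset.range n, c i : ℕ) : ℝ≥0∞) / (n : ℝ≥0∞)) atTop

/-! ### Systems, specifications, repair machines -/

/-- Kripke structures with state set `S` and atomic propositions `AP`. -/
structure Kripke (S AP : Type*) where
  trans : Set (S × S)
  start : Set S
  label : S → Set AP

/-- The traces of `K`, over the alphabet `2 ^ AP`: label sequences of initial infinite paths. -/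
def Kripke.traces {S AP : Type*} (K : Kripke S AP) : Set (ℕ → Set AP) :=
  {t | ∃ s : ℕ → S, s 0 ∈ K.start ∧ (∀ i, (s i, s (i + 1)) ∈ K.trans) ∧ t = fun i => K.label (s i)}

/-- Nondeterministic Büchi automata with states `P` over the alphabet `Γ`. -/
structure NBA (P Γ : Type*) where
  start : Set P
  final : Set P
  trans : Set (P × Γ × P)

/-- The ω-words that have an accepting run. -/
def NBA.language {P Γ : Type*} (B : NBA P Γ) : Set (ℕ → Γ) :=
  {v | ∃ r : ℕ → P, r 0 ∈ B.start ∧ (∀ i, (r i, v i, r (i + 1)) ∈ B.trans) ∧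
    ∃ᶠ i in atTop, r i ∈ B.final}

/-- `B.Reads p w p' b`: the automaton has a run from `p` to `p'` on the finite word `w`, and `b`
tells whether this run enters a final state (the state `p`, in which the run starts, does not
count). Forgetting `b`, this is the extended transition relation. -/
inductive NBA.Reads {P Γ : Type*} (B : NBA P Γ) : P → List Γ → P → Bool → Prop
  | nil (p : P) : NBA.Reads B p [] p false
  | consFinal {p q p' : P} {a : Γ} {w : List Γ} {b : Bool} (h : (p, a, q) ∈ B.trans)
      (hq : q ∈ B.final) (hw : NBA.Reads B q w p' b) : NBA.Reads B p (a :: w) p' true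
  | consOther {p q p' : P} {a : Γ} {w : List Γ} {b : Bool} (h : (p, a, q) ∈ B.trans)
      (hq : q ∉ B.final) (hw : NBA.Reads B q w p' b) : NBA.Reads B p (a :: w) p' b

/-- Repair machines with states `Q`, input alphabet `A` and output alphabet `Γ`: a transition
`(q, a, q', w, c)` reads `a`, writes the word `w` and costs `c`. -/
structure RepairMachine (Q A Γ : Type*) where
  start : Set Q
  final : Set Q
  trans : Set (Q × A × Q × List Γ × ℕ)

/-- The data of a run of a repair machine: its states, output words and costs. -/
structure TRun (Q Γ : Type*) where
  state : ℕ → Q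
  out : ℕ → List Γ
  cost : ℕ → ℕ

/-- `ρ` is an accepting run of `T` on the ω-word `u`. -/
def RepairMachine.IsAcceptingRun {Q A Γ : Type*} (T : RepairMachine Q A Γ) (u : ℕ → A)
    (ρ : TRun Q Γ) : Prop :=
  ρ.state 0 ∈ T.start ∧
    (∀ i, (ρ.state i, u i, ρ.state (i + 1), ρ.out i, ρ.cost i) ∈ T.trans) ∧
    ∃ᶠ i in atTop, ρ.state i ∈ T.final

/-- The optimal mean cost of rewriting `u` to `v` (`∞` if this is impossible). -/
noncomputable def RepairMachine.optCost {Q A Γ : Type*} (T : RepairMachine Q A Γ) (u : ℕ → A)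
    (v : ℕ → Γ) : ℝ≥0∞ :=
  ⨅ (ρ : TRun Q Γ) (_ : T.IsAcceptingRun u ρ ∧ IsConcat ρ.out v), meanCost ρ.cost

/-- The rewritings of `u` of cost at most `τ`. -/
def RepairMachine.rewritings {Q A Γ : Type*} (T : RepairMachine Q A Γ) (τ : ℝ≥0) (u : ℕ → A) :
    Set (ℕ → Γ) :=
  {v | (∃ ρ : TRun Q Γ, T.IsAcceptingRun u ρ ∧ IsConcat ρ.out v) ∧ T.optCost u v ≤ (τ : ℝ≥0∞)}

/-- The optimal threshold: the infimum of all `τ` for which some trace of `K` can be rewritten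
with cost at most `τ` to a word in the (undesirable) language of `B`; `∞` if there is none. -/
noncomputable def impairThreshold {AP Γ S Q P : Type*} (K : Kripke S AP)
    (T : RepairMachine Q (Set AP) Γ) (B : NBA P Γ) : ℝ≥0∞ :=
  ⨅ (τ : ℝ≥0) (_ : ∃ t ∈ K.traces, ∃ v ∈ B.language, v ∈ T.rewritings τ t), (τ : ℝ≥0∞)

/-! ### The synchronized product -/

/-- Vertices `(s, q, p, i)` of the product. The counter `i` is `false` (value 1) while a final
state of the repair machine is awaited, and `true` (value 2) while one of the automaton is. -/
abbrev PVertex (S Q P : Type*) := S × Q × P × Bool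

section Product

variable {AP Γ S Q P : Type*} (K : Kripke S AP) (T : RepairMachine Q (Set AP) Γ) (B : NBA P Γ)

/-- One synchronous step of the product, in which the repair machine writes `w` at cost `c`. -/
def Step (v v' : PVertex S Q P) (w : List Γ) (c : ℕ) : Prop :=
  (v.1, v'.1) ∈ K.trans ∧ (v.2.1, K.label v.1, v'.2.1, w, c) ∈ T.trans ∧
    ∃ b : Bool, B.Reads v.2.2.1 w v'.2.2.1 b ∧
      (v.2.2.2 = false → (v'.2.2.2 = true ↔ v'.2.1 ∈ T.final)) ∧
      (v.2.2.2 = true → (v'.2.2.2 = false ↔ b = true))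

/-- Edges of the product graph. -/
def Edge (v v' : PVertex S Q P) : Prop := ∃ (w : List Γ) (c : ℕ), Step K T B v v' w c

/-- Weight of an edge: the least cost of a step along it. -/
noncomputable def weight (v v' : PVertex S Q P) : ℕ :=
  sInf {c : ℕ | ∃ w : List Γ, Step K T B v v' w c}

/-- Initial vertices of the product. -/
def initialVertices : Set (PVertex S Q P) :=
  {v | v.1 ∈ K.start ∧ v.2.1 ∈ T.start ∧ v.2.2.1 ∈ B.start ∧ v.2.2.2 = false}

/-- Accepting edges: the counter is reset from 2 to 1, since the automaton enters a final state
(and the repair machine has done so before). -/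
def AcceptingEdge (v v' : PVertex S Q P) : Prop :=
  Edge K T B v v' ∧ v.2.2.2 = true ∧ v'.2.2.2 = false

/-- Reachability in the product graph. -/
def Reaches (v v' : PVertex S Q P) : Prop := Relation.ReflTransGen (Edge K T B) v v'

/-- The consecutive pairs of a cyclic list, from its last entry back to the first included. -/
def cyclicPairs {V : Type*} (C : List V) : List (V × V) := C.zip (C.rotate 1)

/-- Closed walks of positive length. -/
def IsClosedWalk (C : List (PVertex S Q P)) : Prop :=
  C ≠ [] ∧ ∀ e ∈ cyclicPairs C, Edge K T B e.1 e.2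

/-- Cycles: closed walks without repeated vertices. -/
def IsCycle (C : List (PVertex S Q P)) : Prop := IsClosedWalk K T B C ∧ C.Nodup

/-- The closed walk uses an accepting edge. -/
def IsAccepting (C : List (PVertex S Q P)) : Prop :=
  ∃ e ∈ cyclicPairs C, AcceptingEdge K T B e.1 e.2

/-- Mean weight of a closed walk. -/
noncomputable def cycleMean (C : List (PVertex S Q P)) : ℝ≥0∞ :=
  ((((cyclicPairs C).map fun e => weight K T B e.1 e.2).sum : ℕ) : ℝ≥0∞) / (C.length : ℝ≥0∞)

/-- `C` is an accepting cycle that is reachable from an initial vertex. -/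
def IsAccessibleAcceptingCycle (C : List (PVertex S Q P)) : Prop :=
  IsCycle K T B C ∧ IsAccepting K T B C ∧
    ∃ v₀ ∈ initialVertices K T B, ∃ v ∈ C, Reaches K T B v₀ v

/-- `C` is a cycle that is reachable from, and can reach, an accepting cycle (which in turn is
reachable from an initial vertex). -/
def IsCandidate (C : List (PVertex S Q P)) : Prop :=
  IsCycle K T B C ∧ ∃ C₂, IsAccessibleAcceptingCycle K T B C₂ ∧
    (∃ v ∈ C₂, ∃ u ∈ C, Reaches K T B v u) ∧ (∃ u ∈ C, ∃ v ∈ C₂, Reaches K T B u v)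

/-- `C` is a cycle of least mean among the candidates. -/
def IsLeastMeanCycle (C : List (PVertex S Q P)) : Prop :=
  IsCandidate K T B C ∧ ∀ C', IsCandidate K T B C' → cycleMean K T B C ≤ cycleMean K T B C'

end Product

/-! ### Strategies of the only player -/

/-- A strategy: a first vertex and, for every history, a rewriting of the current letter and the
next vertex. -/
structure Strategy (V Γ : Type*) where
  start : V
  move : List V → List Γ × V

namespace Strategy

variable {V Γ : Type*} (σ : Strategy V Γ)

/-- The history `v₀, …, vₙ` of the play of `σ`. -/
def history : ℕ → List V
  | 0 => [σ.start]
  | n + 1 => history n ++ [(σ.move (history n)).2]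

/-- The play of `σ`. -/
def play : ℕ → V
  | 0 => σ.start
  | n + 1 => (σ.move (σ.history n)).2

/-- The words written along the play of `σ`. -/
def word (n : ℕ) : List Γ := (σ.move (σ.history n)).1

/-- `σ` is implemented by an automaton with finitely many memory states. -/
def FiniteMemory : Prop :=
  ∃ (k : ℕ) (m₀ : Fin k) (upd : Fin k → V → Fin k) (act : Fin k → V → List Γ × V),
    ∀ (h : List V) (v : V), σ.move (h ++ [v]) = act (h.foldl upd m₀) v

end Strategy

section Outcome

variable {AP Γ S Q P : Type*} (K : Kripke S AP) (T : RepairMachine Q (Set AP) Γ) (B : NBA P Γ)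

/-- The run of the repair machine along the play of `σ`, with the edge weights as costs. -/
noncomputable def outcome (σ : Strategy (PVertex S Q P) Γ) : TRun Q Γ where
  state n := (σ.play n).2.1
  out := σ.word
  cost n := weight K T B (σ.play n) (σ.play (n + 1))

/-- `σ` impairs the system: its play is an initial path of the product with infinitely many
accepting edges, its outcome is an accepting run of the repair machine on the corresponding trace,
and this run rewrites the trace to a word in the language of `B`. -/
def Impairs (σ : Strategy (PVertex S Q P) Γ) : Prop :=
  σ.play 0 ∈ initialVertices K T B ∧
    (∀ n, Edge K T B (σ.play n) (σ.play (n + 1))) ∧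
    (∃ᶠ n in atTop, AcceptingEdge K T B (σ.play n) (σ.play (n + 1))) ∧
    T.IsAcceptingRun (fun n => K.label (σ.play n).1) (outcome K T B σ) ∧
    ∃ v ∈ B.language, IsConcat σ.word v

/-- After the finite path `h`, the play `π` goes in rounds: in round `i` it goes `2 ^ i` times
around `C` and then once around `D`. -/
def IsRoundPlay {V : Type*} (h C D : List V) (π : ℕ → V) : Prop :=
  IsConcat (fun n => match n with
    | 0 => h
    | i + 1 => (List.replicate (2 ^ i) C).flatten ++ D) π

end Outcome

/-! ### Programs and their running time

Programs act on binary trees with natural numbers at the leaves. The size of a tree counts the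
bits of its leaves, and every step is charged the sizes of all the data that it reads and writes.
So the time is polynomially related to the time of a Turing machine. -/

/-- Binary trees with natural numbers at the leaves. -/
inductive Data
  | num (n : ℕ)
  | pair (a b : Data)

namespace Data

/-- The number of nodes plus the number of bits at the leaves. -/
def size : Data → ℕ
  | num n => 1 + Nat.size n
  | pair a b => 1 + a.size + b.size

/-- Every tree but the number `0` counts as true. -/
def IsTrue : Data → Prop
  | num n => n ≠ 0
  | pair _ _ => True

/-- Lists of trees as trees; the empty list is `0`. -/
def ofList : List Data → Data
  | [] => num 0
  | a :: l => pair a (ofList l)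

end Data

/-- Basic operations. -/
inductive Prim
  | const (d : Data)
  | id
  | fst
  | snd
  | add
  | sub
  | mul
  | div

/-- The effect of a basic operation; the result is `0` where the shape of the argument is wrong. -/
def Prim.eval : Prim → Data → Data
  | .const d, _ => d
  | .id, x => x
  | .fst, .pair a _ => a
  | .snd, .pair _ b => b
  | .add, .pair (.num m) (.num n) => .num (m + n)
  | .sub, .pair (.num m) (.num n) => .num (m - n)
  | .mul, .pair (.num m) (.num n) => .num (m * n)
  | .div, .pair (.num m) (.num n) => .num (m / n)
  | _, _ => .num 0

/-- Programs: basic operations, sequential composition, pairing of the results of two programs on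
the same input, conditionals, and while loops `loop p f` ("while `p`, do `f`"). -/
inductive Prog
  | prim (o : Prim)
  | seq (f g : Prog)
  | both (f g : Prog)
  | ite (p f g : Prog)
  | loop (p f : Prog)

/-- `Run f x y t`: started on `x`, the program `f` halts after time `t` with the result `y`. -/
inductive Run : Prog → Data → Data → ℕ → Prop
  | prim (o : Prim) (x : Data) :
      Run (.prim o) x (o.eval x) (1 + x.size + (o.eval x).size)
  | seq {f g : Prog} {x y z : Data} {t₁ t₂ : ℕ} (hf : Run f x y t₁) (hg : Run g y z t₂) :
      Run (.seq f g) x z (1 + t₁ + t₂)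
  | both {f g : Prog} {x y z : Data} {t₁ t₂ : ℕ} (hf : Run f x y t₁) (hg : Run g x z t₂) :
      Run (.both f g) x (.pair y z) (1 + x.size + y.size + z.size + t₁ + t₂)
  | iteTrue {p f g : Prog} {x b y : Data} {t₁ t₂ : ℕ} (hp : Run p x b t₁) (hb : b.IsTrue)
      (hf : Run f x y t₂) : Run (.ite p f g) x y (1 + x.size + t₁ + t₂)
  | iteFalse {p f g : Prog} {x b y : Data} {t₁ t₂ : ℕ} (hp : Run p x b t₁) (hb : ¬ b.IsTrue)
      (hg : Run g x y t₂) : Run (.ite p f g) x y (1 + x.size + t₁ + t₂)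
  | loopStop {p f : Prog} {x b : Data} {t₁ : ℕ} (hp : Run p x b t₁) (hb : ¬ b.IsTrue) :
      Run (.loop p f) x x (1 + x.size + t₁)
  | loopStep {p f : Prog} {x b y z : Data} {t₁ t₂ t₃ : ℕ} (hp : Run p x b t₁) (hb : b.IsTrue)
      (hf : Run f x y t₂) (hl : Run (.loop p f) y z t₃) :
      Run (.loop p f) x z (1 + x.size + t₁ + t₂ + t₃)

/-! ### Inputs of the computational problem -/

/-- A finitely presented Kripke structure, repair machine and automaton. -/
structure Input where
  /-- number of atomic propositions -/
  nAP : ℕ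
  /-- number of output letters -/
  nOut : ℕ
  /-- number of states of the Kripke structure -/
  nS : ℕ
  /-- number of states of the repair machine -/
  nQ : ℕ
  /-- number of states of the automaton -/
  nP : ℕ
  kTrans : List (Fin nS × Fin nS)
  kStart : List (Fin nS)
  kLabel : Fin nS → Finset (Fin nAP)
  tStart : List (Fin nQ)
  tFinal : List (Fin nQ)
  tTrans : List (Fin nQ × Finset (Fin nAP) × Fin nQ × List (Fin nOut) × ℕ)
  bStart : List (Fin nP)
  bFinal : List (Fin nP)
  bTrans : List (Fin nP × Fin nOut × Fin nP)

namespace Input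

/-- The Kripke structure of the input. -/
def kripke (I : Input) : Kripke (Fin I.nS) (Fin I.nAP) where
  trans := {e | e ∈ I.kTrans}
  start := {s | s ∈ I.kStart}
  label s := {a | a ∈ I.kLabel s}

/-- The repair machine of the input. -/
def machine (I : Input) : RepairMachine (Fin I.nQ) (Set (Fin I.nAP)) (Fin I.nOut) where
  start := {q | q ∈ I.tStart}
  final := {q | q ∈ I.tFinal}
  trans := {e | ∃ a : Finset (Fin I.nAP), e.2.1 = {x | x ∈ a} ∧
    (e.1, a, e.2.2.1, e.2.2.2.1, e.2.2.2.2) ∈ I.tTrans}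

/-- The automaton of the input. -/
def automaton (I : Input) : NBA (Fin I.nP) (Fin I.nOut) where
  start := {p | p ∈ I.bStart}
  final := {p | p ∈ I.bFinal}
  trans := {e | e ∈ I.bTrans}

/-- An element of a finite set, as a binary number. -/
def encFin {n : ℕ} (i : Fin n) : Data := .num i

/-- The number of elements of a listed finite set, in unary. -/
def encCard (n : ℕ) : Data := .ofList (List.replicate n (.num 0))

/-- A set of atomic propositions, as a bit vector. -/
def encLetter {n : ℕ} (a : Finset (Fin n)) : Data :=
  .ofList ((List.finRange n).map fun i => .num (if i ∈ a then 1 else 0))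

/-- A list, entry by entry. -/
def encList {α : Type} (f : α → Data) (l : List α) : Data := .ofList (l.map f)

/-- The tree that is given to a program as the input: all components are listed, sets of states
and letters have their elements counted in unary, costs are in binary. -/
def encode (I : Input) : Data :=
  .ofList [encCard I.nAP, encCard I.nOut, encCard I.nS, encCard I.nQ, encCard I.nP,
    encList (fun e => .pair (encFin e.1) (encFin e.2)) I.kTrans,
    encList encFin I.kStart,
    encList (fun s => encLetter (I.kLabel s)) (List.finRange I.nS),
    encList encFin I.tStart,
    encList encFin I.tFinal,
    encList (fun e => .ofList [encFin e.1, encLetter e.2.1, encFin e.2.2.1,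
      encList encFin e.2.2.2.1, .num e.2.2.2.2]) I.tTrans,
    encList encFin I.bStart,
    encList encFin I.bFinal,
    encList (fun e => .ofList [encFin e.1, encFin e.2.1, encFin e.2.2]) I.bTrans]

/-- The threshold of the input. -/
noncomputable def threshold (I : Input) : ℝ≥0∞ := impairThreshold I.kripke I.machine I.automaton

end Input

/-- `0` stands for `∞`, and a pair of numbers `a`, `b` with `b > 0` for the fraction `a / b`. -/
def Represents (d : Data) (x : ℝ≥0∞) : Prop :=
  (d = .num 0 ∧ x = ⊤) ∨
    ∃ a b : ℕ, 0 < b ∧ d = .pair (.num a) (.num b) ∧ x = (a : ℝ≥0∞) / (b : ℝ≥0∞)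

/-- A single program computes the function `f` of the input in polynomial time. -/
def ComputableInPolyTime (f : Input → ℝ≥0∞) : Prop :=
  ∃ (prog : Prog) (poly : Polynomial ℕ), ∀ I : Input, ∃ (y : Data) (t : ℕ),
    Run prog I.encode y t ∧ t ≤ poly.eval I.encode.size ∧ Represents y (f I)

end ImpairVerif

open ImpairVerif

/-! Rewriting a trace of K into a word of L(B) amounts to following an infinite path of the product
from an initial vertex with infinitely many accepting edges (`exists_path_of_run`, `run_of_path`).
The run of B is cut where the output words end, and the counter is the usual device for two Büchi
conditions at once. So the threshold is governed by the mean weights of such paths. Call a vertex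
good if it is reachable and lies on a closed walk with an accepting edge; candidates are exactly the
cycles through good vertices. Let μ be the least mean of a candidate.

Lower bound. A finite product forces some vertex u to recur, and u is good. A segment of the path
that starts at u becomes a closed walk when a return walk to u is added, and return walks can be
chosen from finitely many. A closed walk splits into simple cycles, all through good vertices, so
its mean is at least μ (`closedWalk_bound`). The bounded weight of the return walk vanishes in the
average (`IsLeastMeanCycle.le_meanCost`).

Upper bound. A vertex x on a least-mean cycle C is good, hence lies on a closed walk D with an
accepting edge. Measured against the mean of C, turns around C have no excess and each detour D has
a fixed one. If eventually at least N turns separate the detours, the cost is at most μ + δ / N with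
δ independent of N (`cost_roundBlocks_le`). The numbers 2 ^ i exceed every N, which gives cost μ; a
constant number N of turns gives an ultimately periodic play, hence finite memory, at cost close to
μ.

Algorithm. Dynamic programming yields the least weight of a walk of every length up to the number of
vertices; the answer is the least quotient of weight and length over closed walks at good vertices.
These walks need not be simple: by `closedWalk_bound` none of them beats μ, while C has one of the
lengths considered (`represents_solve`). Polynomial time follows from closure properties of the
class `PolyFun`. The only danger is the growth of data inside loops, which `foldl_distStep_bound`
excludes for the numbers in the dynamic program. -/

namespace ImpairVerif

/-! ### Infinite concatenations -/

section Concat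

variable {α β : Type*}

theorem concatUpTo_zero (w : ℕ → List α) : concatUpTo w 0 = [] := rfl

theorem concatUpTo_succ (w : ℕ → List α) (n : ℕ) :
    concatUpTo w (n + 1) = concatUpTo w n ++ w n := by
  simp [concatUpTo, List.range_succ]

theorem concatUpTo_prefix (w : ℕ → List α) {m n : ℕ} (h : m ≤ n) :
    concatUpTo w m <+: concatUpTo w n := by
  induction n, h using Nat.le_induction with
  | base => exact List.prefix_refl _
  | succ n _ ih => exact ih.trans (by rw [concatUpTo_succ]; exact List.prefix_append _ _)

theorem length_concatUpTo_mono (w : ℕ → List α) : Monotone fun n => (concatUpTo w n).length :=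
  fun _ _ h => (concatUpTo_prefix w h).length_le

theorem concatUpTo_map (f : α → β) (w : ℕ → List α) (n : ℕ) :
    concatUpTo (fun i => (w i).map f) n = (concatUpTo w n).map f := by
  induction n with
  | zero => rfl
  | succ n ih => simp [concatUpTo_succ, ih]

theorem IsConcat.map (f : α → β) {w : ℕ → List α} {v : ℕ → α} (h : IsConcat w v) :
    IsConcat (fun i => (w i).map f) (fun i => f (v i)) := by
  refine ⟨fun n i hi => ?_, fun N => ?_⟩
  · simp only [concatUpTo_map, List.length_map] at hi
    simp [concatUpTo_map, h.1 n i hi]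
  · obtain ⟨n, hn⟩ := h.2 N
    exact ⟨n, by simpa [concatUpTo_map] using hn⟩

/-- Letter i is read off from any finite concatenation that is long enough. The choice is
irrelevant, since the finite concatenations are prefixes of each other. -/
theorem exists_isConcat {w : ℕ → List α} (h : ∀ N : ℕ, ∃ n : ℕ, N ≤ (concatUpTo w n).length) :
    ∃ v, IsConcat w v := by
  choose f hf using h
  refine ⟨fun i => (concatUpTo w (f (i + 1)))[i]'(hf (i + 1)), fun n i hi => ?_,
    fun N => ⟨f N, hf N⟩⟩
  rcases le_total n (f (i + 1)) with h | h
  · exact (concatUpTo_prefix w h).getElem hi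
  · exact ((concatUpTo_prefix w h).getElem (hf (i + 1))).symm

theorem length_concatUpTo_unbounded {w : ℕ → List α} (h : ∃ᶠ n in atTop, w n ≠ []) (N : ℕ) :
    ∃ n : ℕ, N ≤ (concatUpTo w n).length := by
  induction N with
  | zero => exact ⟨0, Nat.zero_le _⟩
  | succ N ih =>
    obtain ⟨m, hm⟩ := ih
    obtain ⟨n, hmn, hn⟩ := frequently_atTop.1 h m
    refine ⟨n + 1, ?_⟩
    have := length_concatUpTo_mono w hmn
    have := List.length_pos_iff.2 hn
    simp only [concatUpTo_succ, List.length_append] at *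
    omega

theorem IsConcat.getElem_block {w : ℕ → List α} {v : ℕ → α} (h : IsConcat w v) {n j : ℕ}
    (hj : j < (w n).length) : (w n)[j] = v ((concatUpTo w n).length + j) := by
  have := h.1 (n + 1) ((concatUpTo w n).length + j) (by simp [concatUpTo_succ, hj])
  rw [← this]
  simp [concatUpTo_succ]

theorem IsConcat.isChain {w : ℕ → List α} {v : ℕ → α} (h : IsConcat w v) {R : α → α → Prop}
    (hR : ∀ n, List.IsChain R (concatUpTo w n)) (i : ℕ) : R (v i) (v (i + 1)) := by
  obtain ⟨n, hn⟩ := h.2 (i + 2)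
  have := List.isChain_iff_getElem.1 (hR n) i (by omega)
  rwa [h.1, h.1] at this

/-- The boundaries belong to the block on their left: position i stands for the state entered after
i letters, and `NBA.Reads` counts the last state of a word but not the first. -/
theorem IsConcat.exists_block {w : ℕ → List α} {v : ℕ → α} (h : IsConcat w v) (N i : ℕ)
    (hi : (concatUpTo w N).length < i) :
    ∃ n ≥ N, (concatUpTo w n).length < i ∧ i ≤ (concatUpTo w (n + 1)).length := by
  classical
  have hex := h.2 i
  have h0 := Nat.find_spec hex
  have hN : N < Nat.find hex := by
    by_contra hlt
    have := length_concatUpTo_mono w (not_lt.1 hlt)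
    simp only at this
    omega
  obtain ⟨n, hn⟩ : ∃ n, Nat.find hex = n + 1 := ⟨Nat.find hex - 1, by omega⟩
  refine ⟨n, by omega, ?_, hn ▸ h0⟩
  exact not_le.1 (Nat.find_min hex (m := n) (by omega))

end Concat

/-! ### Runs of automata on infinite concatenations -/

section Automaton

variable {P Γ : Type*} {B : NBA P Γ}

/-- A finite run becomes a list of transitions, so that gluing infinitely many runs is concatenation
of lists. States alone would be duplicated at the seams. The clause for `t = []` carries the state
across empty output words. -/
theorem NBA.Reads.exists_path {p p' : P} {w : List Γ} {b : Bool} (h : B.Reads p w p' b) :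
    ∃ t : List (P × Γ × P), (∀ e ∈ t, e ∈ B.trans) ∧ t.map (fun e => e.2.1) = w ∧
      List.IsChain (fun e e' => e.2.2 = e'.1) t ∧ (∀ e ∈ t.head?, e.1 = p) ∧
      (t = [] → p = p') ∧ (∀ e ∈ t.getLast?, e.2.2 = p') ∧
      (b = true → ∃ e ∈ t, e.2.2 ∈ B.final) := by
  induction h with
  | nil p => exact ⟨[], by simp⟩
  | @consFinal p q p' a w b h hq hw ih =>
    obtain ⟨t, h1, h2, h3, h4, h5, h6, h7⟩ := ih
    refine ⟨(p, a, q) :: t, by simpa using ⟨h, fun _ _ _ => h1 _⟩, by simp [h2], ?_, by simp,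
      by simp, ?_, fun _ => ⟨_, List.mem_cons_self, hq⟩⟩
    · rw [List.isChain_cons]
      exact ⟨fun e he => (h4 e he).symm, h3⟩
    · rcases t with _ | ⟨e, t⟩
      · simpa using h5 rfl
      · simpa using h6
  | @consOther p q p' a w b h hq hw ih =>
    obtain ⟨t, h1, h2, h3, h4, h5, h6, h7⟩ := ih
    refine ⟨(p, a, q) :: t, by simpa using ⟨h, fun _ _ _ => h1 _⟩, by simp [h2], ?_, by simp,
      by simp, ?_, fun hb => ?_⟩
    · rw [List.isChain_cons]
      exact ⟨fun e he => (h4 e he).symm, h3⟩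
    · rcases t with _ | ⟨e, t⟩
      · simpa using h5 rfl
      · simpa using h6
    · obtain ⟨e, he, hf⟩ := h7 hb
      exact ⟨e, List.mem_cons_of_mem _ he, hf⟩

theorem NBA.exists_mem_language {p : ℕ → P} {w : ℕ → List Γ} {b : ℕ → Bool}
    (h0 : p 0 ∈ B.start) (h : ∀ n, B.Reads (p n) (w n) (p (n + 1)) (b n))
    (hb : ∃ᶠ n in atTop, b n = true) : ∃ v ∈ B.language, IsConcat w v := by
  choose t h1 h2 h3 h4 h5 h6 h7 using fun n => (h n).exists_path
  have hne : ∃ᶠ n in atTop, t n ≠ [] := hb.mono fun n hn => by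
    obtain ⟨e, he, _⟩ := h7 n hn
    exact List.ne_nil_of_mem he
  obtain ⟨τ, hτ⟩ := exists_isConcat (length_concatUpTo_unbounded hne)
  have hw : w = fun n => (t n).map fun e => e.2.1 := funext fun n => (h2 n).symm
  -- The invariant for the first n blocks. Seams match because a block ends in the state in which
  -- the next one starts; if all blocks so far are empty, the current state is still `p 0`.
  have key : ∀ n, List.IsChain (fun e e' : P × Γ × P => e.2.2 = e'.1) (concatUpTo t n) ∧
      (∀ e ∈ (concatUpTo t n).head?, e.1 = p 0) ∧ (concatUpTo t n = [] → p 0 = p n) ∧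
      (∀ e ∈ (concatUpTo t n).getLast?, e.2.2 = p n) ∧ ∀ e ∈ concatUpTo t n, e ∈ B.trans := by
    intro n
    induction n with
    | zero => simp [concatUpTo_zero]
    | succ n ih =>
      obtain ⟨i1, i2, i3, i4, i5⟩ := ih
      rw [concatUpTo_succ]
      refine ⟨List.isChain_append.2 ⟨i1, h3 n, fun x hx y hy => ?_⟩, ?_, ?_, ?_, ?_⟩
      · rw [i4 x hx, h4 n y hy]
      · intro e he
        by_cases hc : concatUpTo t n = []
        · rw [hc, List.nil_append] at he
          rw [h4 n e he, i3 hc]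
        · rw [List.head?_append_of_ne_nil _ hc] at he
          exact i2 e he
      · intro hc
        obtain ⟨ha, hb⟩ := List.append_eq_nil_iff.1 hc
        rw [i3 ha, h5 n hb]
      · intro e he
        by_cases hc : t n = []
        · rw [hc, List.append_nil] at he
          rw [i4 e he, h5 n hc]
        · rw [List.getLast?_append_of_ne_nil _ hc] at he
          exact h6 n e he
      · intro e he
        rcases List.mem_append.1 he with he | he
        · exact i5 e he
        · exact h1 n e he
  refine ⟨fun i => (τ i).2.1, ⟨fun i => (τ i).1, ?_, ?_, ?_⟩, hw ▸ hτ.map fun e => e.2.1⟩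
  · obtain ⟨n, hn⟩ := hτ.2 1
    have := (key n).2.1 (τ 0) (by
      rw [List.head?_eq_getElem?, List.getElem?_eq_getElem hn, hτ.1 n 0 hn]; rfl)
    simpa [this] using h0
  · intro i
    obtain ⟨n, hn⟩ := hτ.2 (i + 1)
    have hm : τ i ∈ B.trans := by
      rw [← hτ.1 n i hn]
      exact (key n).2.2.2.2 _ (List.getElem_mem _)
    have hc := hτ.isChain (fun n => (key n).1) i
    simp only [← hc]
    exact hm
  · rw [frequently_atTop]
    intro N
    obtain ⟨m, hm⟩ := hτ.2 N
    obtain ⟨n, hmn, hn⟩ := frequently_atTop.1 hb m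
    obtain ⟨e, he, hf⟩ := h7 n hn
    obtain ⟨j, hj, rfl⟩ := List.getElem_of_mem he
    have hlen := length_concatUpTo_mono t hmn
    simp only at hlen
    refine ⟨(concatUpTo t n).length + j + 1, by omega, ?_⟩
    have hc := hτ.isChain (fun n => (key n).1) ((concatUpTo t n).length + j)
    simp only [← hc, ← hτ.getElem_block hj]
    exact hf

/-- Only one direction is needed for the flag: a final state entered strictly after position k
forces it to be true. -/
theorem NBA.reads_of_run {r : ℕ → P} {v : ℕ → Γ} (h : ∀ i, (r i, v i, r (i + 1)) ∈ B.trans)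
    (w : List Γ) : ∀ k : ℕ, (∀ (j : ℕ) (hj : j < w.length), w[j] = v (k + j)) →
    ∃ b, B.Reads (r k) w (r (k + w.length)) b ∧
      ∀ j, 0 < j → j ≤ w.length → r (k + j) ∈ B.final → b = true := by
  induction w with
  | nil => exact fun k _ => ⟨false, .nil _, fun j h1 h2 => by simp at h2; omega⟩
  | cons a w ih =>
    intro k hk
    obtain ⟨b, hb, hf⟩ := ih (k + 1) fun j hj => by
      have := hk (j + 1) (by simpa using hj)
      rw [List.getElem_cons_succ] at this
      rw [this]; congr 1; omega
    have ha : (r k, a, r (k + 1)) ∈ B.trans := by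
      have := hk 0 (by simp)
      simp only [List.getElem_cons_zero, Nat.add_zero] at this
      rw [this]; exact h k
    have he : k + (a :: w).length = k + 1 + w.length := by simp; omega
    rw [he]
    by_cases hq : r (k + 1) ∈ B.final
    · exact ⟨true, .consFinal ha hq hb, fun _ _ _ _ => rfl⟩
    · refine ⟨b, .consOther ha hq hb, fun j h1 h2 h3 => ?_⟩
      obtain rfl | hj : j = 1 ∨ 1 < j := by omega
      · exact absurd h3 hq
      · refine hf (j - 1) (by omega) (by simp at h2; omega) ?_
        rwa [show k + 1 + (j - 1) = k + j by omega]

theorem NBA.exists_reads_of_mem_language {v : ℕ → Γ} (hv : v ∈ B.language) {w : ℕ → List Γ}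
    (hw : IsConcat w v) : ∃ (p : ℕ → P) (b : ℕ → Bool), p 0 ∈ B.start ∧
      (∀ n, B.Reads (p n) (w n) (p (n + 1)) (b n)) ∧ ∃ᶠ n in atTop, b n = true := by
  obtain ⟨r, h0, hr, hf⟩ := hv
  choose b hb hbf using fun n => NBA.reads_of_run hr (w n) (concatUpTo w n).length
    fun j hj => hw.getElem_block hj
  refine ⟨fun n => r (concatUpTo w n).length, b, h0, fun n => ?_, ?_⟩
  · have := hb n
    rwa [← List.length_append, ← concatUpTo_succ] at this
  · rw [frequently_atTop] at hf ⊢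
    intro N
    -- The summand 1 puts the final state strictly behind the first N blocks, so it is entered while
    -- one of the later blocks is read.
    obtain ⟨i, hi, hif⟩ := hf ((concatUpTo w N).length + 1)
    obtain ⟨n, hn, h1, h2⟩ := hw.exists_block N i (by omega)
    refine ⟨n, hn, hbf n (i - (concatUpTo w n).length) (by omega) ?_ ?_⟩
    · simp only [concatUpTo_succ, List.length_append] at h2; omega
    · rwa [show (concatUpTo w n).length + (i - (concatUpTo w n).length) = i by omega]

end Automaton

/-! ### Paths of the product -/

section Product

variable {AP Γ S Q P : Type*} {K : Kripke S AP} {T : RepairMachine Q (Set AP) Γ} {B : NBA P Γ}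

theorem weight_le_of_step {v v' : PVertex S Q P} {w : List Γ} {c : ℕ}
    (h : Step K T B v v' w c) : weight K T B v v' ≤ c := Nat.sInf_le ⟨w, h⟩

theorem exists_step_weight {v v' : PVertex S Q P} (h : Edge K T B v v') :
    ∃ w, Step K T B v v' w (weight K T B v v') := by
  obtain ⟨w, c, h⟩ := h
  exact Nat.sInf_mem (s := {c : ℕ | ∃ w : List Γ, Step K T B v v' w c}) ⟨c, w, h⟩

/-- Accepting runs whose output lies in the language of the automaton induce accepting paths. -/
theorem exists_path_of_run {t : ℕ → Set AP} (ht : t ∈ K.traces) {ρ : TRun Q Γ}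
    (hρ : T.IsAcceptingRun t ρ) {v : ℕ → Γ} (hv : v ∈ B.language) (hc : IsConcat ρ.out v) :
    ∃ π : ℕ → PVertex S Q P, π 0 ∈ initialVertices K T B ∧
      (∀ n, Step K T B (π n) (π (n + 1)) (ρ.out n) (ρ.cost n)) ∧
      ∃ᶠ n in atTop, AcceptingEdge K T B (π n) (π (n + 1)) := by
  classical
  obtain ⟨s, hs0, hs, rfl⟩ := ht
  obtain ⟨hq0, hq, hqf⟩ := hρ
  obtain ⟨p, b, hp0, hp, hb⟩ := NBA.exists_reads_of_mem_language hv hc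
  -- The counter is determined by the run: at value 2 it waits for the flag of the automaton, at
  -- value 1 for a final state of the machine.
  let i : ℕ → Bool := fun n => Nat.rec false
    (fun n x => bif x then !(b n) else decide (ρ.state (n + 1) ∈ T.final)) n
  have hi : ∀ n, i (n + 1) = bif i n then !(b n) else decide (ρ.state (n + 1) ∈ T.final) :=
    fun _ => rfl
  let π : ℕ → PVertex S Q P := fun n => (s n, ρ.state n, p n, i n)
  have hstep : ∀ n, Step K T B (π n) (π (n + 1)) (ρ.out n) (ρ.cost n) := by
    refine fun n => ⟨hs n, hq n, b n, hp n, fun h => ?_, fun h => ?_⟩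
    · change i n = false at h
      change i (n + 1) = true ↔ _
      simp [hi, h, π]
    · change i n = true at h
      change i (n + 1) = false ↔ _
      simp [hi, h]
  refine ⟨π, ⟨hs0, hq0, hp0, rfl⟩, hstep, ?_⟩
  rw [frequently_atTop]
  intro N
  -- The counter takes value 2 arbitrarily late: when the machine enters a final state, the counter
  -- either has this value already or gets it now.
  obtain ⟨m, hNm, hm⟩ : ∃ m ≥ N, i m = true := by
    obtain ⟨n, hn, hf⟩ := frequently_atTop.1 hqf (N + 1)
    obtain ⟨n, rfl⟩ : ∃ k, n = k + 1 := ⟨n - 1, by omega⟩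
    by_cases h : i n = true
    · exact ⟨n, by omega, h⟩
    · exact ⟨n + 1, by omega, by simp [hi n, h, hf]⟩
  by_contra hcon
  push Not at hcon
  -- Without accepting edges after m the counter is stuck at 2, although the next true flag would
  -- reset it.
  have hall : ∀ n ≥ m, i n = true := by
    intro n hn
    induction n, hn using Nat.le_induction with
    | base => exact hm
    | succ n hn ih =>
      by_contra hne
      exact hcon n (by omega) ⟨⟨_, _, hstep n⟩, ih, by simpa using hne⟩
  obtain ⟨n, hn, hbn⟩ := frequently_atTop.1 hb m
  have h1 := hall (n + 1) (by omega)
  simp [hi, hall n hn, hbn] at h1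

/-- Accepting paths, with outputs of least cost, induce accepting runs. -/
theorem run_of_path {π : ℕ → PVertex S Q P} (h0 : π 0 ∈ initialVertices K T B) {w : ℕ → List Γ}
    (hw : ∀ n, Step K T B (π n) (π (n + 1)) (w n) (weight K T B (π n) (π (n + 1))))
    (hacc : ∃ᶠ n in atTop, AcceptingEdge K T B (π n) (π (n + 1))) :
    T.IsAcceptingRun (fun n => K.label (π n).1)
      ⟨fun n => (π n).2.1, w, fun n => weight K T B (π n) (π (n + 1))⟩ ∧
    ∃ v ∈ B.language, IsConcat w v := by
  choose h1 h2 b h3 h4 h5 using hw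
  refine ⟨⟨h0.2.1, h2, ?_⟩, NBA.exists_mem_language (p := fun n => (π n).2.2.1) (b := b)
    h0.2.2.1 h3 (hacc.mono fun n hn => (h5 n hn.2.1).1 hn.2.2)⟩
  rw [frequently_atTop] at hacc ⊢
  intro N
  by_contra hcon
  push Not at hcon
  obtain ⟨m, hm, hm'⟩ := hacc N
  -- After an accepting edge the counter has value 1, and without final states of the machine it
  -- never leaves this value; but another accepting edge must start at value 2.
  have hall : ∀ n ≥ m + 1, (π n).2.2.2 = false := by
    intro n hn
    induction n, hn using Nat.le_induction with
    | base => exact hm'.2.2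
    | succ n hn ih =>
      by_contra hne
      exact hcon (n + 1) (by omega) ((h4 n ih).1 (by simpa using hne))
  obtain ⟨n, hn, hn'⟩ := hacc (m + 1)
  simpa [hn'.2.1] using hall n hn

theorem trace_of_path {π : ℕ → PVertex S Q P} (h0 : π 0 ∈ initialVertices K T B)
    (he : ∀ n, Edge K T B (π n) (π (n + 1))) : (fun n => K.label (π n).1) ∈ K.traces :=
  ⟨fun n => (π n).1, h0.1, fun n => (he n).choose_spec.choose_spec.1, rfl⟩

end Product

/-! ### Strategies with a given play -/

namespace Strategy

variable {V Γ : Type*}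

theorem length_history (σ : Strategy V Γ) (n : ℕ) : (σ.history n).length = n + 1 := by
  induction n with
  | zero => rfl
  | succ n ih => simp [history, ih]

/-- The strategy that follows `π` and writes `w`, counting rounds by the length of the history. -/
def ofPlay (π : ℕ → V) (w : ℕ → List Γ) : Strategy V Γ where
  start := π 0
  move h := (w (h.length - 1), π h.length)

theorem play_ofPlay (π : ℕ → V) (w : ℕ → List Γ) : (ofPlay π w).play = π := by
  funext n
  cases n with
  | zero => rfl
  | succ n => simp [play, ofPlay, length_history]

theorem word_ofPlay (π : ℕ → V) (w : ℕ → List Γ) : (ofPlay π w).word = w := by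
  funext n
  simp [word, ofPlay, length_history]

theorem eq_add_mul_of_eventuallyPeriodic {β : Type*} {f : ℕ → β} {n₀ d : ℕ}
    (hf : ∀ n ≥ n₀, f (n + d) = f n) {n : ℕ} (hn : n₀ ≤ n) (k : ℕ) : f (n + k * d) = f n := by
  induction k with
  | zero => simp
  | succ k ih => rw [Nat.succ_mul, ← Nat.add_assoc, hf _ (by omega), ih]

/-- Ultimately periodic plays need finite memory only. -/
theorem finiteMemory_ofPlay {π : ℕ → V} {w : ℕ → List Γ} {n₀ d : ℕ} (hd : 0 < d)
    (hπ : ∀ n ≥ n₀, π (n + d) = π n) (hw : ∀ n ≥ n₀, w (n + d) = w n) :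
    (ofPlay π w).FiniteMemory := by
  -- The memory counts the vertices of the history before the current one. From `n₀ + d` it falls
  -- back to `n₀ + 1`, that is, by the period d.
  refine ⟨n₀ + 1 + d, ⟨0, by omega⟩,
    fun m _ => if h : m.1 + 1 < n₀ + 1 + d then ⟨m.1 + 1, h⟩ else ⟨n₀ + 1, by omega⟩,
    fun m _ => (w m, π (m + 1)), fun h v => ?_⟩
  -- The memory differs from the true count by a multiple of d, and after the first fallback it
  -- stays in the periodic part.
  have key : ∀ h : List V, ∃ k, h.length = (h.foldl (fun (m : Fin (n₀ + 1 + d)) _ =>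
      if h : m.1 + 1 < n₀ + 1 + d then (⟨m.1 + 1, h⟩ : Fin (n₀ + 1 + d)) else ⟨n₀ + 1, by omega⟩)
      ⟨0, by omega⟩ : Fin (n₀ + 1 + d)).1 + k * d ∧ (k = 0 ∨ n₀ ≤ (h.foldl
      (fun (m : Fin (n₀ + 1 + d)) _ => if h : m.1 + 1 < n₀ + 1 + d then
        (⟨m.1 + 1, h⟩ : Fin (n₀ + 1 + d)) else ⟨n₀ + 1, by omega⟩) ⟨0, by omega⟩ :
        Fin (n₀ + 1 + d)).1) := by
    intro h
    induction h using List.reverseRecOn with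
    | nil => exact ⟨0, by simp, .inl rfl⟩
    | append_singleton h v ih =>
      obtain ⟨k, hk, hk'⟩ := ih
      rw [List.foldl_append, List.foldl_cons, List.foldl_nil, List.length_append, hk]
      generalize (h.foldl _ _ : Fin (n₀ + 1 + d)) = m at *
      split_ifs with hm
      · exact ⟨k, by simp; omega, by simp; omega⟩
      · refine ⟨k + 1, ?_, .inr (by simp)⟩
        simp only [List.length_singleton, Nat.succ_mul]
        have := m.2
        omega
  obtain ⟨k, hk, hk'⟩ := key h
  generalize (h.foldl _ _ : Fin (n₀ + 1 + d)) = m at *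
  simp only [ofPlay, List.length_append, List.length_singleton, Nat.add_sub_cancel]
  rcases hk' with rfl | hk'
  · simp [hk]
  · rw [hk, show m.1 + k * d + 1 = m.1 + 1 + k * d by omega, eq_add_mul_of_eventuallyPeriodic hw hk',
      eq_add_mul_of_eventuallyPeriodic hπ (by omega)]

end Strategy

/-! ### Walks in weighted graphs -/

section Walk

variable {V : Type*} {E : V → V → Prop} {wt : V → V → ℕ}

/-- `IsWalk E u l v`: the list `u :: l` is a walk that ends in `v`. -/
def IsWalk (E : V → V → Prop) : V → List V → V → Prop
  | u, [], v => u = v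
  | u, x :: l, v => E u x ∧ IsWalk E x l v

/-- Total weight of the consecutive pairs of a list. -/
def pathWeight (wt : V → V → ℕ) : List V → ℕ
  | u :: v :: l => wt u v + pathWeight wt (v :: l)
  | _ => 0

theorem pathWeight_append (wt : V → V → ℕ) (l : List V) (x : V) (l' : List V) :
    pathWeight wt (l ++ x :: l') = pathWeight wt (l ++ [x]) + pathWeight wt (x :: l') := by
  induction l with
  | nil => simp [pathWeight]
  | cons u l ih =>
    cases l with
    | nil => simp [pathWeight]
    | cons v l =>
      simp only [List.cons_append, pathWeight] at *
      omega

theorem isWalk_append {u w : V} {l l' : List V} :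
    IsWalk E u (l ++ l') w ↔ ∃ v, IsWalk E u l v ∧ IsWalk E v l' w := by
  induction l generalizing u with
  | nil => simp [IsWalk]
  | cons x l ih => simp [IsWalk, ih, and_assoc]

theorem IsWalk.append {u v w : V} {l l' : List V} (h : IsWalk E u l v) (h' : IsWalk E v l' w) :
    IsWalk E u (l ++ l') w := isWalk_append.2 ⟨v, h, h'⟩

theorem IsWalk.eq_of_append_singleton {u v x : V} {l : List V} (h : IsWalk E u (l ++ [x]) v) :
    x = v := by
  obtain ⟨y, _, h⟩ := isWalk_append.1 h
  exact h.2

theorem IsWalk.cons_eq {u v : V} {l : List V} (h : IsWalk E u l v) :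
    ∃ L, u :: l = L ++ [v] := by
  induction l generalizing u with
  | nil =>
    obtain rfl : u = v := h
    exact ⟨[], rfl⟩
  | cons x l ih =>
    obtain ⟨L, hL⟩ := ih h.2
    exact ⟨u :: L, by rw [hL]; rfl⟩

theorem IsWalk.exists_eq_append {u v : V} {l : List V} (h : IsWalk E u l v) (hl : l ≠ []) :
    ∃ L, l = L ++ [v] := by
  rcases List.eq_nil_or_concat l with rfl | ⟨L, x, rfl⟩
  · exact absurd rfl hl
  · rw [List.concat_eq_append] at h ⊢
    exact ⟨L, by rw [h.eq_of_append_singleton]⟩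

theorem IsWalk.pathWeight_append {u v : V} {l : List V} (h : IsWalk E u l v) (l' : List V) :
    pathWeight wt (u :: (l ++ l')) = pathWeight wt (u :: l) + pathWeight wt (v :: l') := by
  obtain ⟨L, hL⟩ := h.cons_eq
  rw [← List.cons_append, hL, List.append_assoc, List.singleton_append,
    ImpairVerif.pathWeight_append]

theorem IsWalk.isChain {u v : V} {l : List V} (h : IsWalk E u l v) : List.IsChain E (u :: l) := by
  induction l generalizing u with
  | nil => simp
  | cons x l ih => exact List.isChain_cons_cons.2 ⟨h.1, ih h.2⟩

theorem IsWalk.reflTransGen {u v : V} {l : List V} (h : IsWalk E u l v) :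
    Relation.ReflTransGen E u v := by
  induction l generalizing u with
  | nil => rw [show u = v from h]
  | cons x l ih => exact .head h.1 (ih h.2)

theorem exists_append_of_not_nodup {l : List V} (h : ¬ l.Nodup) :
    ∃ y A B C, l = A ++ y :: (B ++ y :: C) := by
  induction l with
  | nil => simp at h
  | cons x l ih =>
    by_cases hx : x ∈ l
    · obtain ⟨B, C, rfl⟩ := List.append_of_mem hx
      exact ⟨x, [], B, C, rfl⟩
    · obtain ⟨y, A, B, C, rfl⟩ := ih fun hn => h (List.nodup_cons.2 ⟨hx, hn⟩)
      exact ⟨y, x :: A, B, C, rfl⟩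

/-- Loop erasure: if a vertex put in front already occurs on the walk, the walk is cut so as to
start at that occurrence. -/
theorem exists_nodup_walk {u v : V} (h : Relation.ReflTransGen E u v) :
    ∃ l, IsWalk E u l v ∧ (u :: l).Nodup := by
  induction h using Relation.ReflTransGen.head_induction_on with
  | refl => exact ⟨[], rfl, by simp⟩
  | @head u x hux _ ih =>
    obtain ⟨l, hl, hn⟩ := ih
    by_cases hu : u ∈ x :: l
    · rcases List.mem_cons.1 hu with rfl | hu
      · exact ⟨l, hl, hn⟩
      · obtain ⟨A, B, rfl⟩ := List.append_of_mem hu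
        obtain ⟨y, _, _, hB⟩ := isWalk_append.1 hl
        refine ⟨B, hB, ?_⟩
        rw [List.nodup_cons, List.nodup_append] at hn
        exact hn.2.2.1
    · exact ⟨x :: l, ⟨hux, hl⟩, List.nodup_cons.2 ⟨hu, hn⟩⟩

/-- A lower bound on the mean weight of simple cycles holds for all closed walks. -/
theorem closedWalk_bound {a b : ℕ} {G : V → Prop}
    (hG : ∀ x y l l', IsWalk E x l y → IsWalk E y l' x → G x → G y)
    (hC : ∀ x L, G x → IsWalk E x (L ++ [x]) x → (x :: L).Nodup →
      a * (L.length + 1) ≤ b * pathWeight wt (x :: (L ++ [x]))) {x : V} {l : List V}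
    (hx : G x) (h : IsWalk E x l x) : a * l.length ≤ b * pathWeight wt (x :: l) := by
  induction hn : l.length using Nat.strong_induction_on generalizing x l with
  | _ n ih =>
  subst hn
  by_cases hl : l = []
  · simp [hl]
  obtain ⟨L, rfl⟩ := h.exists_eq_append hl
  by_cases hnd : (x :: L).Nodup
  · simpa using hC x L hx h hnd
  -- A repeated vertex splits the closed walk into two shorter closed walks, whose lengths and
  -- weights add up. If the repeated vertex is x itself, both are based at x; otherwise a closed
  -- detour at y is cut out and the rest is still based at x.
  obtain ⟨y, A, B, C, hA⟩ := exists_append_of_not_nodup hnd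
  rcases A with _ | ⟨x', A⟩
  · obtain ⟨rfl, rfl⟩ := List.cons_eq_cons.1 hA
    have e : B ++ x :: C ++ [x] = (B ++ [x]) ++ (C ++ [x]) := by simp
    rw [e] at h ⊢
    obtain ⟨z, h1, h2⟩ := isWalk_append.1 h
    obtain rfl := h1.eq_of_append_singleton
    have i1 := ih _ (by simp) hx h1 rfl
    have i2 := ih _ (by simp; omega) hx h2 rfl
    rw [h1.pathWeight_append, List.length_append]
    nlinarith
  · simp only [List.cons_append, List.cons.injEq] at hA
    obtain ⟨rfl, rfl⟩ := hA
    have e : A ++ y :: (B ++ y :: C) ++ [x] = (A ++ [y]) ++ ((B ++ [y]) ++ (C ++ [x])) := by simp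
    rw [e] at h ⊢
    obtain ⟨z, h1, h⟩ := isWalk_append.1 h
    obtain rfl := h1.eq_of_append_singleton
    obtain ⟨z, h2, h3⟩ := isWalk_append.1 h
    obtain rfl := h2.eq_of_append_singleton
    -- The closed walk itself connects x and y in both directions, so the property G passes to the
    -- base point of the detour.
    have hy := hG _ _ _ _ h1 h3 hx
    have i1 := ih _ (by simp; omega) hy h2 rfl
    have i2 := ih _ (by simp) hx (h1.append h3) rfl
    rw [h1.pathWeight_append] at i2
    rw [h1.pathWeight_append, h2.pathWeight_append]
    simp only [List.length_append] at *
    nlinarith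

/-! ### Cyclic lists as closed walks -/

theorem cyclicPairs_cons (x : V) (L : List V) : cyclicPairs (x :: L) = (x :: L).zip (L ++ [x]) := by
  simp [cyclicPairs]

theorem forall_mem_zip_iff_isWalk {x y : V} {L : List V} :
    (∀ e ∈ (x :: L).zip (L ++ [y]), E e.1 e.2) ↔ IsWalk E x (L ++ [y]) y := by
  induction L generalizing x with
  | nil => simp [IsWalk]
  | cons z L ih =>
    simp only [List.cons_append, List.zip_cons_cons, List.forall_mem_cons, IsWalk]
    rw [← ih]

theorem sum_map_zip {x y : V} {L : List V} :
    (((x :: L).zip (L ++ [y])).map fun e => wt e.1 e.2).sum =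
      pathWeight wt (x :: (L ++ [y])) := by
  induction L generalizing x with
  | nil => simp [pathWeight]
  | cons z L ih =>
    simp only [List.cons_append, List.zip_cons_cons, List.map_cons, List.sum_cons, pathWeight]
    rw [← ih]

/-- An edge of a closed walk is thus located by splitting a list, which makes it possible to find it
again inside a play. -/
theorem mem_zip_iff {u v x y : V} {L : List V} :
    (u, v) ∈ (x :: L).zip (L ++ [y]) ↔ ∃ A B, x :: (L ++ [y]) = A ++ u :: v :: B := by
  induction L generalizing x with
  | nil =>
    constructor
    · intro h
      simp only [List.nil_append, List.zip_cons_cons, List.zip_nil_right, List.mem_singleton,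
        Prod.mk.injEq] at h
      exact ⟨[], [], by simp [h.1, h.2]⟩
    · rintro ⟨A, B, h⟩
      have := congrArg List.length h
      simp only [List.nil_append, List.length_cons, List.length_append, List.length_nil] at this
      obtain rfl := List.length_eq_zero_iff.1 (show A.length = 0 by omega)
      obtain rfl := List.length_eq_zero_iff.1 (show B.length = 0 by omega)
      simp at h
      simp [h.1, h.2]
  | cons z L ih =>
    simp only [List.cons_append, List.zip_cons_cons, List.mem_cons]
    rw [ih]
    constructor
    · rintro (h | ⟨A, B, h⟩)
      · cases h
        exact ⟨[], L ++ [y], rfl⟩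
      · exact ⟨x :: A, B, by rw [h]; rfl⟩
    · rintro ⟨A, B, h⟩
      cases A with
      | nil =>
        simp only [List.nil_append, List.cons.injEq] at h
        exact .inl (by rw [h.1, h.2.1])
      | cons x' A =>
        simp only [List.cons_append, List.cons.injEq] at h
        exact .inr ⟨A, B, h.2⟩

end Walk

/-! ### Mean payoffs -/

section Mean

variable {c : ℕ → ℕ} {a b K : ℕ}

theorem tendsto_const_div_natCast {K : ℝ≥0∞} (hK : K ≠ ⊤) :
    Tendsto (fun n : ℕ => K / (n : ℝ≥0∞)) atTop (nhds 0) := by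
  simpa [div_eq_mul_inv] using
    ENNReal.Tendsto.const_mul ENNReal.tendsto_inv_nat_nhds_zero (.inr hK)

/-- The additive constant contributes K / (b n), which tends to 0 and does not change the limit
superior. -/
theorem div_le_meanCost (hb : 0 < b) (h : ∀ n, a * n ≤ b * (∑ i ∈ Finset.range n, c i) + K) :
    (a : ℝ≥0∞) / b ≤ meanCost c := by
  have hb0 : (b : ℝ≥0∞) ≠ 0 := by exact_mod_cast hb.ne'
  have hbt : (b : ℝ≥0∞) ≠ ⊤ := ENNReal.natCast_ne_top b
  have ht := tendsto_const_div_natCast (K := (K : ℝ≥0∞) / b)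
    (ENNReal.div_ne_top (ENNReal.natCast_ne_top K) hb0)
  have := ENNReal.limsup_add_of_right_tendsto_zero ht
    (fun n : ℕ => ((∑ i ∈ Finset.range n, c i : ℕ) : ℝ≥0∞) / (n : ℝ≥0∞))
  rw [meanCost, ← this, ← limsup_const (f := (atTop : Filter ℕ)) ((a : ℝ≥0∞) / b)]
  refine limsup_le_limsup ?_
  filter_upwards [eventually_gt_atTop 0] with n hn
  have hn0 : (n : ℝ≥0∞) ≠ 0 := by exact_mod_cast hn.ne'
  have hnt : (n : ℝ≥0∞) ≠ ⊤ := ENNReal.natCast_ne_top n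
  simp only [Pi.add_apply]
  rw [← ENNReal.add_div, ENNReal.le_div_iff_mul_le (.inl hn0) (.inl hnt), ENNReal.div_eq_inv_mul,
    mul_assoc, ← ENNReal.div_eq_inv_mul, ENNReal.div_le_iff_le_mul (.inl hb0) (.inl hbt), add_mul,
    ENNReal.div_mul_cancel hb0 hbt]
  have := h n
  rw [mul_comm b] at this
  exact_mod_cast this

theorem meanCost_le_div (hb : 0 < b) (h : ∀ n, b * (∑ i ∈ Finset.range n, c i) ≤ a * n + K) :
    meanCost c ≤ (a : ℝ≥0∞) / b := by
  have hb0 : (b : ℝ≥0∞) ≠ 0 := by exact_mod_cast hb.ne'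
  have hbt : (b : ℝ≥0∞) ≠ ⊤ := ENNReal.natCast_ne_top b
  have ht := tendsto_const_div_natCast (K := (K : ℝ≥0∞) / b)
    (ENNReal.div_ne_top (ENNReal.natCast_ne_top K) hb0)
  have := ENNReal.limsup_add_of_right_tendsto_zero ht (fun _ => (a : ℝ≥0∞) / b)
  rw [limsup_const] at this
  rw [meanCost, ← this]
  refine limsup_le_limsup ?_
  filter_upwards [eventually_gt_atTop 0] with n hn
  have hn0 : (n : ℝ≥0∞) ≠ 0 := by exact_mod_cast hn.ne'
  have hnt : (n : ℝ≥0∞) ≠ ⊤ := ENNReal.natCast_ne_top n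
  simp only [Pi.add_apply]
  rw [ENNReal.div_le_iff_le_mul (.inl hn0) (.inl hnt), add_mul, ENNReal.div_mul_cancel hn0 hnt,
    ENNReal.div_eq_inv_mul, mul_assoc, ← ENNReal.div_eq_inv_mul, ENNReal.div_eq_inv_mul,
    ENNReal.div_eq_inv_mul, ← mul_add, ← ENNReal.div_eq_inv_mul,
    ENNReal.le_div_iff_mul_le (.inl hb0) (.inl hbt)]
  have := h n
  rw [mul_comm b] at this
  exact_mod_cast this

end Mean

/-! ### Excess weight over a given mean -/

section Excess

variable {V : Type*} {wt : V → V → ℕ} {a b : ℕ} {x : V}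

/-- The prefixes of `l ++ [x]` exceed the mean `a / b` by at most `K / b` in total, and the whole
of it by at most `e / b`. -/
def ExcessLE (wt : V → V → ℕ) (a b : ℕ) (x : V) (l : List V) (e K : ℕ) : Prop :=
  b * pathWeight wt (l ++ [x]) ≤ a * l.length + e ∧
    ∀ p, p <+: l ++ [x] → b * pathWeight wt p ≤ a * (p.length - 1) + K

theorem pathWeight_le_of_prefix {p l : List V} (h : p <+: l) :
    pathWeight wt p ≤ pathWeight wt l := by
  obtain ⟨t, rfl⟩ := h
  rcases List.eq_nil_or_concat p with rfl | ⟨p, y, rfl⟩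
  · simp [pathWeight]
  · rw [List.concat_eq_append, List.append_assoc, List.singleton_append,
      pathWeight_append wt p y t]
    omega

theorem excessLE_trivial (wt : V → V → ℕ) (a b : ℕ) (x : V) (l : List V) :
    ExcessLE wt a b x l (b * pathWeight wt (l ++ [x])) (b * pathWeight wt (l ++ [x])) :=
  ⟨by omega, fun p hp => (Nat.mul_le_mul_left b (pathWeight_le_of_prefix hp)).trans (by omega)⟩

theorem ExcessLE.mono {l : List V} {e K e' K' : ℕ} (h : ExcessLE wt a b x l e K) (he : e ≤ e')
    (hK : K ≤ K') : ExcessLE wt a b x l e' K' :=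
  ⟨h.1.trans (by omega), fun p hp => (h.2 p hp).trans (by omega)⟩

/-- A prefix of the concatenation either ends within the first part or consists of all of it, with
excess e, and a prefix of the second part. The condition `hx` says that the second part starts at x,
where the first one returns. -/
theorem ExcessLE.append {l l' : List V} {e e' K K' : ℕ} (h : ExcessLE wt a b x l e K)
    (h' : ExcessLE wt a b x l' e' K') (hx : ∃ t, l' ++ [x] = x :: t) :
    ExcessLE wt a b x (l ++ l') (e + e') (max K (e + K')) := by
  obtain ⟨t, ht⟩ := hx
  constructor
  · have h1 := h.1
    have h2 := h'.1
    rw [ht] at h2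
    rw [List.append_assoc, ht, pathWeight_append, List.length_append]
    nlinarith
  · intro p hp
    rw [List.append_assoc] at hp
    obtain ⟨s, hs⟩ := hp
    rcases List.append_eq_append_iff.1 hs with ⟨q, rfl, _⟩ | ⟨q, rfl, hq⟩
    · refine (h.2 p (List.prefix_append_of_prefix (List.prefix_append _ _))).trans ?_
      have := le_max_left K (e + K')
      omega
    · rw [ht] at hq
      cases q with
      | nil =>
        refine (h.2 _ (by simp)).trans ?_
        have := le_max_left K (e + K')
        omega
      | cons y q =>
        have h1 := h.1
        have h2 := h'.2 (y :: q) (by rw [ht, hq]; simp)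
        simp only [List.cons_append, List.cons.injEq] at hq
        obtain ⟨rfl, rfl⟩ := hq
        rw [pathWeight_append]
        have := le_max_right K (e + K')
        simp only [List.length_append, List.length_cons, Nat.add_sub_cancel] at *
        have e2 : l.length + (q.length + 1) - 1 = l.length + q.length := by omega
        rw [e2]
        nlinarith

/-- Complete turns have excess 0, so only the turn in progress counts and the bound M does not
depend on the number of turns. -/
theorem excessLE_replicate {C : List V} {M : ℕ} (hx : ∃ t, C ++ [x] = x :: t)
    (hC : ExcessLE wt a b x C 0 M) (k : ℕ) :
    ExcessLE wt a b x (List.replicate k C).flatten 0 M := by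
  induction k with
  | zero =>
    refine ⟨by simp [pathWeight], fun p hp => ?_⟩
    have := pathWeight_le_of_prefix (wt := wt) hp
    simp only [List.replicate_zero, List.flatten_nil, List.nil_append, pathWeight] at this
    rw [Nat.le_zero.1 this]
    omega
  | succ k ih =>
    rw [List.replicate_succ', List.flatten_append, List.flatten_singleton]
    exact (ih.append hC hx).mono le_rfl (by simp)

theorem pathWeight_map_range (wt : V → V → ℕ) (π : ℕ → V) (n : ℕ) :
    pathWeight wt ((List.range (n + 1)).map π) = ∑ i ∈ Finset.range n, wt (π i) (π (i + 1)) := by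
  induction n with
  | zero => simp [pathWeight]
  | succ n ih =>
    rw [Finset.sum_range_succ, ← ih, List.range_succ, List.range_succ]
    simp only [List.map_append, List.map_cons, List.map_nil, List.append_assoc,
      List.singleton_append]
    rw [pathWeight_append]
    simp [pathWeight]

theorem IsConcat.map_range_prefix {w : ℕ → List V} {π : ℕ → V} (h : IsConcat w π) {n m : ℕ}
    (hn : n ≤ (concatUpTo w m).length) : (List.range n).map π <+: concatUpTo w m := by
  rw [List.prefix_iff_eq_take]
  refine List.ext_getElem (by simpa using hn) fun i h1 h2 => ?_
  rw [List.length_map, List.length_range] at h1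
  simp only [List.getElem_map, List.getElem_range, List.getElem_take]
  rw [h.1 m i (by omega)]

end Excess

/-! ### Plays in rounds -/

section Rounds

variable {V : Type*} {E : V → V → Prop} {wt : V → V → ℕ} {x : V} {h C D : List V} {k : ℕ → ℕ}

/-- The blocks of a play that goes `k i` times around `C` and once around `D` in round `i`. -/
def roundBlocks (h C D : List V) (k : ℕ → ℕ) : ℕ → List V
  | 0 => h
  | i + 1 => (List.replicate (k i) C).flatten ++ D

/-- The list `X` can be inserted before `x` into a walk. -/
def IsLoop (E : V → V → Prop) (x : V) (X : List V) : Prop :=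
  ∃ t, X ++ [x] = x :: t ∧ List.IsChain E (x :: t)

theorem IsLoop.append {X Y : List V} (hX : IsLoop E x X) (hY : IsLoop E x Y) :
    IsLoop E x (X ++ Y) := by
  obtain ⟨s, hs, hs'⟩ := hX
  obtain ⟨t, ht, ht'⟩ := hY
  have hc : List.IsChain E (X ++ x :: t) := List.isChain_split.2 ⟨hs ▸ hs', ht'⟩
  refine ⟨s ++ t, ?_, ?_⟩
  · rw [List.append_assoc, ht, ← List.cons_append, ← hs, List.append_assoc]; rfl
  · rwa [← List.cons_append, ← hs, List.append_assoc]

theorem isLoop_replicate (hC : IsLoop E x C) (k : ℕ) :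
    IsLoop E x (List.replicate k C).flatten := by
  induction k with
  | zero => exact ⟨[], by simp⟩
  | succ k ih =>
    rw [List.replicate_succ, List.flatten_cons]
    exact hC.append ih

theorem isLoop_roundBlocks (hC : IsLoop E x C) (hD : IsLoop E x D) (i : ℕ) :
    IsLoop E x (roundBlocks h C D k (i + 1)) := (isLoop_replicate hC _).append hD

theorem isChain_concatUpTo_roundBlocks (hh : List.IsChain E (h ++ [x])) (hC : IsLoop E x C)
    (hD : IsLoop E x D) (n : ℕ) : List.IsChain E (concatUpTo (roundBlocks h C D k) n ++ [x]) := by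
  induction n with
  | zero => simp [concatUpTo_zero]
  | succ n ih =>
    rw [concatUpTo_succ, List.append_assoc]
    cases n with
    | zero => simpa [concatUpTo_zero, roundBlocks] using hh
    | succ n =>
      obtain ⟨t, ht, ht'⟩ := isLoop_roundBlocks (h := h) (k := k) hC hD n
      rw [ht]
      exact List.isChain_split.2 ⟨ih, ht'⟩

theorem le_length_roundBlocks (hC : C ≠ []) (hD : D ≠ []) (i : ℕ) :
    k i + 1 ≤ (roundBlocks h C D k (i + 1)).length := by
  have h1 := List.length_pos_iff.2 hC
  have h2 := List.length_pos_iff.2 hD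
  simp only [roundBlocks, List.length_append, List.length_flatten, List.map_replicate,
    List.sum_replicate, smul_eq_mul]
  nlinarith

/-- This bounds the number of detours by the time: each round from `i₀` on takes at least N steps,
and the summand `N * (i₀ + 1)` pays for `h` and the earlier rounds. -/
theorem le_length_concatUpTo_roundBlocks (hC : C ≠ []) (hD : D ≠ []) {N i₀ : ℕ}
    (hk : ∀ i ≥ i₀, N ≤ k i) (j : ℕ) :
    N * j ≤ (concatUpTo (roundBlocks h C D k) j).length + N * (i₀ + 1) := by
  induction j with
  | zero => simp
  | succ j ih =>
    by_cases hj : j ≤ i₀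
    · exact (Nat.mul_le_mul_left N (by omega)).trans (Nat.le_add_left _ _)
    · obtain ⟨i, rfl⟩ : ∃ i, j = i + 1 := ⟨j - 1, by omega⟩
      have h1 := le_length_roundBlocks (h := h) (k := k) hC hD i
      have h2 := hk i (by omega)
      rw [concatUpTo_succ, List.length_append, Nat.mul_succ]
      omega

theorem exists_isConcat_roundBlocks (hC : C ≠ []) (hD : D ≠ []) :
    ∃ π, IsConcat (roundBlocks h C D k) π := by
  refine exists_isConcat (length_concatUpTo_unbounded (frequently_atTop.2 fun N => ?_))
  refine ⟨N + 1, by omega, fun hn => ?_⟩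
  have := le_length_roundBlocks (h := h) (k := k) hC hD N
  rw [hn] at this
  simp at this

/-- Relative to the mean of C only `h` and the detours D leave an excess, so it grows linearly in
the number of rounds, however many turns around C they contain. -/
theorem excessLE_concatUpTo_roundBlocks (hC : ∃ t, C ++ [x] = x :: t)
    (hD : ∃ t, D ++ [x] = x :: t) (m : ℕ) :
    ExcessLE wt (pathWeight wt (C ++ [x])) C.length x (concatUpTo (roundBlocks h C D k) (m + 1))
      (C.length * pathWeight wt (h ++ [x]) + m * (C.length * pathWeight wt (D ++ [x])))
      (C.length * pathWeight wt (C ++ [x]) + C.length * pathWeight wt (D ++ [x]) +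
        C.length * pathWeight wt (h ++ [x]) + m * (C.length * pathWeight wt (D ++ [x]))) := by
  induction m with
  | zero =>
    simp only [concatUpTo_succ, concatUpTo_zero, List.nil_append, roundBlocks]
    exact (excessLE_trivial wt _ C.length x h).mono (by omega) (by omega)
  | succ m ih =>
    rw [concatUpTo_succ]
    have hC' : ExcessLE wt (pathWeight wt (C ++ [x])) C.length x C 0
        (C.length * pathWeight wt (C ++ [x])) :=
      ⟨by rw [mul_comm]; omega, (excessLE_trivial wt _ C.length x C).2⟩
    have hb := (excessLE_replicate hC hC' (k m)).append
      (excessLE_trivial wt (pathWeight wt (C ++ [x])) C.length x D) hD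
    refine (ih.append (l' := roundBlocks h C D k (m + 1)) hb ?_).mono ?_ ?_
    · obtain ⟨t, ht⟩ := hD
      rw [roundBlocks, List.append_assoc, ht]
      obtain ⟨s, hs⟩ := hC
      cases k m with
      | zero => exact ⟨t, by simp⟩
      | succ j =>
        cases C with
        | nil => exact ⟨t, by simp⟩
        | cons y C =>
          simp only [List.cons_append, List.cons.injEq] at hs
          exact ⟨_, by rw [List.replicate_succ, List.flatten_cons, hs.1]; rfl⟩
    · rw [Nat.succ_mul]; omega
    · rw [Nat.succ_mul]
      refine max_le (by omega) ?_
      have : max (C.length * pathWeight wt (C ++ [x]))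
          (0 + C.length * pathWeight wt (D ++ [x])) ≤
          C.length * pathWeight wt (C ++ [x]) + C.length * pathWeight wt (D ++ [x]) :=
        max_le (by omega) (by omega)
      omega

/-- Each round adds at most the weight of D, scaled by the length of C, and eventually a round lasts
at least N steps. Multiplying the excess bound by N turns the number of rounds into the number of
steps. -/
theorem cost_roundBlocks_le {π : ℕ → V} (hπ : IsConcat (roundBlocks h C D k) π)
    (hC : ∃ t, C ++ [x] = x :: t) (hD : ∃ t, D ++ [x] = x :: t) (hC0 : C ≠ []) (hD0 : D ≠ [])
    {N i₀ : ℕ} (hk : ∀ i ≥ i₀, N ≤ k i) :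
    ∃ K, ∀ n, N * C.length * (∑ i ∈ Finset.range n, wt (π i) (π (i + 1))) ≤
      (N * pathWeight wt (C ++ [x]) + C.length * pathWeight wt (D ++ [x])) * n + K := by
  set a := pathWeight wt (C ++ [x])
  set δ := C.length * pathWeight wt (D ++ [x]) with hδ
  refine ⟨N * (C.length * a + δ + C.length * pathWeight wt (h ++ [x])) + δ * (N * (i₀ + 1)),
    fun n => ?_⟩
  -- The first n edges have n + 1 vertices, and j is the index of the block in which the last of
  -- them lies.
  obtain ⟨j, -, h1, h2⟩ := hπ.exists_block 0 (n + 1) (by simp [concatUpTo_zero])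
  have h3 := (excessLE_concatUpTo_roundBlocks (wt := wt) (h := h) (k := k) hC hD j).2 _
    ((hπ.map_range_prefix h2).trans (List.prefix_append _ _))
  rw [pathWeight_map_range, List.length_map, List.length_range, Nat.add_sub_cancel, ← hδ] at h3
  have h4 := le_length_concatUpTo_roundBlocks (h := h) (k := k) hC0 hD0 hk j
  have h5 : N * j ≤ n + N * (i₀ + 1) := by omega
  have h6 := Nat.mul_le_mul_left δ h5
  have h7 := Nat.mul_le_mul_left N h3
  change N * (C.length * _) ≤ N * (a * n + _) at h7
  nlinarith

/-- The list `D ++ [x]` occurs in every round, since the next round begins at x. So every edge of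
the closed walk recurs, including the one that closes it. -/
theorem frequently_roundBlocks {π : ℕ → V} (hπ : IsConcat (roundBlocks h C D k) π)
    (hC : IsLoop E x C) (hD : IsLoop E x D) (hC0 : C ≠ []) (hD0 : D ≠ []) {u v : V} {A B : List V}
    (hu : D ++ [x] = A ++ u :: v :: B) : ∃ᶠ n in atTop, π n = u ∧ π (n + 1) = v := by
  rw [frequently_atTop]
  intro N
  obtain ⟨m, hm⟩ := hπ.2 N
  have hm' : N ≤ (concatUpTo (roundBlocks h C D k) (m + 1)).length :=
    hm.trans (length_concatUpTo_mono _ (Nat.le_succ m))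
  obtain ⟨t, ht⟩ : ∃ t, roundBlocks h C D k (m + 2) = x :: t := by
    obtain ⟨t, ht, _⟩ := isLoop_roundBlocks (h := h) (k := k) hC hD (m + 1)
    have := le_length_roundBlocks (h := h) (k := k) hC0 hD0 (m + 1)
    cases hr : roundBlocks h C D k (m + 2) with
    | nil => rw [hr] at this; simp at this
    | cons y r =>
      rw [hr] at ht
      simp only [List.cons_append, List.cons.injEq] at ht
      exact ⟨r, by rw [ht.1]⟩
  have he : concatUpTo (roundBlocks h C D k) (m + 3) =
      (concatUpTo (roundBlocks h C D k) (m + 1) ++ (List.replicate (k m) C).flatten ++ A) ++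
        u :: v :: (B ++ t) := by
    rw [concatUpTo_succ, concatUpTo_succ, ht, roundBlocks,
      show ∀ X Y : List V, X ++ Y ++ x :: t = X ++ Y ++ [x] ++ t by simp]
    rw [show ∀ X Y Z : List V, X ++ (Y ++ Z) ++ [x] = X ++ Y ++ (Z ++ [x]) by simp, hu]
    simp
  set X := concatUpTo (roundBlocks h C D k) (m + 1) ++ (List.replicate (k m) C).flatten ++ A
  have hX : N ≤ X.length := by simp only [X, List.length_append]; omega
  refine ⟨X.length, hX, ?_, ?_⟩
  · rw [← hπ.1 (m + 3) X.length (by simp [he])]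
    simp [he]
  · rw [← hπ.1 (m + 3) (X.length + 1) (by simp [he])]
    simp [he]

theorem roundBlocks_periodic {N : ℕ} {π : ℕ → V} (hD0 : D ≠ [])
    (hπ : IsConcat (roundBlocks h C D fun _ => N) π) :
    ∀ n ≥ h.length, π (n + ((List.replicate N C).flatten ++ D).length) = π n := by
  set X := (List.replicate N C).flatten ++ D with hX
  have hc : ∀ m, concatUpTo (roundBlocks h C D fun _ => N) (m + 1) =
      h ++ (List.replicate m X).flatten := by
    intro m
    induction m with
    | zero => simp [concatUpTo_succ, concatUpTo_zero, roundBlocks]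
    | succ m ih =>
      rw [concatUpTo_succ, ih, List.replicate_succ', List.flatten_append]
      simp [roundBlocks, hX]
  intro n hn
  have hX0 : 0 < X.length := by
    have := List.length_pos_iff.2 hD0
    simp only [hX, List.length_append]; omega
  have hl : ∀ m, m ≤ (List.replicate m X).flatten.length := by
    intro m
    simp only [List.length_flatten, List.map_replicate, List.sum_replicate, smul_eq_mul]
    nlinarith
  -- Behind `h` the play repeats X; removing one copy of X shifts the position by the length of X.
  have e1 : (h ++ (List.replicate (n + 1) X).flatten)[n]? = some (π n) := by
    have hlt : n < (h ++ (List.replicate (n + 1) X).flatten).length := by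
      have := hl (n + 1)
      simp only [List.length_append]; omega
    rw [List.getElem?_eq_getElem hlt]
    simp only [← hc]
    rw [hπ.1]
  have e2 : (h ++ (List.replicate (n + 2) X).flatten)[n + X.length]? =
      some (π (n + X.length)) := by
    have hlt : n + X.length < (h ++ (List.replicate (n + 2) X).flatten).length := by
      have := hl (n + 1)
      rw [List.replicate_succ, List.flatten_cons]
      simp only [List.length_append]; omega
    rw [List.getElem?_eq_getElem hlt]
    simp only [← hc]
    rw [hπ.1]
  rw [List.getElem?_append_right hn] at e1
  rw [List.getElem?_append_right (by omega), List.replicate_succ, List.flatten_cons,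
    List.getElem?_append_right (by omega), show n + X.length - h.length - X.length = n - h.length by
      omega, e1] at e2
  exact (Option.some.inj e2).symm

end Rounds

theorem natCast_div_le_div_iff {a b c d : ℕ} (hb : 0 < b) (hd : 0 < d) :
    (a : ℝ≥0∞) / b ≤ (c : ℝ≥0∞) / d ↔ a * d ≤ c * b := by
  rw [ENNReal.le_div_iff_mul_le (.inl (Nat.cast_ne_zero.2 hd.ne')) (.inl (ENNReal.natCast_ne_top d)),
    mul_comm, ← mul_div_assoc, ENNReal.div_le_iff_le_mul (.inl (Nat.cast_ne_zero.2 hb.ne'))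
    (.inl (ENNReal.natCast_ne_top b)), mul_comm]
  exact_mod_cast Iff.rfl

section Threshold

variable {AP Γ S Q P : Type*} {K : Kripke S AP} {T : RepairMachine Q (Set AP) Γ} {B : NBA P Γ}

/-! ### Candidate cycles -/

variable (K T B) in
/-- Vertices that are reachable and lie on a closed walk with an accepting edge. -/
def IsGood (v : PVertex S Q P) : Prop :=
  (∃ v₀ ∈ initialVertices K T B, Reaches K T B v₀ v) ∧
    ∃ x y, AcceptingEdge K T B x y ∧ Reaches K T B v x ∧ Reaches K T B y v

theorem isClosedWalk_cons {x : PVertex S Q P} {L : List (PVertex S Q P)} :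
    IsClosedWalk K T B (x :: L) ↔ IsWalk (Edge K T B) x (L ++ [x]) x := by
  rw [IsClosedWalk, cyclicPairs_cons, forall_mem_zip_iff_isWalk]
  simp

theorem cycleMean_cons {x : PVertex S Q P} {L : List (PVertex S Q P)} :
    cycleMean K T B (x :: L) =
      (pathWeight (weight K T B) (x :: (L ++ [x])) : ℝ≥0∞) / ((L.length + 1 : ℕ) : ℝ≥0∞) := by
  rw [cycleMean, cyclicPairs_cons, sum_map_zip, List.length_cons]

theorem IsGood.of_walk {x y : PVertex S Q P} {l l' : List (PVertex S Q P)}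
    (h : IsWalk (Edge K T B) x l y) (h' : IsWalk (Edge K T B) y l' x) (hx : IsGood K T B x) :
    IsGood K T B y := by
  obtain ⟨⟨v₀, h0, h1⟩, u, v, ha, h2, h3⟩ := hx
  exact ⟨⟨v₀, h0, h1.trans h.reflTransGen⟩, u, v, ha, h'.reflTransGen.trans h2,
    h3.trans h.reflTransGen⟩

theorem IsClosedWalk.reaches {C : List (PVertex S Q P)} (h : IsClosedWalk K T B C)
    {u v : PVertex S Q P} (hu : u ∈ C) (hv : v ∈ C) : Reaches K T B u v := by
  obtain ⟨x, L, rfl⟩ := List.exists_cons_of_ne_nil h.1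
  rw [isClosedWalk_cons] at h
  have key : ∀ z ∈ x :: L, Reaches K T B x z ∧ Reaches K T B z x := by
    intro z hz
    rcases List.mem_cons.1 hz with rfl | hz
    · exact ⟨.refl, .refl⟩
    · obtain ⟨A, A', rfl⟩ := List.append_of_mem hz
      rw [List.append_assoc, List.cons_append, ← List.singleton_append, ← List.append_assoc] at h
      obtain ⟨y, h1, h2⟩ := isWalk_append.1 h
      obtain rfl := h1.eq_of_append_singleton
      exact ⟨h1.reflTransGen, h2.reflTransGen⟩
  exact (key u hu).2.trans (key v hv).1

theorem mem_of_mem_cyclicPairs {V : Type*} {C : List V} {e : V × V} (h : e ∈ cyclicPairs C) :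
    e.1 ∈ C ∧ e.2 ∈ C := by
  obtain ⟨h1, h2⟩ := List.of_mem_zip (a := e.1) (b := e.2) h
  exact ⟨h1, List.mem_rotate.1 h2⟩

/-- An accepting edge that closes up lies on an accepting cycle. -/
theorem exists_accepting_cycle {x y : PVertex S Q P} (ha : AcceptingEdge K T B x y)
    (h : Reaches K T B y x) : ∃ C, IsCycle K T B C ∧ IsAccepting K T B C ∧ y ∈ C := by
  -- Loop erasure acts on the return path only and keeps its end points, so the accepting edge
  -- survives as the edge that closes the cycle.
  obtain ⟨l, hl, hn⟩ := exists_nodup_walk h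
  refine ⟨y :: l, ⟨isClosedWalk_cons.2 (hl.append ⟨ha.1, rfl⟩), hn⟩, ⟨(x, y), ?_, ha⟩, by simp⟩
  obtain ⟨A, hA⟩ := hl.cons_eq
  rw [cyclicPairs_cons, mem_zip_iff]
  exact ⟨A, [], by rw [← List.cons_append, hA]; simp⟩

/-- With the converse `IsCandidate.isGood`, candidacy of a cycle becomes a property of any one of
its vertices. Unlike the original condition, it passes to all cycles into which a closed walk is
split. -/
theorem isCandidate_of_isGood {C : List (PVertex S Q P)} (hC : IsCycle K T B C)
    {v : PVertex S Q P} (hv : v ∈ C) (hg : IsGood K T B v) : IsCandidate K T B C := by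
  obtain ⟨⟨v₀, h0, h1⟩, x, y, ha, h2, h3⟩ := hg
  obtain ⟨C₂, hC₂, hacc, hy⟩ := exists_accepting_cycle ha (h3.trans h2)
  have hvy : Reaches K T B v y := h2.trans (.single ha.1)
  exact ⟨hC, C₂, ⟨hC₂, hacc, v₀, h0, y, hy, h1.trans hvy⟩, ⟨y, hy, v, hv, h3⟩, ⟨v, hv, y, hy, hvy⟩⟩

theorem IsCandidate.isGood {C : List (PVertex S Q P)} (hC : IsCandidate K T B C)
    {x : PVertex S Q P} (hx : x ∈ C) : IsGood K T B x := by
  obtain ⟨hcyc, C₂, ⟨hC₂, ⟨e, he, hacc⟩, v₀, h0, v, hv, hr⟩, ⟨v1, hv1, u1, hu1, hr1⟩,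
    ⟨u2, hu2, v2, hv2, hr2⟩⟩ := hC
  obtain ⟨he1, he2⟩ := mem_of_mem_cyclicPairs he
  have hin : ∀ z ∈ C₂, Reaches K T B z x := fun z hz =>
    ((hC₂.1.reaches hz hv1).trans hr1).trans (hcyc.1.reaches hu1 hx)
  exact ⟨⟨v₀, h0, hr.trans (hin v hv)⟩, e.1, e.2, hacc,
    ((hcyc.1.reaches hx hu2).trans hr2).trans (hC₂.1.reaches hv2 he1), hin _ he2⟩

theorem IsAccessibleAcceptingCycle.isCandidate {C : List (PVertex S Q P)}
    (h : IsAccessibleAcceptingCycle K T B C) : IsCandidate K T B C := by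
  obtain ⟨v₀, h0, v, hv, hr⟩ := h.2.2
  exact ⟨h.1, C, h, ⟨v, hv, v, hv, .refl⟩, ⟨v, hv, v, hv, .refl⟩⟩

/-- A minimum exists because cycles are lists without repetition over a finite set, and there are
finitely many of these. -/
theorem exists_isLeastMeanCycle [Finite S] [Finite Q] [Finite P]
    (h : ∃ C, IsAccessibleAcceptingCycle K T B C) : ∃ C, IsLeastMeanCycle K T B C := by
  have := Fintype.ofFinite (PVertex S Q P)
  have hfin : {C | IsCandidate K T B C}.Finite :=
    (List.finite_length_le (PVertex S Q P) (Fintype.card (PVertex S Q P))).subset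
      fun C hC => hC.1.2.length_le_card
  obtain ⟨C₀, h0⟩ := h
  obtain ⟨C, hC, hmin⟩ := Set.exists_min_image _ (cycleMean K T B) hfin ⟨C₀, h0.isCandidate⟩
  exact ⟨C, hC, hmin⟩

/-- The mean weight of closed walks through good vertices is at least that of a least-mean
cycle. -/
theorem IsLeastMeanCycle.closedWalk_bound {x : PVertex S Q P} {L : List (PVertex S Q P)}
    (hC : IsLeastMeanCycle K T B (x :: L)) {u : PVertex S Q P} {l : List (PVertex S Q P)}
    (hu : IsGood K T B u) (hl : IsWalk (Edge K T B) u l u) :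
    pathWeight (weight K T B) (x :: (L ++ [x])) * l.length ≤
      (L.length + 1) * pathWeight (weight K T B) (u :: l) := by
  refine ImpairVerif.closedWalk_bound (E := Edge K T B) (G := IsGood K T B)
    (fun y z l l' h h' hy => hy.of_walk h h') (fun y M hy hM hn => ?_) hu hl
  have hle := hC.2 (y :: M)
    (isCandidate_of_isGood ⟨isClosedWalk_cons.2 hM, hn⟩ List.mem_cons_self hy)
  rw [cycleMean_cons, cycleMean_cons, natCast_div_le_div_iff (by simp) (by simp)] at hle
  nlinarith

/-! ### The lower bound -/

theorem isWalk_ofPath {V : Type*} {E : V → V → Prop} {π : ℕ → V} (h : ∀ n, E (π n) (π (n + 1)))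
    (m n : ℕ) : ∃ l, IsWalk E (π m) l (π (m + n)) ∧ l.length = n ∧ ∀ wt : V → V → ℕ,
      pathWeight wt (π m :: l) = ∑ i ∈ Finset.range n, wt (π (m + i)) (π (m + i + 1)) := by
  induction n with
  | zero => exact ⟨[], rfl, rfl, fun wt => by simp [pathWeight]⟩
  | succ n ih =>
    obtain ⟨l, hl, hlen, hw⟩ := ih
    refine ⟨l ++ [π (m + n + 1)], hl.append ⟨h _, rfl⟩, by simp [hlen], fun wt => ?_⟩
    rw [hl.pathWeight_append, hw, Finset.sum_range_succ]
    simp [pathWeight]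

/-- Some accepting edge is used between two visits of u. -/
theorem isGood_of_frequently {π : ℕ → PVertex S Q P} (h0 : π 0 ∈ initialVertices K T B)
    (he : ∀ n, Edge K T B (π n) (π (n + 1)))
    (hacc : ∃ᶠ n in atTop, AcceptingEdge K T B (π n) (π (n + 1))) {u : PVertex S Q P}
    (hu : ∃ᶠ n in atTop, π n = u) : IsGood K T B u := by
  have hr : ∀ m n, m ≤ n → Reaches K T B (π m) (π n) := fun m n hmn => by
    obtain ⟨l, hl, _⟩ := isWalk_ofPath he m (n - m)
    rw [Nat.add_sub_cancel' hmn] at hl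
    exact hl.reflTransGen
  obtain ⟨m, -, hm⟩ := frequently_atTop.1 hu 0
  obtain ⟨k, hk, hk'⟩ := frequently_atTop.1 hacc m
  obtain ⟨n, hn, hn'⟩ := frequently_atTop.1 hu (k + 1)
  exact ⟨⟨π 0, h0, hm ▸ hr 0 m (Nat.zero_le m)⟩, _, _, hk', hm ▸ hr m k hk, hn' ▸ hr (k + 1) n hn⟩

theorem exists_frequently_eq {V : Type*} [Finite V] (π : ℕ → V) :
    ∃ u, ∃ᶠ n in atTop, π n = u := by
  obtain ⟨u, hu⟩ := Finite.exists_infinite_fiber π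
  exact ⟨u, Nat.frequently_atTop_iff_infinite.2 (Set.infinite_coe_iff.1 hu)⟩

/-- Segments from a recurrent vertex u are closed up by walks of bounded weight, and the bound for
closed walks applies. The costs c may exceed the edge weights, so that runs with wasteful
transitions are covered. -/
theorem IsLeastMeanCycle.le_meanCost [Finite S] [Finite Q] [Finite P] {C : List (PVertex S Q P)}
    (hC : IsLeastMeanCycle K T B C) {π : ℕ → PVertex S Q P} (h0 : π 0 ∈ initialVertices K T B)
    (he : ∀ n, Edge K T B (π n) (π (n + 1)))
    (hacc : ∃ᶠ n in atTop, AcceptingEdge K T B (π n) (π (n + 1))) {c : ℕ → ℕ}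
    (hc : ∀ n, weight K T B (π n) (π (n + 1)) ≤ c n) : cycleMean K T B C ≤ meanCost c := by
  obtain ⟨x, L, rfl⟩ := List.exists_cons_of_ne_nil hC.1.1.1.1
  rw [cycleMean_cons]
  obtain ⟨u, hu⟩ := exists_frequently_eq π
  have hg := isGood_of_frequently h0 he hacc hu
  obtain ⟨n₀, -, hn₀⟩ := frequently_atTop.1 hu 0
  -- The return walk is chosen for each vertex rather than for each time; finiteness of the product
  -- then bounds all their weights by one M.
  have hret : ∀ z : PVertex S Q P, ∃ l, Reaches K T B z u → IsWalk (Edge K T B) z l u := by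
    intro z
    by_cases hz : Reaches K T B z u
    · obtain ⟨l, hl, _⟩ := exists_nodup_walk hz
      exact ⟨l, fun _ => hl⟩
    · exact ⟨[], fun h => absurd h hz⟩
  choose r hr using hret
  obtain ⟨M, hM⟩ : ∃ M, ∀ z, pathWeight (weight K T B) (z :: r z) ≤ M := by
    obtain ⟨M, hM⟩ := (Set.finite_range fun z => pathWeight (weight K T B) (z :: r z)).bddAbove
    exact ⟨M, fun z => hM ⟨z, rfl⟩⟩
  set a := pathWeight (weight K T B) (x :: (L ++ [x])) with ha
  have key : ∀ n, a * n ≤ (L.length + 1) * (∑ i ∈ Finset.range n, c (n₀ + i)) +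
      (L.length + 1) * M := by
    intro n
    obtain ⟨l, hl, hlen, hw⟩ := isWalk_ofPath he n₀ n
    obtain ⟨m, hm, hm'⟩ := frequently_atTop.1 hu (n₀ + n)
    have hz : Reaches K T B (π (n₀ + n)) u := by
      obtain ⟨l, hl, _⟩ := isWalk_ofPath he (n₀ + n) (m - (n₀ + n))
      rw [Nat.add_sub_cancel' hm, hm'] at hl
      exact hl.reflTransGen
    have hcl := hl.append (hr _ hz)
    rw [← hn₀] at hcl hg
    have hb := hC.closedWalk_bound hg hcl
    rw [hl.pathWeight_append, hw, List.length_append, hlen, ← ha] at hb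
    have h1 : ∑ i ∈ Finset.range n, weight K T B (π (n₀ + i)) (π (n₀ + i + 1)) ≤
        ∑ i ∈ Finset.range n, c (n₀ + i) := Finset.sum_le_sum fun i _ => hc _
    have h2 := hM (π (n₀ + n))
    calc a * n ≤ a * (n + (r (π (n₀ + n))).length) := Nat.mul_le_mul_left a (Nat.le_add_right _ _)
      _ ≤ _ := hb
      _ ≤ (L.length + 1) * (∑ i ∈ Finset.range n, c (n₀ + i) + M) :=
        Nat.mul_le_mul_left _ (Nat.add_le_add h1 h2)
      _ = _ := Nat.mul_add _ _ _
  -- The costs before time `n₀` are dropped, and the share `a * n₀` of these steps goes into the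
  -- constant.
  refine div_le_meanCost (K := a * n₀ + (L.length + 1) * M) (Nat.succ_pos _) fun n => ?_
  rcases le_total n n₀ with h | h
  · have := Nat.mul_le_mul_left a h
    omega
  · obtain ⟨n, rfl⟩ := Nat.exists_eq_add_of_le h
    have := key n
    rw [Finset.sum_range_add, Nat.mul_add, Nat.mul_add]
    omega

theorem IsLeastMeanCycle.le_impairThreshold [Finite S] [Finite Q] [Finite P]
    {C : List (PVertex S Q P)} (hC : IsLeastMeanCycle K T B C) :
    cycleMean K T B C ≤ impairThreshold K T B := by
  refine le_iInf₂ fun τ ⟨t, ht, v, hv, _, hopt⟩ => le_trans ?_ hopt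
  refine le_iInf₂ fun ρ ⟨hρ, hc⟩ => ?_
  obtain ⟨π, h0, hs, hacc⟩ := exists_path_of_run ht hρ hv hc
  exact hC.le_meanCost h0 (fun n => ⟨_, _, hs n⟩) hacc fun n => weight_le_of_step (hs n)

theorem impairThreshold_eq_top [Finite S] [Finite Q] [Finite P]
    (h : ¬ ∃ C, IsAccessibleAcceptingCycle K T B C) : impairThreshold K T B = ⊤ := by
  refine iInf₂_eq_top.2 fun τ ⟨t, ht, v, hv, ⟨ρ, hρ, hc⟩, _⟩ => absurd ?_ h
  obtain ⟨π, h0, hs, hacc⟩ := exists_path_of_run ht hρ hv hc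
  obtain ⟨u, hu⟩ := exists_frequently_eq π
  obtain ⟨⟨v₀, h0, h1⟩, x, y, ha, h2, h3⟩ :=
    isGood_of_frequently h0 (fun n => ⟨_, _, hs n⟩) hacc hu
  obtain ⟨C₂, hC₂, hacc, hy⟩ := exists_accepting_cycle ha (h3.trans h2)
  exact ⟨C₂, hC₂, hacc, v₀, h0, y, hy, (h1.trans h2).tail ha.1⟩

/-! ### Optimal strategies -/

/-- The threshold is at most the cost of any impairing strategy. -/
theorem Impairs.impairThreshold_le {σ : Strategy (PVertex S Q P) Γ} (h : Impairs K T B σ) {μ : ℝ≥0∞}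
    (hμ : μ ≠ ⊤) (hm : meanCost (outcome K T B σ).cost ≤ μ) : impairThreshold K T B ≤ μ := by
  obtain ⟨h0, he, -, hρ, v, hv, hc⟩ := h
  lift μ to ℝ≥0 using hμ
  exact iInf₂_le μ ⟨_, trace_of_path h0 he, v, hv, ⟨_, hρ, hc⟩, (iInf₂_le _ ⟨hρ, hc⟩).trans hm⟩

theorem exists_isChain_of_reflTransGen {V : Type*} {E : V → V → Prop} {u v : V}
    (h : Relation.ReflTransGen E u v) :
    ∃ l, List.IsChain E (l ++ [v]) ∧ (l ++ [v]).head? = some u := by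
  obtain ⟨l, hl, _⟩ := exists_nodup_walk h
  obtain ⟨L, hL⟩ := hl.cons_eq
  exact ⟨L, hL ▸ hl.isChain, by rw [← hL]; rfl⟩

variable (K T B) in
/-- The strategy that follows `π` and writes words of least cost. -/
noncomputable def leastCostStrategy (π : ℕ → PVertex S Q P) : Strategy (PVertex S Q P) Γ :=
  .ofPlay π fun n => Classical.epsilon fun w =>
    Step K T B (π n) (π (n + 1)) w (weight K T B (π n) (π (n + 1)))

theorem cost_leastCostStrategy (π : ℕ → PVertex S Q P) :
    (outcome K T B (leastCostStrategy K T B π)).cost =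
      fun n => weight K T B (π n) (π (n + 1)) := by
  simp only [outcome, leastCostStrategy, Strategy.play_ofPlay]

theorem impairs_leastCostStrategy {π : ℕ → PVertex S Q P} (h0 : π 0 ∈ initialVertices K T B)
    (he : ∀ n, Edge K T B (π n) (π (n + 1)))
    (hacc : ∃ᶠ n in atTop, AcceptingEdge K T B (π n) (π (n + 1))) :
    Impairs K T B (leastCostStrategy K T B π) := by
  have h := run_of_path (K := K) (T := T) (B := B) h0
    (fun n => Classical.epsilon_spec (exists_step_weight (he n))) hacc
  simp only [Impairs, outcome, leastCostStrategy, Strategy.play_ofPlay, Strategy.word_ofPlay]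
  exact ⟨h0, he, hacc, h⟩

/-- Around every least-mean cycle there are impairing plays in rounds. -/
theorem IsLeastMeanCycle.exists_rounds {x : PVertex S Q P} {L : List (PVertex S Q P)}
    (hC : IsLeastMeanCycle K T B (x :: L)) :
    ∃ h D, IsClosedWalk K T B (x :: D) ∧ IsAccepting K T B (x :: D) ∧ ∀ k : ℕ → ℕ,
      ∃ π, IsConcat (roundBlocks h (x :: L) (x :: D) k) π ∧ π 0 ∈ initialVertices K T B ∧
        (∀ n, Edge K T B (π n) (π (n + 1))) ∧
        ∃ᶠ n in atTop, AcceptingEdge K T B (π n) (π (n + 1)) := by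
  obtain ⟨⟨v₀, h0, h1⟩, u, v, ha, h2, h3⟩ := hC.1.isGood (List.mem_cons_self (a := x))
  obtain ⟨l₁, hl₁, -⟩ := exists_nodup_walk h2
  obtain ⟨l₂, hl₂, -⟩ := exists_nodup_walk h3
  obtain ⟨h, hh, hh0⟩ := exists_isChain_of_reflTransGen h1
  -- The closed walk D leads from x to the accepting edge from u to v and back to x.
  have hcl : IsWalk (Edge K T B) x (l₁ ++ v :: l₂) x := hl₁.append ⟨ha.1, hl₂⟩
  obtain ⟨D, hD⟩ := hcl.exists_eq_append (by simp)
  rw [hD] at hcl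
  obtain ⟨A, hA⟩ := hl₁.cons_eq
  have hDuv : x :: (D ++ [x]) = A ++ u :: v :: l₂ := by
    rw [← hD, ← List.cons_append, hA]; simp
  have hCw := isClosedWalk_cons.1 hC.1.1.1
  have hLC : IsLoop (Edge K T B) x (x :: L) := ⟨_, rfl, hCw.isChain⟩
  have hLD : IsLoop (Edge K T B) x (x :: D) := ⟨_, rfl, hcl.isChain⟩
  refine ⟨h, D, isClosedWalk_cons.2 hcl, ⟨(u, v), ?_, ha⟩, fun k => ?_⟩
  · rw [cyclicPairs_cons, mem_zip_iff]
    exact ⟨A, l₂, hDuv⟩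
  · obtain ⟨π, hπ⟩ := exists_isConcat_roundBlocks (h := h) (C := x :: L) (D := x :: D) (k := k)
      (by simp) (by simp)
    refine ⟨π, hπ, ?_, ?_, ?_⟩
    -- The prefix `h` may be empty and the first round may have no turn around C. In every case the
    -- first two blocks begin with `h ++ [x]`, whose head is the initial vertex.
    · have hpre : h ++ [x] <+: concatUpTo (roundBlocks h (x :: L) (x :: D) k) 2 := by
        simp only [concatUpTo_succ, concatUpTo_zero, roundBlocks, List.nil_append]
        rw [List.prefix_append_right_inj]
        cases k 0 with
        | zero => simp
        | succ j => simp [List.replicate_succ]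
      have hlt : 0 < (h ++ [x]).length := by simp
      have e1 := hpre.getElem hlt
      rw [hπ.1] at e1
      rw [List.head?_eq_getElem?, List.getElem?_eq_getElem hlt, e1] at hh0
      rw [Option.some.inj hh0]
      exact h0
    · refine hπ.isChain fun n => ?_
      exact (List.isChain_append.1 (isChain_concatUpTo_roundBlocks hh hLC hLD n)).1
    · refine (frequently_roundBlocks hπ hLC hLD (by simp) (by simp) hDuv).mono ?_
      rintro n ⟨h4, h5⟩
      rwa [h4, h5]

/-- The strategy with 2 ^ i turns costs at most the mean of C, the threshold is at most this mean,
and the lower bound closes the circle. -/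
theorem IsLeastMeanCycle.main [Finite S] [Finite Q] [Finite P] {C : List (PVertex S Q P)}
    (hC : IsLeastMeanCycle K T B C) : impairThreshold K T B = cycleMean K T B C ∧
      (∃ (σ : Strategy (PVertex S Q P) Γ) (h D : List (PVertex S Q P)),
        IsClosedWalk K T B D ∧ IsAccepting K T B D ∧ C.head? = D.head? ∧
        IsRoundPlay h C D σ.play ∧ Impairs K T B σ ∧
        meanCost (outcome K T B σ).cost = impairThreshold K T B) ∧
      (∀ ε : ℝ≥0, 0 < ε → ∃ σ : Strategy (PVertex S Q P) Γ, σ.FiniteMemory ∧ Impairs K T B σ ∧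
        meanCost (outcome K T B σ).cost ≤ impairThreshold K T B + (ε : ℝ≥0∞)) := by
  obtain ⟨x, L, rfl⟩ := List.exists_cons_of_ne_nil hC.1.1.1.1
  obtain ⟨h, D, hD, hDacc, hk⟩ := hC.exists_rounds
  set a := pathWeight (weight K T B) (x :: (L ++ [x])) with ha
  set δ := (L.length + 1) * pathWeight (weight K T B) (x :: (D ++ [x])) with hδ
  have hmean : cycleMean K T B (x :: L) = (a : ℝ≥0∞) / ((L.length + 1 : ℕ) : ℝ≥0∞) := cycleMean_cons
  have hb0 : ((L.length + 1 : ℕ) : ℝ≥0∞) ≠ 0 :=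
    Nat.cast_ne_zero.2 (Nat.succ_ne_zero _)
  have hfin : cycleMean K T B (x :: L) ≠ ⊤ := by
    rw [hmean]
    exact ENNReal.div_ne_top (ENNReal.natCast_ne_top _) hb0
  -- The factor `L.length + 1` in the denominator of the second summand is given away; only its
  -- decay in N matters.
  have hcost : ∀ (k : ℕ → ℕ) (π), IsConcat (roundBlocks h (x :: L) (x :: D) k) π → ∀ N i₀ : ℕ,
      0 < N → (∀ i ≥ i₀, N ≤ k i) → meanCost (fun n => weight K T B (π n) (π (n + 1))) ≤
        cycleMean K T B (x :: L) + (δ : ℝ≥0∞) / (N : ℝ≥0∞) := by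
    intro k π hπ N i₀ hN hi
    obtain ⟨M, hM⟩ := cost_roundBlocks_le (wt := weight K T B) hπ (x := x) ⟨_, rfl⟩ ⟨_, rfl⟩
      (by simp) (by simp) hi
    have hN0 : (N : ℝ≥0∞) ≠ 0 := by exact_mod_cast hN.ne'
    refine (meanCost_le_div (Nat.mul_pos hN (by simp)) hM).trans ?_
    simp only [List.cons_append, List.length_cons, ← ha, ← hδ]
    rw [hmean, Nat.cast_add, ENNReal.add_div, Nat.cast_mul, Nat.cast_mul,
      ENNReal.mul_div_mul_left _ _ hN0 (ENNReal.natCast_ne_top N)]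
    gcongr
    rw [← Nat.cast_mul]
    exact Nat.cast_le.2 (Nat.le_mul_of_pos_right N (Nat.succ_pos _))
  obtain ⟨π, hπ, h0, he, hacc⟩ := hk fun i => 2 ^ i
  have hle : meanCost (outcome K T B (leastCostStrategy K T B π)).cost ≤
      cycleMean K T B (x :: L) := by
    rw [cost_leastCostStrategy]
    have ht := (tendsto_const_div_natCast (K := (δ : ℝ≥0∞)) (ENNReal.natCast_ne_top δ)).const_add
      (cycleMean K T B (x :: L))
    rw [add_zero] at ht
    refine ge_of_tendsto ht ?_
    filter_upwards [eventually_gt_atTop 0] with N hN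
    -- Every N is eventually exceeded: N ≤ 2 ^ i as soon as i ≥ N.
    exact hcost _ π hπ N N hN fun i hi => hi.trans (Nat.lt_two_pow_self).le
  have himp := impairs_leastCostStrategy h0 he hacc
  have heq : impairThreshold K T B = cycleMean K T B (x :: L) :=
    le_antisymm (himp.impairThreshold_le hfin hle) hC.le_impairThreshold
  refine ⟨heq, ⟨_, h, x :: D, hD, hDacc, rfl, ?_, himp, le_antisymm (heq ▸ hle) ?_⟩, ?_⟩
  · rw [leastCostStrategy, Strategy.play_ofPlay, IsRoundPlay]
    convert hπ using 1
    funext n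
    cases n <;> rfl
  · rw [heq, cost_leastCostStrategy]
    exact hC.le_meanCost h0 he hacc fun n => le_rfl
  · intro ε hε
    have ht := tendsto_const_div_natCast (K := (δ : ℝ≥0∞)) (ENNReal.natCast_ne_top δ)
    obtain ⟨N, hN, hN0⟩ := ((ht.eventually_le_const (ENNReal.coe_pos.2 hε)).and
      (eventually_gt_atTop 0)).exists
    obtain ⟨π, hπ, h0, he, hacc⟩ := hk fun _ => N
    refine ⟨leastCostStrategy K T B π, ?_, impairs_leastCostStrategy h0 he hacc, ?_⟩
    · have hper := roundBlocks_periodic (by simp) hπ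
      refine Strategy.finiteMemory_ofPlay (n₀ := h.length) (by simp) hper fun n hn => ?_
      -- The chosen word depends only on the two ends of the edge, so the output inherits the period
      -- of the play.
      have h1 := hper (n + 1) (by omega)
      rw [Nat.add_right_comm] at h1
      rw [h1, hper n hn]
    · rw [cost_leastCostStrategy, heq]
      exact (hcost _ π hπ N 0 hN0 fun _ _ => le_rfl).trans (by gcongr)

end Threshold

/-! ### Functions computable in polynomial time -/

/-- Types whose elements are given to programs as trees. -/
class Enc (α : Type) where
  enc : α → Data

open ImpairVerif.Enc

instance : Enc Data := ⟨_root_.id⟩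
instance : Enc ℕ := ⟨.num⟩
-- The unit value is encoded like the empty list. So a tuple that ends in `Unit` has the tree of a
-- list, which lets `Raw` match the lists of mixed type in `Input.encode`.
instance : Enc Unit := ⟨fun _ => .num 0⟩
instance : Enc Bool := ⟨fun b => .num b.toNat⟩
instance {α β : Type} [Enc α] [Enc β] : Enc (α × β) := ⟨fun p => .pair (enc p.1) (enc p.2)⟩
instance {α : Type} [Enc α] : Enc (List α) := ⟨fun l => .ofList (l.map enc)⟩
instance {α : Type} [Enc α] : Enc (Option α) := ⟨fun o => .ofList (o.toList.map enc)⟩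
instance : Enc (WithTop ℕ) := inferInstanceAs (Enc (Option ℕ))

section PolyFun

variable {α β γ σ : Type} [Enc α] [Enc β] [Enc γ] [Enc σ]

/-- Size of the encoding. -/
def esize (x : α) : ℕ := (enc x).size

theorem esize_pair (x : α) (y : β) : esize (x, y) = 1 + esize x + esize y := rfl
theorem esize_nil : esize ([] : List α) = 1 := rfl
theorem esize_cons (a : α) (l : List α) : esize (a :: l) = 1 + esize a + esize l := rfl
theorem esize_nat (n : ℕ) : esize n = 1 + n.size := rfl

theorem esize_bool (b : Bool) : esize b ≤ 2 := by
  cases b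
  · exact Nat.le_of_ble_eq_true rfl
  · change 1 + Nat.size 1 ≤ 2
    simp

theorem esize_pos (x : α) : 0 < esize x := by
  unfold esize
  cases enc x <;> simp only [Data.size] <;> omega

theorem esize_append (l l' : List α) : esize (l ++ l') + 1 = esize l + esize l' := by
  induction l with
  | nil => rw [List.nil_append, esize_nil]; omega
  | cons a l ih => rw [List.cons_append, esize_cons, esize_cons]; omega

theorem length_lt_esize (l : List α) : l.length < esize l := by
  induction l with
  | nil => simp [esize_nil]
  | cons a l ih => rw [esize_cons, List.length_cons]; omega

theorem esize_le_of_mem {a : α} {l : List α} (h : a ∈ l) : esize a ≤ esize l := by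
  induction l with
  | nil => simp at h
  | cons b l ih =>
    rw [esize_cons]
    rcases List.mem_cons.1 h with rfl | h
    · omega
    · have := ih h
      omega

theorem esize_le_of_forall {l : List α} {M : ℕ} (h : ∀ a ∈ l, esize a ≤ M) :
    esize l ≤ 1 + l.length * (M + 1) := by
  induction l with
  | nil => simp [esize_nil]
  | cons b l ih =>
    have h1 := ih fun a ha => h a (List.mem_cons_of_mem _ ha)
    have h2 := h b List.mem_cons_self
    rw [esize_cons, List.length_cons, Nat.succ_mul]
    omega

theorem esize_le_of_sublist {l l' : List α} (h : l.Sublist l') : esize l ≤ esize l' := by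
  induction h with
  | slnil => exact le_rfl
  | cons a _ ih => rw [esize_cons]; omega
  | cons_cons a _ ih => rw [esize_cons, esize_cons]; omega

/-- Writing is charged, so a time bound also bounds the size of the result; this makes polynomial
time stable under composition. -/
theorem Run.size_le {f : Prog} {x y : Data} {t : ℕ} (h : Run f x y t) : y.size ≤ t := by
  induction h with
  | prim o x => omega
  | seq _ _ _ ih => omega
  | both _ _ ih1 ih2 => simp only [Data.size]; omega
  | iteTrue _ _ _ _ ih => omega
  | iteFalse _ _ _ _ ih => omega
  | loopStop _ _ _ => omega
  | loopStep _ _ _ _ _ _ ih => omega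

/-- Monotonicity, due to natural coefficients, allows time bounds to be evaluated at upper bounds
for sizes. -/
theorem eval_mono (q : Polynomial ℕ) : Monotone fun n => q.eval n := by
  intro m n h
  simp only [Polynomial.eval_eq_sum_range]
  gcongr

theorem eval_le_eval (q : Polynomial ℕ) {m n : ℕ} (h : m ≤ n) : q.eval m ≤ q.eval n := eval_mono q h

/-- The function `f` is computed by a program in polynomial time. -/
@[fun_prop]
def PolyFun (f : α → β) : Prop :=
  ∃ (prog : Prog) (q : Polynomial ℕ), ∀ x, ∃ t, Run prog (enc x) (enc (f x)) t ∧
    t ≤ q.eval (esize x)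

/-! ### Closure under composition, pairing, branching and bounded loops -/

namespace PolyFun

theorem size_le {f : α → β} (hf : PolyFun f) :
    ∃ q : Polynomial ℕ, ∀ x, esize (f x) ≤ q.eval (esize x) := by
  obtain ⟨prog, q, h⟩ := hf
  refine ⟨q, fun x => ?_⟩
  obtain ⟨t, ht, hq⟩ := h x
  exact ht.size_le.trans hq

theorem of_prim {f : α → β} (o : Prim) (h : ∀ x, o.eval (enc x) = enc (f x)) (q : Polynomial ℕ)
    (hq : ∀ x, esize (f x) ≤ q.eval (esize x)) : PolyFun f := by
  refine ⟨.prim o, 1 + Polynomial.X + q, fun x => ⟨_, h x ▸ Run.prim o (enc x), ?_⟩⟩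
  have := hq x
  simp only [Polynomial.eval_add, Polynomial.eval_one, Polynomial.eval_X]
  unfold esize at *
  omega

@[fun_prop]
theorem id : PolyFun fun x : α => x :=
  of_prim .id (fun _ => rfl) .X fun x => by simp

@[fun_prop]
theorem const (c : β) : PolyFun fun _ : α => c :=
  of_prim (.const (enc c)) (fun _ => rfl) (.C (esize c)) fun x => by simp

@[fun_prop]
theorem comp {g : β → γ} {f : α → β} (hg : PolyFun g) (hf : PolyFun f) :
    PolyFun fun x => g (f x) := by
  obtain ⟨pg, qg, hg⟩ := hg
  obtain ⟨pf, qf, hf⟩ := hf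
  refine ⟨.seq pf pg, 1 + qf + qg.comp qf, fun x => ?_⟩
  obtain ⟨t₁, h1, h1'⟩ := hf x
  obtain ⟨t₂, h2, h2'⟩ := hg (f x)
  refine ⟨_, .seq h1 h2, ?_⟩
  have := eval_le_eval qg (h1.size_le.trans h1')
  simp only [Polynomial.eval_add, Polynomial.eval_one, Polynomial.eval_comp]
  unfold esize at *
  omega

@[fun_prop]
theorem prodMk {f : α → β} {g : α → γ} (hf : PolyFun f) (hg : PolyFun g) :
    PolyFun fun x => (f x, g x) := by
  obtain ⟨pf, qf, hf⟩ := hf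
  obtain ⟨pg, qg, hg⟩ := hg
  refine ⟨.both pf pg, 1 + Polynomial.X + qf + qg + qf + qg, fun x => ?_⟩
  obtain ⟨t₁, h1, h1'⟩ := hf x
  obtain ⟨t₂, h2, h2'⟩ := hg x
  refine ⟨_, .both h1 h2, ?_⟩
  have := h1.size_le
  have := h2.size_le
  simp only [Polynomial.eval_add, Polynomial.eval_one, Polynomial.eval_X]
  unfold esize at *
  omega

@[fun_prop]
theorem fst : PolyFun fun x : α × β => x.1 :=
  of_prim .fst (fun _ => rfl) .X fun x => by
    obtain ⟨a, b⟩ := x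
    rw [Polynomial.eval_X, esize_pair]; simp only; omega

@[fun_prop]
theorem snd : PolyFun fun x : α × β => x.2 :=
  of_prim .snd (fun _ => rfl) .X fun x => by
    obtain ⟨a, b⟩ := x
    rw [Polynomial.eval_X, esize_pair]; simp only; omega

theorem branch {c : α → β} {f g h : α → γ} (hc : PolyFun c) (hf : PolyFun f) (hg : PolyFun g)
    (h1 : ∀ x, (enc (c x)).IsTrue → h x = f x) (h2 : ∀ x, ¬ (enc (c x)).IsTrue → h x = g x) :
    PolyFun h := by
  obtain ⟨pc, qc, hc⟩ := hc
  obtain ⟨pf, qf, hf⟩ := hf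
  obtain ⟨pg, qg, hg⟩ := hg
  refine ⟨.ite pc pf pg, 1 + Polynomial.X + qc + qf + qg, fun x => ?_⟩
  obtain ⟨t₁, r1, r1'⟩ := hc x
  simp only [Polynomial.eval_add, Polynomial.eval_one, Polynomial.eval_X]
  by_cases hx : (enc (c x)).IsTrue
  · obtain ⟨t₂, r2, r2'⟩ := hf x
    rw [h1 x hx]
    exact ⟨_, .iteTrue r1 hx r2, by unfold esize at *; omega⟩
  · obtain ⟨t₂, r2, r2'⟩ := hg x
    rw [h2 x hx]
    exact ⟨_, .iteFalse r1 hx r2, by unfold esize at *; omega⟩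

@[fun_prop]
theorem cond {c : α → Bool} {f g : α → γ} (hc : PolyFun c) (hf : PolyFun f) (hg : PolyFun g) :
    PolyFun fun x => bif c x then f x else g x := by
  refine branch hc hf hg (fun x hx => ?_) fun x hx => ?_
  · cases h : c x
    · rw [h] at hx; exact absurd rfl hx
    · rfl
  · cases h : c x
    · rfl
    · rw [h] at hx; exact absurd (by simp [enc, Data.IsTrue]) hx

/-- Iterating a polynomial-time function may blow up the state exponentially, so a polynomial bound
for all intermediate states is required. The loop carries the input, the state and the remaining
list, which is false as a condition exactly when it is empty. -/
theorem foldl {l : α → List β} {i : α → σ} {f : α → σ → β → σ} (hl : PolyFun l) (hi : PolyFun i)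
    (hf : PolyFun fun p : α × σ × β => f p.1 p.2.1 p.2.2)
    (hq : ∃ q : Polynomial ℕ, ∀ x l₁, l₁ <+: l x →
      esize (l₁.foldl (f x) (i x)) ≤ q.eval (esize x)) :
    PolyFun fun x => (l x).foldl (f x) (i x) := by
  obtain ⟨q, hq⟩ := hq
  obtain ⟨ql, hql⟩ := hl.size_le
  obtain ⟨p₀, q₀, h₀⟩ : PolyFun fun x : α => (x, i x, l x) := by fun_prop
  obtain ⟨pc, qc, hc⟩ : PolyFun fun y : α × σ × List β => y.2.2 := by fun_prop
  obtain ⟨ps, qs, hs⟩ : PolyFun fun y : α × σ × β × List β =>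
      (y.1, f y.1 y.2.1 y.2.2.1, y.2.2.2) := by
    have : PolyFun fun y : α × σ × β × List β => f y.1 y.2.1 y.2.2.1 :=
      hf.comp (f := fun y : α × σ × β × List β => (y.1, y.2.1, y.2.2.1)) (by fun_prop)
    fun_prop
  obtain ⟨pe, qe, he⟩ : PolyFun fun y : α × σ × List β => y.2.1 := by fun_prop
  have loop : ∀ (x : α) (l : List β) (s : σ) (M : ℕ),
      (∀ l₁, l₁ <+: l → 3 + esize x + esize (l₁.foldl (f x) s) + esize l ≤ M) →
      ∃ t, Run (.loop pc ps) (enc (x, s, l)) (enc (x, l.foldl (f x) s, ([] : List β))) t ∧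
        t ≤ (l.length + 1) * (1 + M + qc.eval M + qs.eval M) := by
    intro x l
    induction l with
    | nil =>
      intro s M hM
      obtain ⟨t, ht, ht'⟩ := hc (x, s, [])
      refine ⟨_, .loopStop ht (by simp [enc, Data.ofList, Data.IsTrue]), ?_⟩
      have h1 := hM [] (List.prefix_refl _)
      have h2 : esize (x, s, ([] : List β)) ≤ M := by
        simp only [esize_pair, List.foldl_nil] at *; omega
      have h3 := eval_le_eval qc h2
      simp only [List.length_nil, Nat.zero_add, Nat.one_mul]
      unfold esize at *
      omega
    | cons b l ih =>
      intro s M hM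
      obtain ⟨t₁, r1, r1'⟩ := hc (x, s, b :: l)
      -- A nonempty list has the same tree as the pair of its head and tail, so the loop body reads
      -- `(x, s, b :: l)` as `(x, s, b, l)`.
      obtain ⟨t₂, r2, r2'⟩ := hs (x, s, b, l)
      obtain ⟨t₃, r3, r3'⟩ := ih (f x s b) M fun l₁ hl₁ => by
        have h1 := hM (b :: l₁) ((List.prefix_cons_inj b).2 hl₁)
        rw [List.foldl_cons, esize_cons] at h1
        omega
      refine ⟨_, .loopStep r1 trivial r2 r3, ?_⟩
      have h1 := hM [] (List.nil_prefix)
      have h2 : esize (x, s, b :: l) ≤ M := by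
        simp only [esize_pair, List.foldl_nil] at *; omega
      have h3 := eval_le_eval qc h2
      have h4 := eval_le_eval qs (show esize (x, s, b, l) ≤ M from h2)
      rw [List.length_cons, Nat.succ_mul (l.length + 1)]
      unfold esize at *
      omega
  refine ⟨.seq p₀ (.seq (.loop pc ps) pe),
    2 + q₀ + (ql + 1) * (1 + (3 + Polynomial.X + q + ql) + qc.comp (3 + Polynomial.X + q + ql) +
      qs.comp (3 + Polynomial.X + q + ql)) + qe.comp (3 + Polynomial.X + q + ql), fun x => ?_⟩
  have hM : ∀ l₁, l₁ <+: l x → 3 + esize x + esize (l₁.foldl (f x) (i x)) + esize (l x) ≤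
      3 + esize x + q.eval (esize x) + ql.eval (esize x) := by
    intro l₁ hl₁
    have := hq x l₁ hl₁
    have := hql x
    omega
  obtain ⟨t₁, r1, r1'⟩ := h₀ x
  obtain ⟨t₂, r2, r2'⟩ := loop x (l x) (i x) _ hM
  obtain ⟨t₃, r3, r3'⟩ := he (x, (l x).foldl (f x) (i x), [])
  refine ⟨_, .seq r1 (.seq r2 r3), ?_⟩
  have h1 := hM (l x) (List.prefix_refl _)
  have h2 : esize (x, (l x).foldl (f x) (i x), ([] : List β)) ≤
      3 + esize x + q.eval (esize x) + ql.eval (esize x) := by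
    have := esize_pos (l x)
    simp only [esize_pair, esize_nil]
    omega
  have h3 := eval_le_eval qe h2
  have h4 : (l x).length + 1 ≤ ql.eval (esize x) + 1 := by
    have := length_lt_esize (l x)
    have := hql x
    omega
  have h5 := Nat.mul_le_mul_right (1 + (3 + esize x + q.eval (esize x) + ql.eval (esize x)) +
    qc.eval (3 + esize x + q.eval (esize x) + ql.eval (esize x)) +
    qs.eval (3 + esize x + q.eval (esize x) + ql.eval (esize x))) h4
  have e3 : ∀ n : ℕ, Polynomial.eval n (3 : Polynomial ℕ) = 3 := fun n => by
    exact Polynomial.eval_natCast (n := 3)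
  have e2 : ∀ n : ℕ, Polynomial.eval n (2 : Polynomial ℕ) = 2 := fun n => by
    exact Polynomial.eval_natCast (n := 2)
  simp only [Polynomial.eval_add, Polynomial.eval_one, Polynomial.eval_X, Polynomial.eval_mul,
    Polynomial.eval_comp, e2, e3]
  omega

/-- Loops whose state grows by a bounded amount in every round. -/
theorem foldl_of_additive {l : α → List β} {i : α → σ} {f : α → σ → β → σ} (hl : PolyFun l)
    (hi : PolyFun i) (hf : PolyFun fun p : α × σ × β => f p.1 p.2.1 p.2.2)
    (hq : ∃ q : Polynomial ℕ, ∀ x s b, esize (f x s b) ≤ esize s + q.eval (esize (x, b))) :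
    PolyFun fun x => (l x).foldl (f x) (i x) := by
  obtain ⟨q, hq⟩ := hq
  obtain ⟨ql, hql⟩ := hl.size_le
  obtain ⟨qi, hqi⟩ := hi.size_le
  refine foldl hl hi hf ⟨qi + ql * q.comp (1 + Polynomial.X + ql), fun x l₁ hl₁ => ?_⟩
  have key : ∀ (l₁ : List β) (s : σ), (∀ b ∈ l₁, b ∈ l x) → esize (l₁.foldl (f x) s) ≤
      esize s + l₁.length * q.eval (1 + esize x + ql.eval (esize x)) := by
    intro l₁
    induction l₁ with
    | nil => simp
    | cons b l₁ ih =>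
      intro s hb
      have h1 := ih (f x s b) fun c hc => hb c (List.mem_cons_of_mem _ hc)
      have h2 := hq x s b
      have h3 := eval_le_eval q (show esize (x, b) ≤ 1 + esize x + ql.eval (esize x) by
        have := (esize_le_of_mem (hb b List.mem_cons_self)).trans (hql x)
        rw [esize_pair]; omega)
      rw [List.foldl_cons, List.length_cons, Nat.succ_mul]
      omega
  have h1 := key l₁ (i x) fun b hb => hl₁.subset hb
  have h2 : l₁.length ≤ ql.eval (esize x) :=
    (hl₁.length_le.trans (length_lt_esize _).le).trans (hql x)
  have h3 := Nat.mul_le_mul_right (q.eval (1 + esize x + ql.eval (esize x))) h2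
  have h4 := hqi x
  simp only [Polynomial.eval_add, Polynomial.eval_one, Polynomial.eval_X, Polynomial.eval_mul,
    Polynomial.eval_comp]
  omega

/-! ### Numbers and truth values -/

@[fun_prop]
theorem natAdd {f g : α → ℕ} (hf : PolyFun f) (hg : PolyFun g) : PolyFun fun x => f x + g x := by
  have : PolyFun fun p : ℕ × ℕ => p.1 + p.2 := of_prim .add (fun _ => rfl) .X fun p => by
    rw [Polynomial.eval_X, ← Prod.mk.eta (p := p), esize_pair, esize_nat, esize_nat, esize_nat]
    have h1 : p.1 < 2 ^ (p.1.size + p.2.size) := p.1.lt_size_self.trans_le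
      (Nat.pow_le_pow_right (by omega) (by omega))
    have h2 : p.2 < 2 ^ (p.1.size + p.2.size) := p.2.lt_size_self.trans_le
      (Nat.pow_le_pow_right (by omega) (by omega))
    have h3 : (p.1 + p.2).size ≤ p.1.size + p.2.size + 1 := by
      rw [Nat.size_le, Nat.pow_succ]; omega
    simp only
    omega
  exact this.comp (hf.prodMk hg)

@[fun_prop]
theorem natSub {f g : α → ℕ} (hf : PolyFun f) (hg : PolyFun g) : PolyFun fun x => f x - g x := by
  have : PolyFun fun p : ℕ × ℕ => p.1 - p.2 := of_prim .sub (fun _ => rfl) .X fun p => by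
    rw [Polynomial.eval_X, ← Prod.mk.eta (p := p), esize_pair, esize_nat, esize_nat, esize_nat]
    have := Nat.size_le_size (Nat.sub_le p.1 p.2)
    simp only
    omega
  exact this.comp (hf.prodMk hg)

@[fun_prop]
theorem natMul {f g : α → ℕ} (hf : PolyFun f) (hg : PolyFun g) : PolyFun fun x => f x * g x := by
  have : PolyFun fun p : ℕ × ℕ => p.1 * p.2 := of_prim .mul (fun _ => rfl) .X fun p => by
    rw [Polynomial.eval_X, ← Prod.mk.eta (p := p), esize_pair, esize_nat, esize_nat, esize_nat]
    have h3 : (p.1 * p.2).size ≤ p.1.size + p.2.size := by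
      rw [Nat.size_le, pow_add]
      exact Nat.mul_lt_mul'' p.1.lt_size_self p.2.lt_size_self
    simp only
    omega
  exact this.comp (hf.prodMk hg)

@[fun_prop]
theorem decideNatLe {f g : α → ℕ} (hf : PolyFun f) (hg : PolyFun g) :
    PolyFun fun x => decide (f x ≤ g x) := by
  refine branch (c := fun x => f x - g x) (by fun_prop) (const false) (const true)
    (fun x hx => ?_) fun x hx => ?_
  · have : f x - g x ≠ 0 := hx
    simp; omega
  · have : f x - g x = 0 := not_not.1 hx
    simp; omega

end PolyFun

end PolyFun

/-- Membership in a list. -/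
def memb {β : Type} [DecidableEq β] (b : β) (l : List β) : Bool := l.any fun c => decide (b = c)

theorem memb_iff {β : Type} [DecidableEq β] {b : β} {l : List β} : memb b l = true ↔ b ∈ l := by
  simp [memb]

namespace PolyFun

variable {α β γ σ : Type} [Enc α] [Enc β] [Enc γ] [Enc σ]

@[fun_prop]
theorem not {f : α → Bool} (hf : PolyFun f) : PolyFun fun x => !f x := by
  have := cond hf (const false) (const true)
  convert this using 2 with x
  cases f x <;> rfl

@[fun_prop]
theorem and {f g : α → Bool} (hf : PolyFun f) (hg : PolyFun g) : PolyFun fun x => f x && g x := by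
  have := cond hf hg (const false)
  convert this using 2 with x
  cases f x <;> rfl

@[fun_prop]
theorem or {f g : α → Bool} (hf : PolyFun f) (hg : PolyFun g) : PolyFun fun x => f x || g x := by
  have := cond hf (const true) hg
  convert this using 2 with x
  cases f x <;> rfl

/-! ### Decidable equality -/

variable (α) in
/-- Equality is decidable in polynomial time. -/
class DecEq [DecidableEq α] : Prop where
  polyFun : PolyFun fun p : α × α => decide (p.1 = p.2)

@[fun_prop]
theorem decideEq [DecidableEq β] [DecEq β] {f g : α → β} (hf : PolyFun f) (hg : PolyFun g) :
    PolyFun fun x => decide (f x = g x) :=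
  (DecEq.polyFun (α := β)).comp (hf.prodMk hg)

instance : DecEq ℕ where
  polyFun := by
    have : PolyFun fun p : ℕ × ℕ => decide (p.1 ≤ p.2) && decide (p.2 ≤ p.1) := by fun_prop
    convert this using 2 with p
    rw [← Bool.decide_and, decide_eq_decide]
    omega

instance : DecEq Bool where
  polyFun := by
    have : PolyFun fun p : Bool × Bool => bif p.1 then p.2 else !p.2 := by fun_prop
    convert this using 2 with p
    rcases p with ⟨_ | _, _ | _⟩ <;> rfl

instance [DecidableEq α] [DecidableEq β] [DecEq α] [DecEq β] : DecEq (α × β) where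
  polyFun := by
    have : PolyFun fun p : (α × β) × (α × β) => decide (p.1.1 = p.2.1) && decide (p.1.2 = p.2.2) := by
      fun_prop
    convert this using 2 with p
    rw [← Bool.decide_and, decide_eq_decide, Prod.ext_iff]

/-! ### Lists -/

@[fun_prop]
theorem cons {f : α → β} {g : α → List β} (hf : PolyFun f) (hg : PolyFun g) :
    PolyFun fun x => f x :: g x := by
  obtain ⟨p, q, h⟩ := hf.prodMk hg
  exact ⟨p, q, h⟩

@[fun_prop]
theorem reverse {l : α → List β} (hl : PolyFun l) : PolyFun fun x => (l x).reverse := by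
  have := foldl_of_additive (f := fun _ (s : List β) (b : β) => b :: s) hl (const [])
    (by fun_prop) ⟨.X, fun x s b => by
      rw [Polynomial.eval_X, esize_pair, esize_cons]; omega⟩
  convert this using 2 with x
  simp

@[fun_prop]
theorem append {l l' : α → List β} (hl : PolyFun l) (hl' : PolyFun l') :
    PolyFun fun x => l x ++ l' x := by
  have := foldl_of_additive (f := fun _ (s : List β) (b : β) => b :: s) hl.reverse hl'
    (by fun_prop) ⟨.X, fun x s b => by
      rw [Polynomial.eval_X, esize_pair, esize_cons]; omega⟩
  convert this using 2 with x
  simp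

theorem flatMap {l : α → List β} {f : α → β → List γ} (hl : PolyFun l)
    (hf : PolyFun fun p : α × β => f p.1 p.2) : PolyFun fun x => (l x).flatMap (f x) := by
  obtain ⟨q, hq⟩ := hf.size_le
  have := foldl_of_additive (f := fun x (s : List γ) (b : β) => s ++ f x b) hl (const [])
    (append (by fun_prop)
      (hf.comp (f := fun p : α × List γ × β => (p.1, p.2.2)) (by fun_prop)))
    ⟨q, fun x s b => by
      have := esize_append s (f x b)
      have := hq (x, b)
      simp only at this
      omega⟩
  convert this using 2 with x
  have key : ∀ (l : List β) (s : List γ),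
      l.foldl (fun s b => s ++ f x b) s = s ++ l.flatMap (f x) := by
    intro l
    induction l with
    | nil => simp
    | cons b l ih => intro s; simp [ih]
  rw [key, List.nil_append]

theorem map {l : α → List β} {f : α → β → γ} (hl : PolyFun l)
    (hf : PolyFun fun p : α × β => f p.1 p.2) : PolyFun fun x => (l x).map (f x) := by
  have := flatMap (f := fun x b => [f x b]) hl (by fun_prop)
  convert this using 2 with x
  exact List.map_eq_flatMap

theorem filter {l : α → List β} {f : α → β → Bool} (hl : PolyFun l)
    (hf : PolyFun fun p : α × β => f p.1 p.2) : PolyFun fun x => (l x).filter (f x) := by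
  have := flatMap (f := fun x b => bif f x b then [b] else []) hl (by fun_prop)
  convert this using 2 with x
  induction l x with
  | nil => rfl
  | cons b l ih =>
    rw [List.filter_cons, List.flatMap_cons, ← ih]
    cases f x b <;> rfl

theorem any {l : α → List β} {f : α → β → Bool} (hl : PolyFun l)
    (hf : PolyFun fun p : α × β => f p.1 p.2) : PolyFun fun x => (l x).any (f x) := by
  have := foldl_of_additive (f := fun x s b => s || f x b) hl (const false)
    (or (by fun_prop) (hf.comp (f := fun p : α × Bool × β => (p.1, p.2.2)) (by fun_prop)))
    ⟨.C 2, fun x s b => by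
      rw [Polynomial.eval_C]
      exact (esize_bool _).trans (Nat.le_add_left _ _)⟩
  convert this using 2 with x
  have key : ∀ (l : List β) (s : Bool), l.foldl (fun s b => s || f x b) s = (s || l.any (f x)) := by
    intro l
    induction l with
    | nil => simp
    | cons b l ih => intro s; simp [ih, Bool.or_assoc]
  rw [key, Bool.false_or]

theorem all {l : α → List β} {f : α → β → Bool} (hl : PolyFun l)
    (hf : PolyFun fun p : α × β => f p.1 p.2) : PolyFun fun x => (l x).all (f x) := by
  have := (any (f := fun x b => !f x b) hl (by fun_prop)).not
  convert this using 2 with x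
  simp [List.not_any_eq_all_not]

@[fun_prop]
theorem memb [DecidableEq β] [DecEq β] {l : α → List β} {f : α → β} (hl : PolyFun l)
    (hf : PolyFun f) : PolyFun fun x => memb (f x) (l x) :=
  any (f := fun x b => decide (f x = b)) hl
    (decideEq (hf.comp (f := fun p : α × β => p.1) (by fun_prop)) (by fun_prop))

@[fun_prop]
theorem zipIdx {l : α → List β} (hl : PolyFun l) : PolyFun fun x => (l x).zipIdx := by
  have key : ∀ (l : List β) (s : List (β × ℕ)) (k : ℕ),
      l.foldl (fun (s : ℕ × List (β × ℕ)) b => (s.1 + 1, s.2 ++ [(b, s.1)])) (k, s) =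
        (k + l.length, s ++ l.zipIdx k) := by
    intro l
    induction l with
    | nil => simp
    | cons b l ih =>
      intro s k
      rw [List.foldl_cons, ih]
      simp [Nat.add_comm 1, Nat.add_assoc]
  obtain ⟨q, hq⟩ := hl.size_le
  have := snd.comp (foldl (f := fun _ (s : ℕ × List (β × ℕ)) (b : β) => (s.1 + 1, s.2 ++ [(b, s.1)])) hl
    (const (0, [])) (by fun_prop)
    ⟨4 + 2 * q + q * (2 + 2 * q + 1), fun x l₁ hl₁ => ?_⟩)
  · convert this using 2 with x
    rw [key]
    simp
  · rw [key, esize_pair, esize_nat, Nat.zero_add, List.nil_append]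
    have h1 := hl₁.length_le
    have h2 := length_lt_esize (l x)
    have h3 := hq x
    have h4 : l₁.length.size ≤ l₁.length := Nat.size_le.2 Nat.lt_two_pow_self
    have h5 : esize (l₁.zipIdx) ≤ 1 + l₁.zipIdx.length * (2 + 2 * q.eval (esize x) + 1) := by
      refine esize_le_of_forall fun a ha => ?_
      obtain ⟨b, i⟩ := a
      have h6 := List.mem_zipIdx ha
      have h7 : esize b ≤ esize (l x) := esize_le_of_mem (hl₁.subset (List.fst_mem_of_mem_zipIdx ha))
      have h8 : i.size ≤ i := Nat.size_le.2 Nat.lt_two_pow_self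
      rw [esize_pair, esize_nat]
      omega
    rw [List.length_zipIdx] at h5
    have h9 := Nat.mul_le_mul_right (2 + 2 * q.eval (esize x) + 1)
      (show l₁.length ≤ q.eval (esize x) by omega)
    have e4 : Polynomial.eval (esize x) (4 : Polynomial ℕ) = 4 := Polynomial.eval_natCast (n := 4)
    have e2 : Polynomial.eval (esize x) (2 : Polynomial ℕ) = 2 := Polynomial.eval_natCast (n := 2)
    simp only [Polynomial.eval_add, Polynomial.eval_mul, Polynomial.eval_one, e2, e4]
    omega

/-- A fold traverses only one list at a time. Equality of two lists is therefore tested as mutual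
inclusion of their sets of indexed entries. -/
theorem decide_eq_zipIdx {τ : Type} [DecidableEq τ] (l l' : List τ) :
    decide (l = l') = (l.zipIdx.all (fun a => ImpairVerif.memb a l'.zipIdx) &&
      l'.zipIdx.all fun a => ImpairVerif.memb a l.zipIdx) := by
  rw [Bool.eq_iff_iff]
  simp only [decide_eq_true_eq, Bool.and_eq_true, List.all_eq_true, memb_iff]
  refine ⟨fun h => by subst h; exact ⟨fun _ h => h, fun _ h => h⟩, fun ⟨h1, h2⟩ => ?_⟩
  refine List.ext_getElem? fun i => Option.ext fun a => ?_
  exact ⟨fun h => List.mem_zipIdx_iff_getElem?.1 (h1 (a, i) (List.mem_zipIdx_iff_getElem?.2 h)),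
    fun h => List.mem_zipIdx_iff_getElem?.1 (h2 (a, i) (List.mem_zipIdx_iff_getElem?.2 h))⟩

instance [DecidableEq α] [DecEq α] : DecEq (List α) where
  polyFun := by
    have h1 : PolyFun fun p : List α × List α =>
        p.1.zipIdx.all fun a => ImpairVerif.memb a p.2.zipIdx := all (by fun_prop) (by fun_prop)
    have h2 : PolyFun fun p : List α × List α =>
        p.2.zipIdx.all fun a => ImpairVerif.memb a p.1.zipIdx := all (by fun_prop) (by fun_prop)
    have := h1.and h2
    convert this using 2 with p
    exact decide_eq_zipIdx p.1 p.2

/-! ### Optional values -/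

@[fun_prop]
theorem some {f : α → β} (hf : PolyFun f) : PolyFun fun x => some (f x) := by
  obtain ⟨p, q, h⟩ := hf.prodMk (const ())
  exact ⟨p, q, h⟩

/-- The value `none` is encoded as 0, the only false tree, and `some b` as the pair of b and the
unit value, so the branch on the option itself decides the case. -/
theorem optionElim {o : α → Option β} {f : α → γ} {g : α → β → γ} (ho : PolyFun o)
    (hf : PolyFun f) (hg : PolyFun fun p : α × β => g p.1 p.2) :
    PolyFun fun x => (o x).elim (f x) (g x) := by
  obtain ⟨pg, qg, hg⟩ := hg
  obtain ⟨ph, qh, hh⟩ : PolyFun fun y : α × β × Unit => (y.1, y.2.1) := by fun_prop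
  obtain ⟨po, qo, ho⟩ := ho
  obtain ⟨pf, qf, hf⟩ := hf
  refine ⟨.ite po (.seq (.both (.prim .id) po) (.seq ph pg)) pf,
    5 + 5 * Polynomial.X + 5 * qo + qf + qh.comp (1 + Polynomial.X + qo) +
      qg.comp (1 + Polynomial.X + qo), fun x => ?_⟩
  obtain ⟨t₁, r1, r1'⟩ := ho x
  have e : ∀ k n : ℕ, Polynomial.eval n (k : Polynomial ℕ) = k := fun k n =>
    Polynomial.eval_natCast
  have e5 := e 5
  simp only [Nat.cast_ofNat] at e5
  simp only [Polynomial.eval_add, Polynomial.eval_one, Polynomial.eval_X, Polynomial.eval_mul,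
    Polynomial.eval_comp, e5]
  cases hx : o x with
  | none =>
    rw [hx] at r1
    obtain ⟨t₂, r2, r2'⟩ := hf x
    exact ⟨_, .iteFalse r1 (by simp [enc, Data.ofList, Data.IsTrue]) r2, by unfold esize at *; omega⟩
  | some b =>
    rw [hx] at r1
    obtain ⟨t₂, r2, r2'⟩ := hh (x, b, ())
    obtain ⟨t₃, r3, r3'⟩ := hg (x, b)
    refine ⟨_, .iteTrue r1 trivial (.seq (.both (.prim .id _) r1) (.seq r2 r3)), ?_⟩
    have h1 := r1.size_le
    have h2 : esize (x, b, ()) ≤ 1 + esize x + qo.eval (esize x) :=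
      Nat.add_le_add_left (h1.trans r1') _
    have h3 : esize (x, b) ≤ 1 + esize x + qo.eval (esize x) := by
      refine le_trans ?_ h2
      rw [esize_pair, esize_pair, esize_pair]; omega
    have h4 := eval_le_eval qh h2
    have h5 := eval_le_eval qg h3
    simp only [Prim.eval]
    unfold esize at *
    omega

@[fun_prop]
theorem coeWithTop {f : α → ℕ} (hf : PolyFun f) : PolyFun fun x => (f x : WithTop ℕ) := hf.some

theorem withTopElim {o : α → WithTop ℕ} {f : α → γ} {g : α → ℕ → γ} (ho : PolyFun o)
    (hf : PolyFun f) (hg : PolyFun fun p : α × ℕ => g p.1 p.2) :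
    PolyFun fun x => Option.elim (o x) (f x) (g x) := optionElim (β := ℕ) ho hf hg

@[fun_prop]
theorem withTopAdd {f g : α → WithTop ℕ} (hf : PolyFun f) (hg : PolyFun g) :
    PolyFun fun x => f x + g x := by
  have h : PolyFun fun p : WithTop ℕ × WithTop ℕ =>
      Option.elim p.1 (⊤ : WithTop ℕ) fun m => Option.elim p.2 (⊤ : WithTop ℕ) fun n =>
        ((m + n : ℕ) : WithTop ℕ) :=
    withTopElim fst (const _) (withTopElim (g := fun (p : (WithTop ℕ × WithTop ℕ) × ℕ) n =>
      ((p.2 + n : ℕ) : WithTop ℕ)) (by fun_prop) (const _) (by fun_prop))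
  have h' := h.comp (hf.prodMk hg)
  convert h' using 2 with x
  cases f x <;> cases g x <;> rfl

@[fun_prop]
theorem withTopMin {f g : α → WithTop ℕ} (hf : PolyFun f) (hg : PolyFun g) :
    PolyFun fun x => min (f x) (g x) := by
  have h : PolyFun fun p : WithTop ℕ × WithTop ℕ =>
      Option.elim p.1 p.2 fun m => Option.elim p.2 p.1 fun n =>
        bif decide (m ≤ n) then (m : WithTop ℕ) else (n : WithTop ℕ) :=
    withTopElim fst snd (withTopElim (g := fun (p : (WithTop ℕ × WithTop ℕ) × ℕ) n =>
      bif decide (p.2 ≤ n) then (p.2 : WithTop ℕ) else (n : WithTop ℕ)) (by fun_prop)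
      (by fun_prop) (by fun_prop))
  have h' := h.comp (hf.prodMk hg)
  convert h' using 2 with x
  cases hf : f x with
  | top => simp [show (⊤ : WithTop ℕ) = none from rfl]; exact top_inf_eq _
  | coe m =>
    cases hg : g x with
    | top => exact inf_top_eq _
    | coe n =>
      change _ = bif decide (m ≤ n) then (m : WithTop ℕ) else (n : WithTop ℕ)
      by_cases hmn : m ≤ n
      · simp [hmn]
      · simp [hmn]; omega

end PolyFun

/-- Minimum over a list. -/
def minOver {β : Type} (l : List β) (f : β → WithTop ℕ) : WithTop ℕ := (l.map f).foldl min ⊤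

/-- Weights are specified by their finite upper bounds throughout; this avoids a case distinction at
⊤, also for the empty list. -/
theorem minOver_le_iff {β : Type} {l : List β} {f : β → WithTop ℕ} {n : ℕ} :
    minOver l f ≤ n ↔ ∃ b ∈ l, f b ≤ n := by
  have key : ∀ (l : List β) (s : WithTop ℕ),
      (l.map f).foldl min s ≤ n ↔ s ≤ n ∨ ∃ b ∈ l, f b ≤ n := by
    intro l
    induction l with
    | nil => simp
    | cons b l ih => intro s; simp [ih, or_assoc]
  rw [minOver, key]
  simp

namespace PolyFun

theorem minOver {α β : Type} [Enc α] [Enc β] {l : α → List β} {f : α → β → WithTop ℕ}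
    (hl : PolyFun l) (hf : PolyFun fun p : α × β => f p.1 p.2) :
    PolyFun fun x => ImpairVerif.minOver (l x) (f x) := by
  refine foldl_of_additive (f := fun _ s b => min s b) (hl.map hf) (const ⊤) (by fun_prop)
    ⟨.X, fun x s b => ?_⟩
  rw [Polynomial.eval_X, esize_pair]
  rcases min_choice s b with h | h <;> rw [h] <;> omega

end PolyFun

/-! ### The algorithm -/

/-- Vertices of the product, with numbers for states. -/
abbrev RawVertex := ℕ × ℕ × ℕ × Bool

/-- Inputs with numbers for states and letters, in the shape in which programs read them. -/
abbrev Raw := List ℕ × List ℕ × List ℕ × List ℕ × List ℕ × List (ℕ × ℕ) × List ℕ ×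
  List (List ℕ) × List ℕ × List ℕ × List (ℕ × List ℕ × ℕ × List ℕ × ℕ × Unit) × List ℕ ×
  List ℕ × List (ℕ × ℕ × ℕ × Unit) × Unit

namespace Raw

def cardS (r : Raw) : List ℕ := r.2.2.1
def cardQ (r : Raw) : List ℕ := r.2.2.2.1
def cardP (r : Raw) : List ℕ := r.2.2.2.2.1
def kTrans (r : Raw) : List (ℕ × ℕ) := r.2.2.2.2.2.1
def kStart (r : Raw) : List ℕ := r.2.2.2.2.2.2.1
def kLabel (r : Raw) : List (List ℕ) := r.2.2.2.2.2.2.2.1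
def tStart (r : Raw) : List ℕ := r.2.2.2.2.2.2.2.2.1
def tFinal (r : Raw) : List ℕ := r.2.2.2.2.2.2.2.2.2.1
def tTrans (r : Raw) : List (ℕ × List ℕ × ℕ × List ℕ × ℕ × Unit) := r.2.2.2.2.2.2.2.2.2.2.1
def bStart (r : Raw) : List ℕ := r.2.2.2.2.2.2.2.2.2.2.2.1
def bFinal (r : Raw) : List ℕ := r.2.2.2.2.2.2.2.2.2.2.2.2.1
def bTrans (r : Raw) : List (ℕ × ℕ × ℕ × Unit) := r.2.2.2.2.2.2.2.2.2.2.2.2.2.1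

/-- The numbers below the length of a list. -/
def rangeOf {β : Type} (l : List β) : List ℕ := l.zipIdx.map fun e => e.2

theorem rangeOf_eq {β : Type} (l : List β) : rangeOf l = List.range l.length := by
  rw [rangeOf, List.range_eq_range']
  exact List.zipIdx_map_snd 0 l

/-- All states of the automaton with a flag. -/
def flagged (r : Raw) : List (ℕ × Bool) :=
  (rangeOf (cardP r)).flatMap fun p => [(p, true), (p, false)]

/-- One step of the automaton on the letter `a`, from a set of states with flags. -/
def readStep (r : Raw) (s : List (ℕ × Bool)) (a : ℕ) : List (ℕ × Bool) :=
  (flagged r).filter fun e => s.any fun d => (bTrans r).any fun t =>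
    decide (t.1 = d.1) && decide (t.2.1 = a) && decide (t.2.2.1 = e.1) &&
      decide (e.2 = (d.2 || memb e.1 (bFinal r)))

/-- The states that are reached on `w`, with flags for visits of final states. -/
def readSet (r : Raw) (p : ℕ) (w : List ℕ) : List (ℕ × Bool) :=
  w.foldl (readStep r) [(p, false)]

/-- A transition of the machine makes a step of the product from `u` to `v`. -/
def fits (r : Raw) (u v : RawVertex) (e : ℕ × List ℕ × ℕ × List ℕ × ℕ × Unit) : Bool :=
  decide (e.1 = u.2.1) && decide (e.2.2.1 = v.2.1) && memb (e.2.1, u.1) (kLabel r).zipIdx &&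
    (readSet r u.2.2.1 e.2.2.2.1).any fun d => decide (d.1 = v.2.2.1) &&
      bif u.2.2.2 then decide (v.2.2.2 = !d.2) else decide (v.2.2.2 = memb v.2.1 (tFinal r))

/-- The weight of an edge, `⊤` if there is none. -/
def edgeWeight (r : Raw) (u v : RawVertex) : WithTop ℕ :=
  bif memb (u.1, v.1) (kTrans r) then
    minOver (tTrans r) fun e => bif fits r u v e then (e.2.2.2.2.1 : WithTop ℕ) else ⊤
  else ⊤

/-- All vertices of the product. -/
def verts (r : Raw) : List RawVertex :=
  (rangeOf (cardS r)).flatMap fun s => (rangeOf (cardQ r)).flatMap fun q =>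
    (flagged r).map fun p => (s, q, p.1, p.2)

/-- From least weights of walks to those of walks that are longer by one. -/
def distStep (r : Raw) (d : List (RawVertex × WithTop ℕ)) : List (RawVertex × WithTop ℕ) :=
  (verts r).map fun v => (v, minOver d fun e => e.2 + edgeWeight r e.1 v)

/-- Least weights of walks from `u` of the length of the list `l`. -/
def distVec (r : Raw) (u : RawVertex) (l : List ℕ) : List (RawVertex × WithTop ℕ) :=
  l.foldl (fun d _ => distStep r d) [(u, 0)]

/-- Least weight of a walk of length `k + 1`, for `k` less than the number of vertices. -/
def dist (r : Raw) (u v : RawVertex) (k : ℕ) : WithTop ℕ :=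
  minOver (distVec r u ((rangeOf (verts r)).filter fun i => decide (i ≤ k))) fun e =>
    bif decide (e.1 = v) then e.2 else ⊤

def isFinite (x : WithTop ℕ) : Bool := Option.elim x false fun _ => true

/-- Lengths up to the number of vertices suffice because loops can be erased; the empty walk is
treated separately. -/
def reach (r : Raw) (u v : RawVertex) : Bool :=
  decide (u = v) || (rangeOf (verts r)).any fun k => isFinite (dist r u v k)

def isInitial (r : Raw) (v : RawVertex) : Bool :=
  memb v.1 (kStart r) && memb v.2.1 (tStart r) && memb v.2.2.1 (bStart r) && !v.2.2.2

def isGood (r : Raw) (v : RawVertex) : Bool :=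
  ((verts r).any fun v₀ => isInitial r v₀ && reach r v₀ v) &&
    (verts r).any fun x => (verts r).any fun y =>
      x.2.2.2 && !y.2.2.2 && isFinite (edgeWeight r x y) && reach r v x && reach r y v

/-- Weights and lengths of closed walks. -/
def closedWalks (r : Raw) : List (ℕ × ℕ) :=
  (verts r).flatMap fun v => bif isGood r v then
    (rangeOf (verts r)).flatMap fun k => Option.elim (dist r v v k) [] fun d => [(d, k + 1)]
    else []

/-- The pair `(a, b)` with the least fraction `a / b`. -/
def leastFraction (l : List (ℕ × ℕ)) : Option (ℕ × ℕ) :=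
  l.foldl (fun s e => s.elim (some e) fun d =>
    bif decide (d.1 * e.2 ≤ e.1 * d.2) then some d else some e) none

def solve (r : Raw) : Data :=
  (leastFraction (closedWalks r)).elim (.num 0) enc

end Raw

/-! ### Running time of the algorithm -/

namespace PolyFun

variable {α : Type} [Enc α] {r : α → Raw}

@[fun_prop] theorem cardS (h : PolyFun r) : PolyFun fun x => (r x).cardS := by
  unfold Raw.cardS; fun_prop
@[fun_prop] theorem cardQ (h : PolyFun r) : PolyFun fun x => (r x).cardQ := by
  unfold Raw.cardQ; fun_prop
@[fun_prop] theorem cardP (h : PolyFun r) : PolyFun fun x => (r x).cardP := by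
  unfold Raw.cardP; fun_prop
@[fun_prop] theorem kTrans (h : PolyFun r) : PolyFun fun x => (r x).kTrans := by
  unfold Raw.kTrans; fun_prop
@[fun_prop] theorem kStart (h : PolyFun r) : PolyFun fun x => (r x).kStart := by
  unfold Raw.kStart; fun_prop
@[fun_prop] theorem kLabel (h : PolyFun r) : PolyFun fun x => (r x).kLabel := by
  unfold Raw.kLabel; fun_prop
@[fun_prop] theorem tStart (h : PolyFun r) : PolyFun fun x => (r x).tStart := by
  unfold Raw.tStart; fun_prop
@[fun_prop] theorem tFinal (h : PolyFun r) : PolyFun fun x => (r x).tFinal := by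
  unfold Raw.tFinal; fun_prop
@[fun_prop] theorem tTrans (h : PolyFun r) : PolyFun fun x => (r x).tTrans := by
  unfold Raw.tTrans; fun_prop
@[fun_prop] theorem bStart (h : PolyFun r) : PolyFun fun x => (r x).bStart := by
  unfold Raw.bStart; fun_prop
@[fun_prop] theorem bFinal (h : PolyFun r) : PolyFun fun x => (r x).bFinal := by
  unfold Raw.bFinal; fun_prop
@[fun_prop] theorem bTrans (h : PolyFun r) : PolyFun fun x => (r x).bTrans := by
  unfold Raw.bTrans; fun_prop

@[fun_prop]
theorem rangeOf {β : Type} [Enc β] {l : α → List β} (h : PolyFun l) :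
    PolyFun fun x => Raw.rangeOf (l x) := map (by fun_prop) (by fun_prop)

@[fun_prop]
theorem flagged (h : PolyFun r) : PolyFun fun x => (r x).flagged :=
  flatMap (by fun_prop) (by fun_prop)

@[fun_prop]
theorem readStep {s : α → List (ℕ × Bool)} {a : α → ℕ} (h : PolyFun r) (hs : PolyFun s)
    (ha : PolyFun a) : PolyFun fun x => (r x).readStep (s x) (a x) :=
  filter (by fun_prop) (any (by fun_prop) (any (by fun_prop) (by fun_prop)))

-- All intermediate sets are sublists of the list of flagged states, so their size stays bounded
-- along the word.
@[fun_prop]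
theorem readSet {p : α → ℕ} {w : α → List ℕ} (h : PolyFun r) (hp : PolyFun p) (hw : PolyFun w) :
    PolyFun fun x => (r x).readSet (p x) (w x) := by
  obtain ⟨q, hq⟩ := h.flagged.size_le
  refine foldl_of_additive (f := fun x => (r x).readStep) hw (by fun_prop) (by fun_prop)
    ⟨q, fun x s a => ?_⟩
  have h1 : esize ((r x).readStep s a) ≤ esize (r x).flagged :=
    esize_le_of_sublist List.filter_sublist
  have h2 := eval_le_eval q (show esize x ≤ esize (x, a) by rw [esize_pair]; omega)
  have h3 := hq x
  omega

theorem fits {u v : α → RawVertex} {e : α → ℕ × List ℕ × ℕ × List ℕ × ℕ × Unit} (h : PolyFun r)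
    (hu : PolyFun u) (hv : PolyFun v) (he : PolyFun e) :
    PolyFun fun x => (r x).fits (u x) (v x) (e x) :=
  and (by fun_prop) (any (by fun_prop) (by fun_prop))

@[fun_prop]
theorem edgeWeight {u v : α → RawVertex} (h : PolyFun r) (hu : PolyFun u) (hv : PolyFun v) :
    PolyFun fun x => (r x).edgeWeight (u x) (v x) :=
  cond (by fun_prop) (minOver (by fun_prop) (cond (fits (by fun_prop) (by fun_prop) (by fun_prop)
    (by fun_prop)) (by fun_prop) (by fun_prop))) (by fun_prop)

@[fun_prop]
theorem verts (h : PolyFun r) : PolyFun fun x => (r x).verts :=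
  flatMap (by fun_prop) (flatMap (by fun_prop) (map (by fun_prop) (by fun_prop)))

@[fun_prop]
theorem distStep {d : α → List (RawVertex × WithTop ℕ)} (h : PolyFun r) (hd : PolyFun d) :
    PolyFun fun x => (r x).distStep (d x) :=
  map (by fun_prop) (prodMk (by fun_prop) (minOver (by fun_prop) (by fun_prop)))

end PolyFun

namespace Raw

/-- One round adds at most one edge weight to each finite entry, so the values grow linearly and
their bit lengths stay small. The start `u₀` is listed separately since it need not be among the
vertices. -/
theorem foldl_distStep_bound {r : Raw} {Q : ℕ} {u₀ : RawVertex}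
    (hQ : ∀ u v : RawVertex, (u ∈ verts r ∨ u = u₀) → v ∈ verts r → ∀ n : ℕ,
      edgeWeight r u v = n → n ≤ 2 ^ Q) (l : List ℕ) :
    (distVec r u₀ l).length ≤ (verts r).length + 1 ∧
      ∀ e ∈ distVec r u₀ l, (e.1 ∈ verts r ∨ e.1 = u₀) ∧
        ∀ n : ℕ, e.2 = n → n ≤ l.length * 2 ^ Q := by
  induction l using List.reverseRecOn with
  | nil =>
    refine ⟨by simp [distVec], fun e he => ?_⟩
    obtain rfl := List.mem_singleton.1 he
    exact ⟨.inr rfl, fun n hn => by simp [← WithTop.coe_injective (a₁ := 0) (a₂ := n) hn]⟩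
  | append_singleton l a ih =>
    rw [distVec, List.foldl_append, List.foldl_cons, List.foldl_nil, ← distVec]
    refine ⟨by simp [distStep], fun e he => ?_⟩
    obtain ⟨v, hv, rfl⟩ := List.mem_map.1 he
    refine ⟨.inl hv, fun n hn => ?_⟩
    simp only at hn
    obtain ⟨b, hb, hbn⟩ := minOver_le_iff.1 hn.le
    have hmin : n ≤ b.2 + edgeWeight r b.1 v := by
      rw [← hn]
      cases hc : b.2 + edgeWeight r b.1 v with
      | top => exact le_top
      | coe m => exact minOver_le_iff.2 ⟨b, hb, hc.le⟩
    obtain ⟨h1, h2⟩ := ih.2 b hb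
    cases hx : b.2 with
    | top => rw [hx, top_add] at hbn; simp at hbn
    | coe i =>
      cases hy : edgeWeight r b.1 v with
      | top => rw [hy, add_top] at hbn; simp at hbn
      | coe j =>
        rw [hx, hy] at hmin
        have h3 : n ≤ i + j := WithTop.coe_le_coe.1 hmin
        have h4 := h2 i hx
        have h5 := hQ _ _ h1 hv j hy
        rw [List.length_append, List.length_singleton, Nat.succ_mul]
        omega

end Raw

namespace PolyFun

variable {α : Type} [Enc α] {r : α → Raw}

-- The rule for additive growth does not apply: a long entry of the old vector may enter many
-- entries of the new one. The size is bounded through the values and the number of entries instead.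
@[fun_prop]
theorem distVec {u : α → RawVertex} {l : α → List ℕ} (h : PolyFun r) (hu : PolyFun u)
    (hl : PolyFun l) : PolyFun fun x => (r x).distVec (u x) (l x) := by
  refine foldl (f := fun x d _ => (r x).distStep d) hl (by fun_prop) (by fun_prop) ?_
  obtain ⟨qw, hqw⟩ := (edgeWeight (r := fun p : Raw × RawVertex × RawVertex => p.1)
    (u := fun p => p.2.1) (v := fun p => p.2.2) (by fun_prop) (by fun_prop) (by fun_prop)).size_le
  obtain ⟨qr, hqr⟩ := h.size_le
  obtain ⟨qv, hqv⟩ := h.verts.size_le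
  obtain ⟨qu, hqu⟩ := hu.size_le
  obtain ⟨ql, hql⟩ := hl.size_le
  refine ⟨1 + (qv + 1) * (6 + (qu + qv) + ql + qw.comp (2 + qr + 2 * (qu + qv))),
    fun x l₁ hl₁ => ?_⟩
  set E := qu.eval (esize x) + qv.eval (esize x) with hE
  set Q := qw.eval (2 + qr.eval (esize x) + 2 * E) with hQ
  have h1 := hqr x
  have h2 := hqv x
  have h3 := hqu x
  have h4 := hql x
  have hmem : ∀ v : RawVertex, (v ∈ (r x).verts ∨ v = u x) → esize v ≤ E := by
    rintro v (hv | rfl)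
    · have := esize_le_of_mem hv
      omega
    · omega
  obtain ⟨hlen, hb⟩ := Raw.foldl_distStep_bound (r := r x) (Q := Q) (u₀ := u x)
    (fun v w hv hw n hn => by
      have h5 := hqw (r x, v, w)
      have h6 := hmem v hv
      have h7 := hmem w (.inl hw)
      have h8 := eval_le_eval qw (show esize (r x, v, w) ≤ 2 + qr.eval (esize x) + 2 * E by
        rw [esize_pair (r x) (v, w), esize_pair v w]; omega)
      simp only [hn] at h5
      have h9 : n.size ≤ esize ((n : ℕ) : WithTop ℕ) := by
        change n.size ≤ 1 + (1 + n.size) + 1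
        omega
      exact (Nat.size_le.1 (h9.trans (h5.trans h8))).le) l₁
  have hsize : esize ((r x).distVec (u x) l₁) ≤
      1 + ((r x).distVec (u x) l₁).length * ((5 + E + ql.eval (esize x) + Q) + 1) := by
    refine esize_le_of_forall fun e he => ?_
    obtain ⟨h5, h6⟩ := hb e he
    have h7 := hmem _ h5
    have h8 : esize e.2 ≤ 3 + ql.eval (esize x) + Q + 1 := by
      cases hc : e.2 with
      | top => change 1 ≤ _; omega
      | coe n =>
        change 1 + (1 + n.size) + 1 ≤ _
        have h9 := h6 n hc
        have h10 : l₁.length ≤ ql.eval (esize x) :=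
          (hl₁.length_le.trans (length_lt_esize _).le).trans h4
        -- The value is at most the length times 2 ^ Q, and a number is less than the power of two
        -- with itself as exponent.
        have h11 : n.size ≤ ql.eval (esize x) + Q := by
          rw [Nat.size_le, pow_add]
          refine lt_of_le_of_lt h9 ?_
          exact Nat.mul_lt_mul_of_pos_right (h10.trans_lt Nat.lt_two_pow_self) (by positivity)
        omega
    change 1 + esize e.1 + esize e.2 ≤ _
    omega
  have h5 : ((r x).distVec (u x) l₁).length ≤ qv.eval (esize x) + 1 := by
    have := length_lt_esize (r x).verts
    omega
  have h6 := Nat.mul_le_mul_right ((5 + E + ql.eval (esize x) + Q) + 1) h5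
  have e : ∀ k n : ℕ, Polynomial.eval n (k : Polynomial ℕ) = k := fun k n =>
    Polynomial.eval_natCast
  have e2 := e 2
  have e6 := e 6
  simp only [Nat.cast_ofNat] at e2 e6
  simp only [Polynomial.eval_add, Polynomial.eval_mul, Polynomial.eval_one, Polynomial.eval_comp,
    e2, e6, ← hE, ← hQ]
  change esize ((r x).distVec (u x) l₁) ≤ _
  rw [show 6 + E + ql.eval (esize x) + Q = 5 + E + ql.eval (esize x) + Q + 1 by omega]
  omega

-- The number k is in binary and cannot drive a loop. The filtered list of vertex numbers serves as
-- a unary clock that is never longer than the list of vertices.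
@[fun_prop]
theorem dist {u v : α → RawVertex} {k : α → ℕ} (h : PolyFun r) (hu : PolyFun u) (hv : PolyFun v)
    (hk : PolyFun k) : PolyFun fun x => (r x).dist (u x) (v x) (k x) :=
  minOver (distVec h hu (filter (by fun_prop) (by fun_prop))) (by fun_prop)

@[fun_prop]
theorem isFinite {o : α → WithTop ℕ} (h : PolyFun o) : PolyFun fun x => Raw.isFinite (o x) :=
  withTopElim h (by fun_prop) (by fun_prop)

@[fun_prop]
theorem reach {u v : α → RawVertex} (h : PolyFun r) (hu : PolyFun u) (hv : PolyFun v) :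
    PolyFun fun x => (r x).reach (u x) (v x) :=
  or (by fun_prop) (any (by fun_prop) (by fun_prop))

@[fun_prop]
theorem isInitial {u : α → RawVertex} (h : PolyFun r) (hu : PolyFun u) :
    PolyFun fun x => (r x).isInitial (u x) := by
  unfold Raw.isInitial; fun_prop

@[fun_prop]
theorem isGood {u : α → RawVertex} (h : PolyFun r) (hu : PolyFun u) :
    PolyFun fun x => (r x).isGood (u x) :=
  and (any (by fun_prop) (by fun_prop)) (any (by fun_prop) (any (by fun_prop) (by fun_prop)))

@[fun_prop]
theorem closedWalks (h : PolyFun r) : PolyFun fun x => (r x).closedWalks :=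
  flatMap (by fun_prop) (cond (by fun_prop) (flatMap (by fun_prop) (withTopElim (by fun_prop)
    (by fun_prop) (by fun_prop))) (by fun_prop))

@[fun_prop]
theorem leastFraction {l : α → List (ℕ × ℕ)} (h : PolyFun l) :
    PolyFun fun x => Raw.leastFraction (l x) := by
  refine foldl_of_additive (f := fun _ s e => s.elim (Option.some e) fun d =>
    bif decide (d.1 * e.2 ≤ e.1 * d.2) then Option.some d else Option.some e) h (const none)
    (optionElim (by fun_prop) (by fun_prop) (by fun_prop))
    ⟨.X + 2, fun x s e => ?_⟩
  have e2 : Polynomial.eval (esize (x, e)) (2 : Polynomial ℕ) = 2 :=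
    Polynomial.eval_natCast (n := 2)
  rw [Polynomial.eval_add, Polynomial.eval_X, e2, esize_pair]
  have h1 : esize (Option.some e) = 1 + esize e + 1 := rfl
  cases s with
  | none => rw [Option.elim_none, h1]; omega
  | some d =>
    rw [Option.elim_some]
    cases decide (d.1 * e.2 ≤ e.1 * d.2)
    · rw [cond_false, h1]; omega
    · rw [cond_true]; omega

theorem encode {α β : Type} [Enc α] [Enc β] {f : α → β} (h : PolyFun f) :
    PolyFun fun x => enc (f x) := h

theorem solve : PolyFun Raw.solve :=
  optionElim (by fun_prop) (by fun_prop) (encode (by fun_prop))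

end PolyFun

/-! ### Correctness of the algorithm -/

theorem NBA.reads_cons_iff {P Γ : Type*} {B : NBA P Γ} {p p' : P} {a : Γ} {w : List Γ} {b : Bool} :
    B.Reads p (a :: w) p' b ↔ ∃ q b', (p, a, q) ∈ B.trans ∧ B.Reads q w p' b' ∧
      (b = true ↔ q ∈ B.final ∨ b' = true) := by
  constructor
  · intro h
    cases h with
    | consFinal h hq hw => exact ⟨_, _, h, hw, by simp [hq]⟩
    | consOther h hq hw => exact ⟨_, _, h, hw, by simp [hq]⟩
  · rintro ⟨q, b', h, hw, hb⟩
    by_cases hq : q ∈ B.final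
    · rw [show b = true from hb.2 (.inl hq)]
      exact .consFinal h hq hw
    · rw [show b = b' from by rw [Bool.eq_iff_iff, hb]; simp [hq]]
      exact .consOther h hq hw

/-! ### Numbered data and the product graph they stand for -/

namespace Input

variable (I : Input)

/-- A set of letters as a bit vector. -/
def bits {n : ℕ} (a : Finset (Fin n)) : List ℕ :=
  (List.finRange n).map fun i => if i ∈ a then 1 else 0

theorem bits_injective {n : ℕ} : Function.Injective (bits (n := n)) := by
  intro a b h
  ext i
  have := List.map_inj_left.1 h i (List.mem_finRange i)
  by_cases h1 : i ∈ a <;> by_cases h2 : i ∈ b <;> simp_all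

/-- The input with numbers for states and letters. -/
def raw : Raw :=
  (List.replicate I.nAP 0, List.replicate I.nOut 0, List.replicate I.nS 0,
    List.replicate I.nQ 0, List.replicate I.nP 0,
    I.kTrans.map fun e => ((e.1 : ℕ), (e.2 : ℕ)), I.kStart.map Fin.val,
    (List.finRange I.nS).map fun s => bits (I.kLabel s), I.tStart.map Fin.val,
    I.tFinal.map Fin.val,
    I.tTrans.map fun e => ((e.1 : ℕ), bits e.2.1, (e.2.2.1 : ℕ), e.2.2.2.1.map Fin.val,
      e.2.2.2.2, ()),
    I.bStart.map Fin.val, I.bFinal.map Fin.val,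
    I.bTrans.map fun e => ((e.1 : ℕ), (e.2.1 : ℕ), (e.2.2 : ℕ), ()), ())

theorem enc_raw : enc I.raw = I.encode := by
  simp only [enc, raw, encode, encCard, encList, encFin, encLetter, bits, Data.ofList,
    List.map_replicate, List.map_map, Function.comp_def]
  rfl

/-- The number of a vertex of the product. -/
def num (v : PVertex (Fin I.nS) (Fin I.nQ) (Fin I.nP)) : RawVertex :=
  (v.1, v.2.1, v.2.2.1, v.2.2.2)

variable {I}

theorem num_injective : Function.Injective I.num := by
  rintro ⟨s, q, p, i⟩ ⟨s', q', p', i'⟩ h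
  simp only [num, Prod.mk.injEq] at h
  simp only [Prod.mk.injEq]
  exact ⟨Fin.ext h.1, Fin.ext h.2.1, Fin.ext h.2.2.1, h.2.2.2⟩

theorem val_mem_map {n : ℕ} {i : Fin n} {l : List (Fin n)} : (i : ℕ) ∈ l.map Fin.val ↔ i ∈ l := by
  simp [Fin.val_inj]

theorem mem_flagged {e : ℕ × Bool} : e ∈ I.raw.flagged ↔ e.1 < I.nP := by
  obtain ⟨p, _ | _⟩ := e <;> simp [Raw.flagged, Raw.rangeOf_eq, Raw.cardP, raw]

theorem mem_readStep {s : List (ℕ × Bool)} {a : Fin I.nOut} {e : ℕ × Bool} :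
    e ∈ I.raw.readStep s a ↔ ∃ (p q : Fin I.nP) (b : Bool), ((p : ℕ), b) ∈ s ∧
      (p, a, q) ∈ I.bTrans ∧ e = ((q : ℕ), (b || decide (q ∈ I.bFinal))) := by
  have hm : ∀ q : Fin I.nP, memb (q : ℕ) I.raw.bFinal = decide (q ∈ I.bFinal) := by
    intro q
    rw [Bool.eq_iff_iff, memb_iff, decide_eq_true_eq]
    exact val_mem_map
  rw [Raw.readStep, List.mem_filter, mem_flagged]
  simp only [List.any_eq_true, Bool.and_eq_true, decide_eq_true_eq]
  constructor
  · rintro ⟨-, ⟨p₀, b⟩, hd, t, ht, ⟨⟨h1, h2⟩, h3⟩, h4⟩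
    obtain ⟨⟨p, a', q⟩, htr, rfl⟩ := List.mem_map.1 ht
    simp only at h1 h2 h3 h4
    obtain rfl := Fin.ext h2
    subst h1
    refine ⟨p, q, b, hd, htr, ?_⟩
    rw [← h3, hm] at h4
    rw [← h4, h3]
  · rintro ⟨p, q, b, hs, ht, rfl⟩
    exact ⟨q.2, _, hs, _, List.mem_map.2 ⟨_, ht, rfl⟩, ⟨⟨rfl, rfl⟩, rfl⟩, by simp only [hm]⟩

/-- Arbitrary sets of start states with flags `b₀` are admitted for the sake of the induction: after
one letter there may be several states, some of them already flagged. -/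
theorem mem_foldl_readStep (w : List (Fin I.nOut)) : ∀ (s : List (ℕ × Bool)),
    (∀ e ∈ s, e.1 < I.nP) → ∀ e : ℕ × Bool, e ∈ (w.map Fin.val).foldl I.raw.readStep s ↔
      ∃ (p q : Fin I.nP) (b₀ b : Bool), ((p : ℕ), b₀) ∈ s ∧ I.automaton.Reads p w q b ∧
        e = ((q : ℕ), (b₀ || b)) := by
  induction w with
  | nil =>
    intro s hs e
    constructor
    · intro he
      exact ⟨⟨e.1, hs e he⟩, ⟨e.1, hs e he⟩, e.2, false, he, .nil _, by simp⟩
    · rintro ⟨p, q, b₀, b, hp, hr, rfl⟩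
      cases hr
      simpa using hp
  | cons a w ih =>
    intro s hs e
    rw [List.map_cons, List.foldl_cons, ih (I.raw.readStep s a) fun e he =>
      mem_flagged.1 (List.mem_filter.1 he).1]
    constructor
    · rintro ⟨p₁, q, b₁, b, hp₁, hr, rfl⟩
      obtain ⟨p, p₂, b₀, hp, ht, he⟩ := mem_readStep.1 hp₁
      obtain ⟨h1, rfl⟩ := Prod.mk.inj he
      obtain rfl := Fin.ext h1
      refine ⟨p, q, b₀, decide (p₁ ∈ I.bFinal) || b, hp,
        NBA.reads_cons_iff.2 ⟨p₁, b, ht, hr, ?_⟩, by rw [Bool.or_assoc]⟩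
      simp [automaton]
    · rintro ⟨p, q, b₀, b, hp, hr, rfl⟩
      obtain ⟨p₁, b', ht, hr', hb⟩ := NBA.reads_cons_iff.1 hr
      refine ⟨p₁, q, _, b', mem_readStep.2 ⟨p, p₁, b₀, hp, ht, rfl⟩, hr', ?_⟩
      rw [show b = (decide (p₁ ∈ I.bFinal) || b') from by
        rw [Bool.eq_iff_iff, hb]; simp [automaton], Bool.or_assoc]

theorem mem_readSet {p q : Fin I.nP} {w : List (Fin I.nOut)} {b : Bool} :
    ((q : ℕ), b) ∈ I.raw.readSet p (w.map Fin.val) ↔ I.automaton.Reads p w q b := by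
  rw [Raw.readSet, mem_foldl_readStep w _ (by simp)]
  constructor
  · rintro ⟨p', q', b₀, b', hp, hr, he⟩
    simp only [List.mem_singleton, Prod.mk.injEq] at hp
    obtain ⟨h1, rfl⟩ := hp
    obtain ⟨h2, rfl⟩ := Prod.mk.inj he
    rw [← Fin.ext h1, Fin.ext h2]
    simpa using hr
  · intro h
    exact ⟨p, q, false, b, by simp, h, by simp⟩

theorem exists_mem_readSet {p : Fin I.nP} {w : List (Fin I.nOut)} {f : ℕ × Bool → Bool} :
    (I.raw.readSet p (w.map Fin.val)).any f = true ↔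
      ∃ q b, I.automaton.Reads p w q b ∧ f ((q : ℕ), b) = true := by
  rw [List.any_eq_true]
  constructor
  · rintro ⟨e, he, hf⟩
    obtain ⟨p', q, b₀, b, -, -, rfl⟩ := (mem_foldl_readStep w _ (by simp) e).1 he
    exact ⟨q, _, mem_readSet.1 he, hf⟩
  · rintro ⟨q, b, hr, hf⟩
    exact ⟨_, mem_readSet.2 hr, hf⟩

theorem memb_kLabel {s : Fin I.nS} {l : List ℕ} :
    memb (l, (s : ℕ)) I.raw.kLabel.zipIdx = true ↔ l = bits (I.kLabel s) := by
  rw [memb_iff, List.mem_zipIdx_iff_getElem?]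
  simp [Raw.kLabel, raw, eq_comm]

theorem fits_iff {u v : PVertex (Fin I.nS) (Fin I.nQ) (Fin I.nP)}
    {e : Fin I.nQ × Finset (Fin I.nAP) × Fin I.nQ × List (Fin I.nOut) × ℕ} :
    I.raw.fits (I.num u) (I.num v) ((e.1 : ℕ), bits e.2.1, (e.2.2.1 : ℕ), e.2.2.2.1.map Fin.val,
      e.2.2.2.2, ()) = true ↔ e.1 = u.2.1 ∧ e.2.2.1 = v.2.1 ∧ e.2.1 = I.kLabel u.1 ∧
        ∃ b : Bool, I.automaton.Reads u.2.2.1 e.2.2.2.1 v.2.2.1 b ∧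
          (u.2.2.2 = false → (v.2.2.2 = true ↔ v.2.1 ∈ I.machine.final)) ∧
          (u.2.2.2 = true → (v.2.2.2 = false ↔ b = true)) := by
  obtain ⟨s, q, p, i⟩ := u
  obtain ⟨s', q', p', i'⟩ := v
  have hf : memb (q' : ℕ) I.raw.tFinal = decide (q' ∈ I.tFinal) := by
    rw [Bool.eq_iff_iff, memb_iff, decide_eq_true_eq]
    exact val_mem_map
  simp only [Raw.fits, num, Bool.and_eq_true, decide_eq_true_eq, memb_kLabel, exists_mem_readSet,
    bits_injective.eq_iff, Fin.val_inj, and_assoc, hf]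
  refine and_congr_right fun _ => and_congr_right fun _ => and_congr_right fun _ => ?_
  constructor
  · rintro ⟨p₁, b, hr, rfl, h⟩
    refine ⟨b, hr, ?_⟩
    cases i
    · simp only [cond_false, decide_eq_true_eq] at h
      simp [h, machine]
    · have h' : i' = !b := of_decide_eq_true h
      simp [h']
  · rintro ⟨b, hr, h1, h2⟩
    refine ⟨p', b, hr, rfl, ?_⟩
    cases i
    · simp only [cond_false, decide_eq_true_eq]
      rw [Bool.eq_iff_iff, h1 rfl]
      simp [machine]
    · have := h2 rfl
      refine decide_eq_true ?_
      cases i' <;> cases b <;> simp_all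

theorem edgeWeight_le_iff_step {u v : PVertex (Fin I.nS) (Fin I.nQ) (Fin I.nP)} {n : ℕ} :
    I.raw.edgeWeight (I.num u) (I.num v) ≤ n ↔
      ∃ w c, Step I.kripke I.machine I.automaton u v w c ∧ c ≤ n := by
  have hk : memb ((I.num u).1, (I.num v).1) I.raw.kTrans = true ↔ (u.1, v.1) ∈ I.kTrans := by
    rw [memb_iff]
    simp only [Raw.kTrans, raw, List.mem_map, num, Prod.mk.injEq, Fin.val_inj, Prod.exists]
    constructor
    · rintro ⟨a, b, h, rfl, rfl⟩
      exact h
    · exact fun h => ⟨_, _, h, rfl, rfl⟩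
  rw [Raw.edgeWeight]
  by_cases huv : (u.1, v.1) ∈ I.kTrans
  · rw [hk.2 huv, cond_true, minOver_le_iff]
    constructor
    · rintro ⟨_, ht, hle⟩
      obtain ⟨e, he, rfl⟩ := List.mem_map.1 ht
      by_cases hfit : I.raw.fits (I.num u) (I.num v) ((e.1 : ℕ), bits e.2.1, (e.2.2.1 : ℕ),
        e.2.2.2.1.map Fin.val, e.2.2.2.2, ()) = true
      · rw [hfit, cond_true] at hle
        obtain ⟨h1, h2, h3, h4⟩ := fits_iff.1 hfit
        refine ⟨e.2.2.2.1, e.2.2.2.2, ⟨huv, ⟨I.kLabel u.1, rfl, ?_⟩, h4⟩, WithTop.coe_le_coe.1 hle⟩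
        simp only [← h1, ← h2, ← h3]
        exact he
      · rw [Bool.not_eq_true] at hfit
        rw [hfit, cond_false] at hle
        simp at hle
    · rintro ⟨w, c, ⟨-, ⟨a, ha, ht⟩, h4⟩, hc⟩
      have ha' : a = I.kLabel u.1 := by
        ext x
        exact (Set.ext_iff.1 ha x).symm
      refine ⟨_, List.mem_map.2 ⟨_, ht, rfl⟩, ?_⟩
      have := (fits_iff (u := u) (v := v) (e := (u.2.1, a, v.2.1, w, c))).2 ⟨rfl, rfl, ha', h4⟩
      simp only at this ⊢
      rw [this, cond_true]
      exact WithTop.coe_le_coe.2 hc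
  · rw [show memb ((I.num u).1, (I.num v).1) I.raw.kTrans = false from by
      rw [← Bool.not_eq_true, hk]; exact huv, cond_false]
    constructor
    · intro h
      simp at h
    · rintro ⟨w, c, h, -⟩
      exact absurd h.1 huv

local notation "E[" I "]" => Edge (Input.kripke I) (Input.machine I) (Input.automaton I)
local notation "W[" I "]" => weight (Input.kripke I) (Input.machine I) (Input.automaton I)

theorem edgeWeight_le_iff {u v : PVertex (Fin I.nS) (Fin I.nQ) (Fin I.nP)} {n : ℕ} :
    I.raw.edgeWeight (I.num u) (I.num v) ≤ n ↔ E[I] u v ∧ W[I] u v ≤ n := by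
  rw [edgeWeight_le_iff_step]
  constructor
  · rintro ⟨w, c, h, hc⟩
    exact ⟨⟨w, c, h⟩, (weight_le_of_step h).trans hc⟩
  · rintro ⟨h, hn⟩
    obtain ⟨w, hw⟩ := exists_step_weight h
    exact ⟨w, _, hw, hn⟩

theorem mem_verts {x : RawVertex} : x ∈ I.raw.verts ↔ ∃ v, I.num v = x := by
  obtain ⟨s, q, p, i⟩ := x
  simp only [Raw.verts, Raw.rangeOf_eq, List.mem_flatMap, List.mem_map, mem_flagged,
    List.mem_range, Prod.mk.injEq, num]
  constructor
  · rintro ⟨s', hs, q', hq, ⟨p', i'⟩, hp, rfl, rfl, rfl, rfl⟩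
    simp only [Raw.cardS, Raw.cardQ, raw, List.length_replicate] at hs hq
    exact ⟨(⟨s', hs⟩, ⟨q', hq⟩, ⟨p', hp⟩, i'), rfl, rfl, rfl, rfl⟩
  · rintro ⟨⟨s', q', p', i'⟩, rfl, rfl, rfl, rfl⟩
    exact ⟨s', by simp [Raw.cardS, raw], q', by simp [Raw.cardQ, raw], (p', i'), p'.2, rfl, rfl,
      rfl, rfl⟩

/-- Counting needs no absence of duplicates in the list of vertices: it contains the image of l,
which has no duplicates. -/
theorem length_le_of_nodup {l : List (PVertex (Fin I.nS) (Fin I.nQ) (Fin I.nP))} (h : l.Nodup) :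
    l.length ≤ I.raw.verts.length := by
  have h1 : (l.map I.num).Nodup := h.map num_injective
  have h2 := (h1.subperm fun x hx => by
    obtain ⟨v, -, rfl⟩ := List.mem_map.1 hx
    exact mem_verts.2 ⟨v, rfl⟩ : (l.map I.num).Subperm I.raw.verts).length_le
  rwa [List.length_map] at h2

theorem add_le_natCast_iff {a b : WithTop ℕ} {n : ℕ} :
    a + b ≤ n ↔ ∃ i j : ℕ, a ≤ i ∧ b ≤ j ∧ i + j ≤ n := by
  constructor
  · intro h
    cases a with
    | top => simp at h
    | coe i =>
      cases b with
      | top => simp at h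
      | coe j => exact ⟨i, j, le_rfl, le_rfl, WithTop.coe_le_coe.1 h⟩
  · rintro ⟨i, j, h1, h2, h3⟩
    refine (add_le_add h1 h2).trans ?_
    exact_mod_cast h3

/-- The entries of the list l play no role; its length is the exact number of edges. A longer walk
is split at its last edge, and the best weight is kept for each end vertex. -/
theorem mem_distVec {u : PVertex (Fin I.nS) (Fin I.nQ) (Fin I.nP)} (l : List ℕ) :
    (∀ e ∈ I.raw.distVec (I.num u) l, ∃ v, I.num v = e.1) ∧ ∀ v (n : ℕ),
      (∃ x, (I.num v, x) ∈ I.raw.distVec (I.num u) l ∧ x ≤ n) ↔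
        ∃ m, IsWalk E[I] u m v ∧ m.length = l.length ∧ pathWeight W[I] (u :: m) ≤ n := by
  induction l using List.reverseRecOn with
  | nil =>
    refine ⟨fun e he => ⟨u, by rw [List.mem_singleton.1 he]⟩, fun v n => ?_⟩
    simp only [Raw.distVec, List.foldl_nil, List.mem_singleton, Prod.mk.injEq,
      num_injective.eq_iff, List.length_nil, List.length_eq_zero_iff]
    constructor
    · rintro ⟨x, ⟨rfl, rfl⟩, -⟩
      exact ⟨[], rfl, rfl, Nat.zero_le _⟩
    · rintro ⟨m, h, rfl, -⟩
      exact ⟨0, ⟨(show u = v from h).symm, rfl⟩, bot_le⟩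
  | append_singleton l a ih =>
    rw [Raw.distVec, List.foldl_append, List.foldl_cons, List.foldl_nil, ← Raw.distVec]
    refine ⟨fun e he => ?_, fun v n => ?_⟩
    · obtain ⟨v, hv, rfl⟩ := List.mem_map.1 he
      exact mem_verts.1 hv
    · have h1 : (∃ x, (I.num v, x) ∈ I.raw.distStep (I.raw.distVec (I.num u) l) ∧ x ≤ n) ↔
          minOver (I.raw.distVec (I.num u) l)
            (fun e => e.2 + I.raw.edgeWeight e.1 (I.num v)) ≤ n := by
        simp only [Raw.distStep, List.mem_map, Prod.mk.injEq]
        constructor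
        · rintro ⟨x, ⟨v', _, rfl, rfl⟩, hx⟩
          exact hx
        · exact fun h => ⟨_, ⟨_, mem_verts.2 ⟨v, rfl⟩, rfl, rfl⟩, h⟩
      rw [h1, minOver_le_iff]
      constructor
      · rintro ⟨⟨z, x⟩, he, hle⟩
        obtain ⟨z, rfl⟩ := ih.1 _ he
        obtain ⟨i, j, hi, hj, hij⟩ := add_le_natCast_iff.1 hle
        obtain ⟨m, hm, hml, hmw⟩ := (ih.2 z i).1 ⟨x, he, hi⟩
        obtain ⟨he, hw⟩ := edgeWeight_le_iff.1 hj
        refine ⟨m ++ [v], hm.append ⟨he, rfl⟩, by simp [hml], ?_⟩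
        rw [hm.pathWeight_append]
        simp only [pathWeight]
        omega
      · rintro ⟨m, hm, hml, hmw⟩
        obtain ⟨m, rfl⟩ := hm.exists_eq_append (by
          intro h; subst h; simp at hml)
        obtain ⟨z, hz, he, -⟩ := isWalk_append.1 hm
        rw [hz.pathWeight_append] at hmw
        simp only [pathWeight, Nat.add_zero] at hmw
        obtain ⟨x, hx, hxw⟩ := (ih.2 z (pathWeight W[I] (u :: m))).2
          ⟨m, hz, by simpa using hml, le_rfl⟩
        exact ⟨_, hx, add_le_natCast_iff.2 ⟨_, _, hxw, edgeWeight_le_iff.2 ⟨he, le_rfl⟩, hmw⟩⟩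

theorem dist_le_iff {u v : PVertex (Fin I.nS) (Fin I.nQ) (Fin I.nP)} {k n : ℕ}
    (hk : k < I.raw.verts.length) : I.raw.dist (I.num u) (I.num v) k ≤ n ↔
      ∃ m, IsWalk E[I] u m v ∧ m.length = k + 1 ∧ pathWeight W[I] (u :: m) ≤ n := by
  -- The clock has k + 1 ticks only because k is below the number of listed vertices.
  have hlen : ((Raw.rangeOf I.raw.verts).filter fun i => decide (i ≤ k)).length = k + 1 := by
    rw [Raw.rangeOf_eq, ← List.countP_eq_length_filter]
    obtain ⟨d, hd⟩ := Nat.exists_eq_add_of_lt hk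
    rw [hd, show k + d + 1 = (k + 1) + d by omega, List.range_add, List.countP_append,
      List.countP_eq_length.2, List.countP_eq_zero.2]
    · simp
    · intro a ha
      obtain ⟨b, -, rfl⟩ := List.mem_map.1 ha
      simp; omega
    · intro a ha
      have := List.mem_range.1 ha
      simp; omega
  have := (mem_distVec (u := u) ((Raw.rangeOf I.raw.verts).filter fun i => decide (i ≤ k))).2 v n
  rw [hlen] at this
  rw [← this, Raw.dist, minOver_le_iff]
  constructor
  · rintro ⟨⟨z, x⟩, he, hle⟩
    by_cases hz : z = I.num v
    · subst hz
      exact ⟨x, he, by simpa using hle⟩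
    · simp [hz] at hle
  · rintro ⟨x, he, hx⟩
    exact ⟨_, he, by simpa using hx⟩

theorem isFinite_iff {x : WithTop ℕ} : Raw.isFinite x = true ↔ ∃ n : ℕ, x ≤ n := by
  cases x with
  | top => exact ⟨fun h => absurd h (by decide), fun ⟨n, hn⟩ => absurd hn (by simp)⟩
  | coe n => exact ⟨fun _ => ⟨n, le_rfl⟩, fun _ => rfl⟩

theorem reach_iff {u v : PVertex (Fin I.nS) (Fin I.nQ) (Fin I.nP)} :
    I.raw.reach (I.num u) (I.num v) = true ↔
      Reaches I.kripke I.machine I.automaton u v := by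
  simp only [Raw.reach, Bool.or_eq_true, decide_eq_true_eq, num_injective.eq_iff, List.any_eq_true,
    Raw.rangeOf_eq, List.mem_range]
  constructor
  · rintro (rfl | ⟨k, hk, h⟩)
    · exact .refl
    · obtain ⟨n, hn⟩ := isFinite_iff.1 h
      obtain ⟨m, hm, -⟩ := (dist_le_iff hk).1 hn
      exact hm.reflTransGen
  · intro h
    obtain ⟨m, hm, hnd⟩ := exists_nodup_walk h
    rcases m with _ | ⟨y, m⟩
    · exact .inl hm
    · have := length_le_of_nodup hnd
      simp only [List.length_cons] at this
      have hk : m.length < I.raw.verts.length := by omega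
      exact .inr ⟨m.length, hk, isFinite_iff.2 ⟨_, (dist_le_iff hk).2 ⟨_, hm, rfl, le_rfl⟩⟩⟩

theorem isInitial_iff {v : PVertex (Fin I.nS) (Fin I.nQ) (Fin I.nP)} :
    I.raw.isInitial (I.num v) = true ↔
      v ∈ initialVertices I.kripke I.machine I.automaton := by
  simp only [Raw.isInitial, Bool.and_eq_true, memb_iff, and_assoc, Bool.not_eq_true']
  exact and_congr val_mem_map (and_congr val_mem_map (and_congr val_mem_map Iff.rfl))

theorem exists_mem_verts {f : RawVertex → Bool} :
    I.raw.verts.any f = true ↔ ∃ v, f (I.num v) = true := by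
  rw [List.any_eq_true]
  constructor
  · rintro ⟨x, hx, hf⟩
    obtain ⟨v, rfl⟩ := mem_verts.1 hx
    exact ⟨v, hf⟩
  · rintro ⟨v, hf⟩
    exact ⟨_, mem_verts.2 ⟨v, rfl⟩, hf⟩

theorem isGood_iff {v : PVertex (Fin I.nS) (Fin I.nQ) (Fin I.nP)} :
    I.raw.isGood (I.num v) = true ↔ IsGood I.kripke I.machine I.automaton v := by
  have he : ∀ x y, Raw.isFinite (I.raw.edgeWeight (I.num x) (I.num y)) = true ↔ E[I] x y := by
    intro x y
    rw [isFinite_iff]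
    exact ⟨fun ⟨n, hn⟩ => (edgeWeight_le_iff.1 hn).1,
      fun h => ⟨_, edgeWeight_le_iff.2 ⟨h, le_rfl⟩⟩⟩
  simp only [Raw.isGood, Bool.and_eq_true, exists_mem_verts, isInitial_iff, reach_iff, he, IsGood,
    AcceptingEdge, Bool.not_eq_true']
  refine and_congr Iff.rfl (exists_congr fun x => exists_congr fun y => ?_)
  simp only [num]
  tauto

theorem mem_closedWalks {e : ℕ × ℕ} : e ∈ I.raw.closedWalks ↔
    ∃ v, IsGood I.kripke I.machine I.automaton v ∧ ∃ k < I.raw.verts.length,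
      I.raw.dist (I.num v) (I.num v) k = (e.1 : WithTop ℕ) ∧ e.2 = k + 1 := by
  simp only [Raw.closedWalks, List.mem_flatMap, Raw.rangeOf_eq]
  constructor
  · rintro ⟨x, hx, he⟩
    obtain ⟨v, rfl⟩ := mem_verts.1 hx
    cases hg : I.raw.isGood (I.num v) with
    | false => simp [hg] at he
    | true =>
      rw [hg, cond_true, List.mem_flatMap] at he
      obtain ⟨k, hk, he⟩ := he
      refine ⟨v, isGood_iff.1 hg, k, List.mem_range.1 hk, ?_⟩
      cases hd : I.raw.dist (I.num v) (I.num v) k with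
      | top => rw [hd] at he; exact absurd he (by simp [show (⊤ : WithTop ℕ) = none from rfl])
      | coe d =>
        rw [hd] at he
        obtain rfl := List.mem_singleton.1 he
        exact ⟨rfl, rfl⟩
  · rintro ⟨v, hg, k, hk, hd, he⟩
    refine ⟨_, mem_verts.2 ⟨v, rfl⟩, ?_⟩
    rw [isGood_iff.2 hg, cond_true, List.mem_flatMap]
    refine ⟨k, List.mem_range.2 hk, ?_⟩
    rw [hd, ← he]
    exact List.mem_singleton.2 rfl

/-- Cycles through good vertices are taken into account. -/
theorem exists_mem_closedWalks {x : PVertex (Fin I.nS) (Fin I.nQ) (Fin I.nP)}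
    {L : List (PVertex (Fin I.nS) (Fin I.nQ) (Fin I.nP))}
    (h : IsCandidate I.kripke I.machine I.automaton (x :: L)) :
    ∃ a ≤ pathWeight W[I] (x :: (L ++ [x])), (a, L.length + 1) ∈ I.raw.closedWalks := by
  have hk : L.length < I.raw.verts.length := length_le_of_nodup h.1.2
  have hw := isClosedWalk_cons.1 h.1.1
  have hd := (dist_le_iff (u := x) (v := x) hk).2 ⟨_, hw, by simp, le_rfl⟩
  cases hc : I.raw.dist (I.num x) (I.num x) L.length with
  | top => rw [hc] at hd; simp at hd
  | coe a =>
    rw [hc] at hd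
    exact ⟨a, WithTop.coe_le_coe.1 hd,
      mem_closedWalks.2 ⟨x, h.isGood List.mem_cons_self, _, hk, hc, rfl⟩⟩

theorem leastFraction_eq_none {l : List (ℕ × ℕ)} (h : Raw.leastFraction l = none) : l = [] := by
  have key : ∀ (l : List (ℕ × ℕ)) (s : Option (ℕ × ℕ)), l.foldl (fun s e => s.elim (some e) fun d =>
      bif decide (d.1 * e.2 ≤ e.1 * d.2) then some d else some e) s = none → s = none ∧ l = [] := by
    intro l
    induction l with
    | nil => exact fun s h => ⟨h, rfl⟩
    | cons e l ih =>
      intro s hs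
      have := (ih _ hs).1
      cases s with
      | none => simp at this
      | some d =>
        simp only [Option.elim_some] at this
        cases h : decide (d.1 * e.2 ≤ e.1 * d.2) <;> simp [h] at this
  exact (key l none h).2

theorem leastFraction_eq_some {l : List (ℕ × ℕ)} (hl : ∀ e ∈ l, 0 < e.2) {d : ℕ × ℕ}
    (h : Raw.leastFraction l = some d) : d ∈ l ∧ ∀ e ∈ l, d.1 * e.2 ≤ e.1 * d.2 := by
  induction l using List.reverseRecOn generalizing d with
  | nil => simp [Raw.leastFraction] at h
  | append_singleton l e ih =>
    rw [Raw.leastFraction, List.foldl_append, List.foldl_cons, List.foldl_nil,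
      ← Raw.leastFraction] at h
    cases hc : Raw.leastFraction l with
    | none =>
      rw [hc, Option.elim_none] at h
      obtain rfl := Option.some.inj h
      obtain rfl := leastFraction_eq_none hc
      simp
    | some c =>
      obtain ⟨h1, h2⟩ := ih (fun x hx => hl x (List.mem_append_left _ hx)) hc
      have hc0 := hl c (List.mem_append_left _ h1)
      rw [hc, Option.elim_some] at h
      by_cases hle : c.1 * e.2 ≤ e.1 * c.2
      · simp only [hle, decide_true, cond_true, Option.some.injEq] at h
        subst h
        refine ⟨List.mem_append_left _ h1, fun x hx => ?_⟩
        rcases List.mem_append.1 hx with hx | hx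
        · exact h2 x hx
        · rwa [List.mem_singleton.1 hx]
      · simp only [hle, decide_false, cond_false, Option.some.injEq] at h
        subst h
        refine ⟨by simp, fun x hx => ?_⟩
        rcases List.mem_append.1 hx with hx | hx
        · have h3 := h2 x hx
          -- Transitivity of the order of fractions in cross-multiplied form; the positive
          -- denominator of the previous minimum c is cancelled.
          refine le_of_mul_le_mul_right (a := c.2) ?_ hc0
          have h4 := Nat.mul_le_mul_right x.2 (not_le.1 hle).le
          have h5 := Nat.mul_le_mul_right e.2 h3
          calc e.1 * x.2 * c.2 = e.1 * c.2 * x.2 := by ring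
            _ ≤ c.1 * e.2 * x.2 := h4
            _ = c.1 * x.2 * e.2 := by ring
            _ ≤ x.1 * c.2 * e.2 := h5
            _ = x.1 * e.2 * c.2 := by ring
        · rw [List.mem_singleton.1 hx]

/-- Every listed pair comes from a closed walk at a good vertex, hence its fraction is at least the
mean of a least-mean cycle. That cycle is simple, so its length is among those tried, and the pair
listed for this length is at least as good. Simplicity of walks never has to be tested. -/
theorem represents_solve (I : Input) : Represents (Raw.solve I.raw) I.threshold := by
  rw [Raw.solve]
  cases hl : Raw.leastFraction I.raw.closedWalks with
  | none =>
    refine .inl ⟨rfl, impairThreshold_eq_top ?_⟩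
    rintro ⟨C, hC⟩
    obtain ⟨x, L, rfl⟩ := List.exists_cons_of_ne_nil hC.1.1.1
    obtain ⟨a, -, ha⟩ := exists_mem_closedWalks hC.isCandidate
    rw [leastFraction_eq_none hl] at ha
    simp at ha
  | some d =>
    obtain ⟨hd, hmin⟩ := leastFraction_eq_some (fun e he => by
      obtain ⟨_, _, k, _, _, hk⟩ := mem_closedWalks.1 he
      omega) hl
    obtain ⟨v, hg, k, hk, hdist, hdk⟩ := mem_closedWalks.1 hd
    refine .inr ⟨d.1, d.2, by omega, rfl, ?_⟩
    obtain ⟨⟨v₀, h0, h1⟩, x, y, hacc, h2, h3⟩ := id hg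
    obtain ⟨C₂, hC₂, hC₂', hy⟩ := exists_accepting_cycle hacc (h3.trans h2)
    obtain ⟨C, hC⟩ := exists_isLeastMeanCycle
      ⟨C₂, hC₂, hC₂', v₀, h0, y, hy, (h1.trans h2).tail hacc.1⟩
    rw [threshold, hC.main.1]
    obtain ⟨z, L, rfl⟩ := List.exists_cons_of_ne_nil hC.1.1.1.1
    rw [cycleMean_cons]
    refine le_antisymm ?_ ?_
    · rw [natCast_div_le_div_iff (Nat.succ_pos _) (by omega)]
      obtain ⟨m, hm, hml, hmw⟩ := (dist_le_iff hk).1 hdist.le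
      have hb := hC.closedWalk_bound hg hm
      rw [hml, ← hdk] at hb
      exact hb.trans (by rw [mul_comm]; exact Nat.mul_le_mul_right _ hmw)
    · rw [natCast_div_le_div_iff (by omega) (Nat.succ_pos _)]
      obtain ⟨a, ha, hamem⟩ := exists_mem_closedWalks hC.1
      exact (hmin _ hamem).trans (Nat.mul_le_mul_right _ ha)

end Input

theorem computableInPolyTime_threshold : ComputableInPolyTime Input.threshold := by
  obtain ⟨prog, q, h⟩ := PolyFun.solve
  refine ⟨prog, q, fun I => ?_⟩
  obtain ⟨t, h1, h2⟩ := h I.raw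
  rw [esize, I.enc_raw] at h2
  rw [I.enc_raw] at h1
  exact ⟨_, t, h1, h2, I.represents_solve⟩

end ImpairVerif

theorem theorem6 :
    (∀ (AP Γ S Q P : Type*) [Finite S] [Finite Q] [Finite P] (K : Kripke S AP)
      (T : RepairMachine Q (Set AP) Γ) (B : NBA P Γ),
      ((¬ ∃ C, IsAccessibleAcceptingCycle K T B C) → impairThreshold K T B = ⊤) ∧
      ((∃ C, IsAccessibleAcceptingCycle K T B C) →
        (∃ C, IsLeastMeanCycle K T B C) ∧
        (∀ C, IsLeastMeanCycle K T B C → impairThreshold K T B = cycleMean K T B C) ∧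
        (∃ (σ : Strategy (PVertex S Q P) Γ) (h C D : List (PVertex S Q P)),
          IsLeastMeanCycle K T B C ∧ IsClosedWalk K T B D ∧ IsAccepting K T B D ∧
          C.head? = D.head? ∧ IsRoundPlay h C D σ.play ∧
          Impairs K T B σ ∧ meanCost (outcome K T B σ).cost = impairThreshold K T B) ∧
        (∀ ε : ℝ≥0, 0 < ε → ∃ σ : Strategy (PVertex S Q P) Γ, σ.FiniteMemory ∧
          Impairs K T B σ ∧
          meanCost (outcome K T B σ).cost ≤ impairThreshold K T B + (ε : ℝ≥0∞)))) ∧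
    ComputableInPolyTime Input.threshold := by
  refine ⟨fun AP Γ S Q P _ _ _ K T B => ⟨impairThreshold_eq_top, fun hex => ?_⟩,
    computableInPolyTime_threshold⟩
  obtain ⟨C, hC⟩ := exists_isLeastMeanCycle hex
  obtain ⟨-, ⟨σ, h, D, hσ⟩, hε⟩ := hC.main
  exact ⟨⟨C, hC⟩, fun C' hC' => hC'.main.1, ⟨σ, h, C, D, hC, hσ⟩, hε⟩
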